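/- Let $\mathrm{e}_1,\mathrm{e}_2$ be the standard basis of $\mathbb{C}^2$, and equip $\otimes^3\mathbb{C}^2$ with the Hilbert–Schmidt inner product $\langle\cdot,\cdot\rangle$ and norm. Let $\|\mathcal{T}\|_\infty=\max\{|\langle \mathcal{T},x\otimes y\otimes z\rangle| : \|x\|=\|y\|=\|z\|=1\}$ be the spectral norm and let $\|\mathcal{T}\|_1=\max\{\operatorname{Re}\langle \mathcal{T},\mathcal{X}\rangle : \|\mathcal{X}\|_\infty\le 1\}$ be its dual, the nuclear norm. The rank of $\mathcal{T}$ is the least $r$ such that $\mathcal{T}=\sum_{i=1}^r x_i\otimes y_i\otimes z_i$; a nuclear decomposition of $\mathcal{T}$ is such a decomposition with $\|\mathcal{T}\|_1=\sum_{i=1}^r\|x_i\|\,\|y_i\|\,\|z_i\|$, and the nuclear rank of $\mathcal{T}$ is the least $r$ for which $\mathcal{T}$ has a nuclear decomposition with $r$ terms. Let $\mathrm{S}^3\mathbb{C}^2\subset\otimes^3\mathbb{C}^2$ be the space of symmetric tensors, let $B_1(3,2)=\{\mathcal{S}\in \mathrm{S}^3\mathbb{C}^2 : \|\mathcal{S}\|_1\le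 1\}$, and let $$|W_3\rangle=\mathrm{e}_1\otimes \mathrm{e}_1\otimes \mathrm{e}_2+\mathrm{e}_1\otimes \mathrm{e}_2\otimes \mathrm{e}_1+\mathrm{e}_2\otimes \mathrm{e}_1\otimes \mathrm{e}_1 .$$ The unitary group $U(2)$ acts on $\otimes^3\mathbb{C}^2$ by $\mathcal{T}\mapsto U^{\otimes 3}\mathcal{T}$. Let $$\mathbf{F}=\{\mathcal{S}\in B_1(3,2) : \operatorname{Re}\langle \mathcal{S},|W_3\rangle\rangle=\||W_3\rangle\|_\infty\},$$ which is the exposed face of $B_1(3,2)$ given by the real functional $\mathcal{S}\mapsto\operatorname{Re}\langle \mathcal{S},|W_3\rangle\rangle$. Then: 1. $\mathbf{F}$ is nonempty and its real dimension (the dimension of its real affine span) is $4$. 2. With $\zeta=e^{2\pi \mathrm{i}/9}$, $$|W_3\rangle=\frac{\sqrt3}{2}\Big(\big(\sqrt{\tfrac23}\,\mathrm{e}_1+\tfrac1{\sqrt3}\mathrm{e}_2\big)^{\otimes3}+\big(\sqrt{\tfrac23}\,\zeta \mathrm{e}_1+\tfrac1{\sqrt3}\bar\zeta^2\mathrm{e}_2\big)^{\otimes3}+\big(\sqrt{\tfrac23}\,\bar\zeta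 \mathrm{e}_1+\tfrac1{\sqrt3}\zeta^2\mathrm{e}_2\big)^{\otimes3}\Big)$$ is a nuclear decomposition of $|W_3\rangle$. The rank of $|W_3\rangle$ is $3$, and the nuclear rank of $|W_3\rangle$ is also $3$. 3. Every $\mathcal{S}\in\mathbf{F}$ has nuclear rank at most $4$. 4. The subgroup $\{U\in U(2) : U^{\otimes3}|W_3\rangle=|W_3\rangle\}$ and the subgroup $\{U\in U(2) : U^{\otimes3}\mathbf{F}=\mathbf{F}\}$ (setwise) both equal $$G=\{\operatorname{diag}(\zeta,\bar\zeta^2) : \zeta\in\mathbb{C},\ |\zeta|=1\},$$ and $\zeta\mapsto\operatorname{diag}(\zeta,\bar\zeta^2)$ is an isomorphism of topological groups from the unit circle onto $G$; in particular $G$ is one-dimensional. 5. The union $\bigcup_{U\in U(2)}U^{\otimes3}\mathbf{F}$ is a semialgebraic set (in the real coordinates given by the real and imaginary parts of the entries of a tensor), and its dimension is $7$ (its Hausdorff dimension, which for a semialgebraic set is its dimension). -/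

import Mathlib

noncomputable section

open scoped BigOperators ComplexConjugate

namespace NuclearFace

/-- The space `⊗^d ℂⁿ` of `d`-mode tensors `[T_{i₁,…,i_d}]`, with the Hilbert–Schmidt inner product
and norm.  Indices start at `0`, so that `e₁, e₂` are the basis vectors with index `0, 1`. -/
abbrev Tensor (d n : ℕ) : Type := EuclideanSpace ℂ (Fin d → Fin n)

/-- The product tensor `x₁ ⊗ ⋯ ⊗ x_d`. -/
def tensorProd {d n : ℕ} (x : Fin d → EuclideanSpace ℂ (Fin n)) : Tensor d n :=
  WithLp.toLp 2 fun i => ∏ j, x j (i j)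

/-- The symmetric rank one tensor `u^{⊗ d}`. -/
def tensorPow (d : ℕ) {n : ℕ} (u : EuclideanSpace ℂ (Fin n)) : Tensor d n :=
  tensorProd fun _ => u

/-- The subspace `S^d ℂⁿ` of symmetric tensors. -/
def symTensor (d n : ℕ) : Submodule ℂ (Tensor d n) where
  carrier := {T | ∀ (σ : Equiv.Perm (Fin d)) (i : Fin d → Fin n), T (i ∘ σ) = T i}
  add_mem' := by
    intro S T hS hT σ i
    simp [hS σ i, hT σ i]
  zero_mem' := by
    intro σ i
    simp
  smul_mem' := by
    intro c T hT σ i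
    simp [hT σ i]

/-- The spectral norm `‖T‖_∞`: the maximum of `|⟨T, x₁ ⊗ ⋯ ⊗ x_d⟩|` over unit vectors `x_j`. -/
def tensorSpectralNorm {d n : ℕ} (T : Tensor d n) : ℝ :=
  sSup {c : ℝ | ∃ x : Fin d → EuclideanSpace ℂ (Fin n),
    (∀ j, ‖x j‖ = 1) ∧ c = ‖inner ℂ T (tensorProd x)‖}

/-- The nuclear norm `‖T‖₁`: the dual norm of the spectral norm. -/
def nuclearNorm {d n : ℕ} (T : Tensor d n) : ℝ :=
  sSup {c : ℝ | ∃ X : Tensor d n, tensorSpectralNorm X ≤ 1 ∧ c = (inner ℂ X T).re}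

/-- The rank of a tensor: the least number of product tensors with sum `T`. -/
def tensorRank {d n : ℕ} (T : Tensor d n) : ℕ∞ :=
  sInf {k : ℕ∞ | ∃ (r : ℕ) (x : Fin r → Fin d → EuclideanSpace ℂ (Fin n)),
    T = ∑ i, tensorProd (x i) ∧ k = r}

/-- A nuclear (minimal) decomposition `T = ∑ᵢ x_{i,1} ⊗ ⋯ ⊗ x_{i,d}`, that is, one with
`‖T‖₁ = ∑ᵢ ∏ⱼ ‖x_{i,j}‖`. -/
def IsNuclearDecomposition {d n r : ℕ} (T : Tensor d n)
    (x : Fin r → Fin d → EuclideanSpace ℂ (Fin n)) : Prop :=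
  T = ∑ i, tensorProd (x i) ∧ nuclearNorm T = ∑ i, ∏ j, ‖x i j‖

/-- The nuclear rank: the least number of summands in a nuclear decomposition of `T`.  The value is
an extended natural number, so that a finite bound asserts that a nuclear decomposition exists. -/
def nuclearRank {d n : ℕ} (T : Tensor d n) : ℕ∞ :=
  sInf {k : ℕ∞ | ∃ (r : ℕ) (x : Fin r → Fin d → EuclideanSpace ℂ (Fin n)),
    IsNuclearDecomposition T x ∧ k = r}

/-- The unit ball of the nuclear norm in the space `S^d ℂⁿ` of symmetric tensors. -/
def symNuclearBall (d n : ℕ) : Set (Tensor d n) :=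
  {S | S ∈ symTensor d n ∧ nuclearNorm S ≤ 1}

/-- The face `F(X) = {S ∈ B : Re ⟨S, X⟩ = ‖X‖_∞}` of the nuclear norm unit ball `B` of `S^d ℂⁿ`. -/
def face {d n : ℕ} (X : Tensor d n) : Set (Tensor d n) :=
  {S | S ∈ symNuclearBall d n ∧ (inner ℂ X S).re = tensorSpectralNorm X}

/-- The action `T ↦ A^{⊗ d} T` of an `n × n` matrix on `⊗^d ℂⁿ`. -/
def matAct {d n : ℕ} (A : Matrix (Fin n) (Fin n) ℂ) (T : Tensor d n) : Tensor d n :=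
  WithLp.toLp 2 fun i => ∑ k : Fin d → Fin n, (∏ j, A (i j) (k j)) * T k

theorem matAct_one {d n : ℕ} (T : Tensor d n) : matAct 1 T = T := by
  ext i
  simp only [matAct, Matrix.one_apply, Finset.prod_ite_zero, Finset.mem_univ, forall_true_left]
  rw [Finset.sum_eq_single i]
  · simp
  · intro k _ hk
    rw [if_neg (fun h => hk (funext fun j => (h j).symm)), zero_mul]
  · simp

theorem matAct_mul {d n : ℕ} (A B : Matrix (Fin n) (Fin n) ℂ) (T : Tensor d n) :
    matAct (A * B) T = matAct A (matAct B T) := by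
  ext i
  simp only [matAct, Matrix.mul_apply, Finset.prod_univ_sum, Fintype.piFinset_univ, Finset.mul_sum,
    Finset.sum_mul]
  rw [Finset.sum_comm]
  refine Finset.sum_congr rfl fun k _ => Finset.sum_congr rfl fun l _ => ?_
  rw [Finset.prod_mul_distrib, mul_assoc]

/-- The unitary group `U(n)`. -/
abbrev U (n : ℕ) : Type := Matrix.unitaryGroup (Fin n) ℂ

theorem act_inv_act {d n : ℕ} (V : U n) (T : Tensor d n) :
    matAct (V⁻¹ : U n).1 (matAct V.1 T) = T := by
  rw [← matAct_mul]
  have h : (V⁻¹ : U n).1 * V.1 = 1 := congrArg Subtype.val (inv_mul_cancel V)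
  rw [h, matAct_one]

/-- The subgroup of `U(n)` of all `V` with `V^{⊗ d} T = T`. -/
def tensorStabilizer {d n : ℕ} (T : Tensor d n) : Subgroup (U n) where
  carrier := {V | matAct V.1 T = T}
  mul_mem' := by
    intro V W hV hW
    change matAct (V.1 * W.1) T = T
    rw [matAct_mul, show matAct W.1 T = T from hW]
    exact hV
  one_mem' := matAct_one T
  inv_mem' := by
    intro V hV
    have h := act_inv_act V T
    rw [show matAct V.1 T = T from hV] at h
    exact h

/-- The subgroup of `U(n)` of all `V` with `V^{⊗ d} F = F`, for a set `F` of tensors. -/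
def setStabilizer {d n : ℕ} (F : Set (Tensor d n)) : Subgroup (U n) where
  carrier := {V | matAct V.1 '' F = F}
  mul_mem' := by
    intro V W hV hW
    change matAct (V.1 * W.1) '' F = F
    have h : (matAct (V.1 * W.1) : Tensor d n → Tensor d n) = matAct V.1 ∘ matAct W.1 :=
      funext fun T => matAct_mul _ _ T
    rw [h, Set.image_comp, show matAct W.1 '' F = F from hW]
    exact hV
  one_mem' := by
    change matAct 1 '' F = F
    have h : (matAct 1 : Tensor d n → Tensor d n) = id := funext fun T => matAct_one T
    rw [h, Set.image_id]
  inv_mem' := by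
    intro V hV
    change matAct (V⁻¹ : U n).1 '' F = F
    have h : (matAct (V⁻¹ : U n).1 ∘ matAct V.1 : Tensor d n → Tensor d n) = id :=
      funext fun T => act_inv_act V T
    conv_lhs => rw [← show matAct V.1 '' F = F from hV]
    rw [← Set.image_comp, h, Set.image_id]

/-- Semialgebraic subsets of a real coordinate space: the smallest family of sets that contains all
sets `{x | p x > 0}` with `p` a real polynomial and is closed under complements and finite unions
(hence under finite intersections; `{p = 0}` is the complement of `{p > 0} ∪ {-p > 0}`). -/
inductive IsSemialgebraic {ι : Type} : Set (ι → ℝ) → Prop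
  | pos (p : MvPolynomial ι ℝ) : IsSemialgebraic {x | 0 < MvPolynomial.eval x p}
  | compl {s : Set (ι → ℝ)} : IsSemialgebraic s → IsSemialgebraic sᶜ
  | union {s t : Set (ι → ℝ)} : IsSemialgebraic s → IsSemialgebraic t → IsSemialgebraic (s ∪ t)

/-- The real coordinates `(Re T, Im T)` of a tensor. -/
def realCoords {d n : ℕ} (T : Tensor d n) : (Fin d → Fin n) ⊕ (Fin d → Fin n) → ℝ :=
  Sum.elim (fun i => (T i).re) (fun i => (T i).im)

/-- The standard basis vector `e₁` of `ℂ²`. -/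
def e₁ : EuclideanSpace ℂ (Fin 2) := !₂[1, 0]

/-- The standard basis vector `e₂` of `ℂ²`. -/
def e₂ : EuclideanSpace ℂ (Fin 2) := !₂[0, 1]

/-- `|W₃⟩ = e₁ ⊗ e₁ ⊗ e₂ + e₁ ⊗ e₂ ⊗ e₁ + e₂ ⊗ e₁ ⊗ e₁`. -/
def W₃ : Tensor 3 2 :=
  tensorProd ![e₁, e₁, e₂] + tensorProd ![e₁, e₂, e₁] + tensorProd ![e₂, e₁, e₁]

/-- The vector `√(2/3) ζ e₁ + (1/√3) ζ̄² e₂`. -/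
def wVec (ζ : ℂ) : EuclideanSpace ℂ (Fin 2) :=
  (((Real.sqrt (2 / 3) : ℝ) : ℂ) * ζ) • e₁ + (((1 / Real.sqrt 3 : ℝ) : ℂ) * conj ζ ^ 2) • e₂

/-- The diagonal matrix with entries `ζ, ζ̄²`. -/
def diagMat (ζ : ℂ) : Matrix (Fin 2) (Fin 2) ℂ := !![ζ, 0; 0, conj ζ ^ 2]

end NuclearFace

end

open NuclearFace

/-! ### Matching the signs of two real polynomials by an order isomorphism of the line. -/

namespace NuclearFace

open Polynomial

/-! On product tensors of unit vectors the pairing with `W₃` has modulus at most `2 * cQ = 2/√3`. A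
sum of four squares (`spectral_identity`) proves this and shows that equality fixes the moduli of
all coordinates. If the real part of the pairing attains the bound, the phases are fixed up to one
unimodular number `w`, and the product is `facePoint w (w ^ 2)` (`unit_maximizer`).

By Hahn–Banach duality the nuclear unit ball lies in the convex hull of the unit product tensors
(`mem_convexHull_of_nuclearNorm_le_one`). So the face is an affine copy of the convex hull of the
curve `(w, w²)`, `|w| = 1`, in `ℂ²`. This hull is `|x| ≤ 1`, `|y - x²| ≤ 1 - |x|²` (`faceRegion`,
`face_W₃_eq`). It has interior, which gives real dimension 4, and each of its points is a convex
combination of four curve points (`exists_four_atoms`). Curve points are cubes of the vectors `wVec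
ζ`, and `W₃` itself is a dual certificate for every nonnegative combination of them
(`isNuclearDecomposition_of_atoms`). This gives nuclear rank at most 4 on the face, and the
three-term decomposition of `W₃` from cube roots of unity. Rank 2 or less is excluded by the
determinant of the pencil of slices (`W₃_ne_two_products`).

A unitary fixing `W₃` is diagonal by comparison of entries. A unitary preserving the face fixes its
unique shortest point, which is a multiple of `W₃`, so both stabilizers are `G`.

Since `U(2) = SU(2)·G` and `G` preserves the face, the orbit is covered by a smooth image of `3 + 4
= 7` parameters. Conversely, a chart whose derivative is invertible at the origin shows that a
linear projection of the orbit to a 7-dimensional space has interior. Semialgebraicity is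
elimination of the entries of the unitary matrix by Tarski–Seidenberg, proved here by the
Cohen–Hörmander method: the sign diagram of a finite family of polynomials in one variable is
determined by finitely many signs of polynomials in the parameters (`diagramDetermined`). -/

theorem exists_orderIso_move_right {a b c d : ℝ} (hac : a < c) (hcd : c ≤ d) (hdb : d < b) :
    ∃ g : ℝ ≃o ℝ, g c = d ∧ ∀ t, t ≤ a ∨ b ≤ t → g t = t := by
  have h1 : 0 < c - a := by linarith
  have h2 : 0 < b - c := by linarith
  have s1 : 0 < (d - a) / (c - a) := div_pos (by linarith) h1
  have s2 : 0 < (b - d) / (b - c) := div_pos (by linarith) h2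
  have s1' : 1 ≤ (d - a) / (c - a) := by rw [le_div_iff₀ h1]; linarith
  have s2' : (b - d) / (b - c) ≤ 1 := by rw [div_le_one h2]; linarith
  have m1 : StrictMono fun t : ℝ => a + (t - a) * ((d - a) / (c - a)) := fun x y h => by
    have : (x - a) * ((d - a) / (c - a)) < (y - a) * ((d - a) / (c - a)) :=
      mul_lt_mul_of_pos_right (by linarith) s1
    simpa using this
  have m2 : StrictMono fun t : ℝ => b + (t - b) * ((b - d) / (b - c)) := fun x y h => by
    have : (x - b) * ((b - d) / (b - c)) < (y - b) * ((b - d) / (b - c)) :=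
      mul_lt_mul_of_pos_right (by linarith) s2
    simpa using this
  -- The two affine functions join `(a, a)` and `(b, b)` to `(c, d)`. Their slopes are at least and
  -- at most `1`, so the identity dominates outside `(a, b)`.
  set g : ℝ → ℝ := fun t => max t (min (a + (t - a) * ((d - a) / (c - a)))
    (b + (t - b) * ((b - d) / (b - c)))) with hg
  have hm : StrictMono g := fun x y h => max_lt_max h (min_lt_min (m1 h) (m2 h))
  have hfix : ∀ t, t ≤ a ∨ b ≤ t → g t = t := by
    intro t ht
    refine max_eq_left ?_
    rcases ht with ht | ht
    · refine (min_le_left _ _).trans ?_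
      nlinarith
    · refine (min_le_right _ _).trans ?_
      nlinarith
  have hc : Continuous g := by fun_prop
  have hsurj : Function.Surjective g := by
    refine hc.surjective (Filter.tendsto_atTop_mono (fun t => le_max_left _ _) Filter.tendsto_id) ?_
    refine Filter.tendsto_id.congr' ?_
    filter_upwards [Filter.eventually_le_atBot a] with t ht
    exact (hfix t (Or.inl ht)).symm
  refine ⟨StrictMono.orderIsoOfSurjective g hm hsurj, ?_, hfix⟩
  change g c = d
  have e1 : a + (c - a) * ((d - a) / (c - a)) = d := by field_simp; ring
  have e2 : b + (c - b) * ((b - d) / (b - c)) = d := by field_simp; ring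
  simp only [hg, e1, e2, min_self]
  exact max_eq_right hcd

theorem exists_orderIso_move {a b c d : ℝ} (hac : a < c) (hcb : c < b) (had : a < d)
    (hdb : d < b) : ∃ g : ℝ ≃o ℝ, g c = d ∧ ∀ t, t ≤ a ∨ b ≤ t → g t = t := by
  rcases le_total c d with h | h
  · exact exists_orderIso_move_right hac h hdb
  · obtain ⟨g, h1, h2⟩ := exists_orderIso_move_right had h hcb
    refine ⟨g.symm, by rw [← h1]; simp, fun t ht => ?_⟩
    conv_lhs => rw [← h2 t ht]
    simp

theorem sign_eval_eq_of_ne_zero {p : ℝ[X]} {s t : ℝ} (hst : s ≤ t)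
    (h : ∀ u, s ≤ u → u ≤ t → p.eval u ≠ 0) :
    SignType.sign (p.eval s) = SignType.sign (p.eval t) := by
  have key : ∀ f : ℝ[X], (∀ u, s ≤ u → u ≤ t → f.eval u ≠ 0) → 0 < f.eval s → 0 < f.eval t := by
    intro f hf hs
    by_contra hn
    obtain ⟨u, hu, h0⟩ := intermediate_value_Icc' hst f.continuous.continuousOn
      (show (0 : ℝ) ∈ Set.Icc (f.eval t) (f.eval s) from ⟨not_lt.1 hn, hs.le⟩)
    exact hf u hu.1 hu.2 h0
  rcases lt_or_gt_of_ne (h s le_rfl hst) with hs | hs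
  · have := key (-p) (fun u h1 h2 => by simpa using h u h1 h2) (by simpa using hs)
    rw [sign_neg hs, sign_neg (by simpa using this)]
  · rw [sign_pos hs, sign_pos (key p h hs)]

/-- A root of `q` between `φ t` and `ψ t` would be `φ z = ψ z` for some `z ∈ Z`, and monotonicity of
both maps squeezes `z = t`. Hence only the values of a matching on the roots matter, and it may be
changed elsewhere. -/
theorem sign_eval_orderIso_congr {Z : Finset ℝ} {φ ψ : ℝ ≃o ℝ} (hZ : ∀ z ∈ Z, ψ z = φ z)
    {p q : ℝ[X]} (hp : ∀ t, p.eval t = 0 → t ∈ Z)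
    (hs : ∀ t, SignType.sign (p.eval t) = SignType.sign (q.eval (φ t))) (t : ℝ) :
    SignType.sign (p.eval t) = SignType.sign (q.eval (ψ t)) := by
  by_cases ht : t ∈ Z
  · rw [hZ t ht, hs]
  rw [hs]
  have hroot : ∀ u, q.eval u = 0 → ∃ z ∈ Z, φ z = u := by
    intro u hu
    refine ⟨φ.symm u, hp _ ?_, by simp⟩
    have := hs (φ.symm u)
    rw [φ.apply_symm_apply, hu, sign_zero] at this
    exact sign_eq_zero_iff.1 this
  rcases le_total (φ t) (ψ t) with h | h
  · refine sign_eval_eq_of_ne_zero h fun u h1 h2 h0 => ht ?_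
    obtain ⟨z, hz, rfl⟩ := hroot u h0
    rw [← hZ z hz] at h2
    have a1 := φ.le_iff_le.1 h1
    have a2 := ψ.le_iff_le.1 h2
    rwa [le_antisymm a1 a2]
  · refine (sign_eval_eq_of_ne_zero h fun u h1 h2 h0 => ht ?_).symm
    obtain ⟨z, hz, rfl⟩ := hroot u h0
    rw [← hZ z hz] at h1
    have a1 := ψ.le_iff_le.1 h1
    have a2 := φ.le_iff_le.1 h2
    rwa [le_antisymm a1 a2]

/-- The order isomorphism `φ` matches the signs of `p` and `q` on the finite set `Z`, which contains
all critical points and encloses all roots. -/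
structure Matched (p q : ℝ[X]) (Z : Finset ℝ) (φ : ℝ ≃o ℝ) : Prop where
  critLeft : ∀ t, p.derivative.eval t = 0 → t ∈ Z
  critRight : ∀ s, q.derivative.eval s = 0 → ∃ z ∈ Z, φ z = s
  sign : ∀ z ∈ Z, SignType.sign (p.eval z) = SignType.sign (q.eval (φ z))
  boundLeft : ∀ t, p.eval t = 0 → (∃ z ∈ Z, z < t) ∧ ∃ z ∈ Z, t < z
  boundRight : ∀ s, q.eval s = 0 → (∃ z ∈ Z, φ z < s) ∧ ∃ z ∈ Z, s < φ z

theorem Matched.symm {p q : ℝ[X]} {Z : Finset ℝ} {φ : ℝ ≃o ℝ} (h : Matched p q Z φ) :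
    Matched q p (Z.image φ) φ.symm where
  critLeft s hs := by simpa using h.critRight s hs
  critRight t ht := ⟨φ t, Finset.mem_image_of_mem _ (h.critLeft t ht), by simp⟩
  sign := by
    intro z hz
    obtain ⟨w, hw, rfl⟩ := Finset.mem_image.1 hz
    simpa using (h.sign w hw).symm
  boundLeft s hs := by simpa using h.boundRight s hs
  boundRight t ht := by simpa using h.boundLeft t ht

theorem Matched.derivative_ne_zero {p q : ℝ[X]} {Z : Finset ℝ} {φ : ℝ ≃o ℝ}
    (h : Matched p q Z φ) : p.derivative ≠ 0 := by
  intro h0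
  obtain ⟨t, ht⟩ := Infinite.exists_notMem_finset Z
  exact ht (h.critLeft t (by simp [h0]))

theorem exists_adjacent {Z : Finset ℝ} {t : ℝ} (ht : t ∉ Z) (h1 : ∃ z ∈ Z, z < t)
    (h2 : ∃ z ∈ Z, t < z) :
    ∃ a ∈ Z, ∃ b ∈ Z, a < t ∧ t < b ∧ ∀ z ∈ Z, z ≤ a ∨ b ≤ z := by
  obtain ⟨a, ha, hma⟩ := (Z.filter (· < t)).exists_max_image id
    (by obtain ⟨z, hz⟩ := h1; exact ⟨z, by simpa using hz⟩)
  obtain ⟨b, hb, hmb⟩ := (Z.filter (t < ·)).exists_min_image id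
    (by obtain ⟨z, hz⟩ := h2; exact ⟨z, by simpa using hz⟩)
  simp only [Finset.mem_filter, id] at ha hb hma hmb
  refine ⟨a, ha.1, b, hb.1, ha.2, hb.2, fun z hz => ?_⟩
  rcases lt_trichotomy z t with h | h | h
  · exact Or.inl (hma z ⟨hz, h⟩)
  · exact absurd (h ▸ hz) ht
  · exact Or.inr (hmb z ⟨hz, h⟩)

/-- A root between adjacent critical points forces opposite signs at the two ends. -/
theorem sign_ends_of_root {p : ℝ[X]} {a t b : ℝ} (hat : a < t) (htb : t < b)
    (hp : p.eval t = 0) (hd : ∀ u, a < u → u < b → p.derivative.eval u ≠ 0) :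
    (p.eval a < 0 ∧ 0 < p.eval b) ∨ (0 < p.eval a ∧ p.eval b < 0) := by
  have key : ∀ f : ℝ[X], f.eval t = 0 → (∀ u, a < u → u < b → f.derivative.eval u ≠ 0) →
      0 < f.derivative.eval t → f.eval a < 0 ∧ 0 < f.eval b := by
    intro f hf hd hpos
    have hm : StrictMonoOn (fun u => f.eval u) (Set.Icc a b) := by
      refine strictMonoOn_of_deriv_pos (convex_Icc a b) f.continuous.continuousOn fun u hu => ?_
      rw [interior_Icc] at hu
      rw [Polynomial.deriv]
      rcases le_total u t with h | h
      · have := sign_eval_eq_of_ne_zero (p := f.derivative) h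
          fun v h1 h2 => hd v (hu.1.trans_le h1) (h2.trans_lt htb)
        rwa [sign_pos hpos, sign_eq_one_iff] at this
      · have := sign_eval_eq_of_ne_zero (p := f.derivative) h
          fun v h1 h2 => hd v (hat.trans_le h1) (h2.trans_lt hu.2)
        rwa [sign_pos hpos, eq_comm, sign_eq_one_iff] at this
    have e1 := hm ⟨le_rfl, (hat.trans htb).le⟩ ⟨hat.le, htb.le⟩ hat
    have e2 := hm ⟨hat.le, htb.le⟩ ⟨(hat.trans htb).le, le_rfl⟩ htb
    simp only [hf] at e1 e2
    exact ⟨e1, e2⟩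
  rcases lt_or_gt_of_ne (hd t hat htb) with h | h
  · have := key (-p) (by simpa using hp) (by simpa using hd) (by simpa using h)
    right
    simpa using this
  · exact Or.inl (key p hp hd h)

/-- A new root `t` of `p` lies between adjacent marks `a < b` with no critical point between them,
so `p` changes sign there. So does `q` between `φ a` and `φ b`, which yields a root `s`. Composing
`φ` with a map that moves `φ t` to `s` and is the identity outside `(φ a, φ b)` keeps all old marks.
-/
theorem Matched.insert_root {p q : ℝ[X]} {Z : Finset ℝ} {φ : ℝ ≃o ℝ} (h : Matched p q Z φ)
    {t : ℝ} (ht : p.eval t = 0) :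
    ∃ ψ : ℝ ≃o ℝ, (∀ z ∈ Z, ψ z = φ z) ∧ Matched p q (insert t Z) ψ := by
  by_cases htZ : t ∈ Z
  · exact ⟨φ, fun _ _ => rfl, by rwa [Finset.insert_eq_of_mem htZ]⟩
  obtain ⟨a, ha, b, hb, hat, htb, hab⟩ :=
    exists_adjacent htZ (h.boundLeft t ht).1 (h.boundLeft t ht).2
  have hends := sign_ends_of_root hat htb ht fun u h1 h2 h0 => by
    rcases hab u (h.critLeft u h0) with h' | h' <;> linarith
  have hlt : φ a < φ b := φ.lt_iff_lt.2 (hat.trans htb)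
  have hsa := h.sign a ha
  have hsb := h.sign b hb
  obtain ⟨s, hs, hs0⟩ : ∃ s ∈ Set.Ioo (φ a) (φ b), q.eval s = 0 := by
    rcases hends with ⟨h1, h2⟩ | ⟨h1, h2⟩
    · rw [sign_neg h1, eq_comm, sign_eq_neg_one_iff] at hsa
      rw [sign_pos h2, eq_comm, sign_eq_one_iff] at hsb
      exact intermediate_value_Ioo hlt.le q.continuous.continuousOn ⟨hsa, hsb⟩
    · rw [sign_pos h1, eq_comm, sign_eq_one_iff] at hsa
      rw [sign_neg h2, eq_comm, sign_eq_neg_one_iff] at hsb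
      exact intermediate_value_Ioo' hlt.le q.continuous.continuousOn ⟨hsb, hsa⟩
  obtain ⟨g, hg, hfix⟩ := exists_orderIso_move (φ.lt_iff_lt.2 hat) (φ.lt_iff_lt.2 htb) hs.1 hs.2
  have hZ : ∀ z ∈ Z, (φ.trans g) z = φ z := fun z hz => by
    exact hfix _ ((hab z hz).imp φ.le_iff_le.2 φ.le_iff_le.2)
  refine ⟨φ.trans g, hZ, ⟨fun u hu => Finset.mem_insert_of_mem (h.critLeft u hu), ?_, ?_, ?_, ?_⟩⟩
  · intro u hu
    obtain ⟨z, hz, rfl⟩ := h.critRight u hu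
    exact ⟨z, Finset.mem_insert_of_mem hz, hZ z hz⟩
  · intro z hz
    rcases Finset.mem_insert.1 hz with rfl | hz
    · change _ = SignType.sign (q.eval (g (φ z)))
      rw [hg, ht, hs0]
    · rw [hZ z hz, h.sign z hz]
  · intro u hu
    obtain ⟨⟨z, hz, h1⟩, w, hw, h2⟩ := h.boundLeft u hu
    exact ⟨⟨z, Finset.mem_insert_of_mem hz, h1⟩, w, Finset.mem_insert_of_mem hw, h2⟩
  · intro u hu
    obtain ⟨⟨z, hz, h1⟩, w, hw, h2⟩ := h.boundRight u hu
    exact ⟨⟨z, Finset.mem_insert_of_mem hz, by rwa [hZ z hz]⟩, w, Finset.mem_insert_of_mem hw,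
      by rwa [hZ w hw]⟩

theorem Matched.insert_roots {p q : ℝ[X]} {Z : Finset ℝ} {φ : ℝ ≃o ℝ} (h : Matched p q Z φ) :
    ∃ (ψ : ℝ ≃o ℝ) (Y : Finset ℝ), Z ⊆ Y ∧ (∀ z ∈ Z, ψ z = φ z) ∧ Matched p q Y ψ ∧
      ∀ t, p.eval t = 0 → t ∈ Y := by
  have key : ∀ R : Finset ℝ, (∀ t ∈ R, p.eval t = 0) → ∃ (ψ : ℝ ≃o ℝ) (Y : Finset ℝ),
      Z ⊆ Y ∧ (∀ z ∈ Z, ψ z = φ z) ∧ Matched p q Y ψ ∧ R ⊆ Y := by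
    intro R
    induction R using Finset.induction_on with
    | empty => exact fun _ => ⟨φ, Z, subset_rfl, fun _ _ => rfl, h, by simp⟩
    | insert t R _ ih =>
      intro hR
      obtain ⟨ψ, Y, hZY, hψ, hm, hRY⟩ := ih fun u hu => hR u (Finset.mem_insert_of_mem hu)
      obtain ⟨χ, hχ, hm'⟩ := hm.insert_root (hR t (Finset.mem_insert_self _ _))
      refine ⟨χ, insert t Y, hZY.trans (Finset.subset_insert _ _),
        fun z hz => by rw [hχ z (hZY hz), hψ z hz], hm', Finset.insert_subset_insert _ hRY⟩
  have hp : p ≠ 0 := fun h0 => h.derivative_ne_zero (by simp [h0])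
  obtain ⟨ψ, Y, h1, h2, h3, h4⟩ := key p.roots.toFinset fun t ht => by
    simpa [hp] using ht
  exact ⟨ψ, Y, h1, h2, h3, fun t ht => h4 (by simpa [hp] using ht)⟩

/-- Away from its roots and critical points, the sign of `p` is the sign at an adjacent marked
point. -/
theorem sign_eval_eq_of_adjacent {p : ℝ[X]} {a t b : ℝ} (hat : a < t) (htb : t < b)
    (hp : ∀ u, a < u → u < b → p.eval u ≠ 0)
    (hd : ∀ u, a < u → u < b → p.derivative.eval u ≠ 0) :
    (p.eval a ≠ 0 ∧ SignType.sign (p.eval t) = SignType.sign (p.eval a)) ∨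
      (p.eval a = 0 ∧ p.eval b ≠ 0 ∧ SignType.sign (p.eval t) = SignType.sign (p.eval b)) := by
  by_cases ha : p.eval a = 0
  · by_cases hb : p.eval b = 0
    -- By Rolle, both ends cannot be roots.
    · obtain ⟨c, hc, h0⟩ := exists_deriv_eq_zero (f := fun u => p.eval u) (hat.trans htb)
        p.continuous.continuousOn (ha.trans hb.symm)
      rw [Polynomial.deriv] at h0
      exact absurd h0 (hd c hc.1 hc.2)
    · refine Or.inr ⟨ha, hb, sign_eval_eq_of_ne_zero htb.le fun u h1 h2 => ?_⟩
      rcases h2.eq_or_lt with rfl | h2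
      · exact hb
      · exact hp u (hat.trans_le h1) h2
  · refine Or.inl ⟨ha, (sign_eval_eq_of_ne_zero hat.le fun u h1 h2 => ?_).symm⟩
    rcases h1.eq_or_lt with rfl | h1
    · exact ha
    · exact hp u h1 (h2.trans_lt htb)

/-- With all roots and critical points marked, the sign on a gap is read off at an end that is not a
root, and the same end serves for `p` and `q`. Beyond the extreme marks neither polynomial has
roots. -/
theorem Matched.sign_eq {p q : ℝ[X]} {Z : Finset ℝ} {φ : ℝ ≃o ℝ} (h : Matched p q Z φ)
    (hne : Z.Nonempty) (hp : ∀ t, p.eval t = 0 → t ∈ Z)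
    (hq : ∀ s, q.eval s = 0 → ∃ z ∈ Z, φ z = s) (t : ℝ) :
    SignType.sign (p.eval t) = SignType.sign (q.eval (φ t)) := by
  by_cases htZ : t ∈ Z
  · exact h.sign t htZ
  have hsz : ∀ z ∈ Z, p.eval z = 0 ↔ q.eval (φ z) = 0 := fun z hz => by
    rw [← sign_eq_zero_iff, h.sign z hz, sign_eq_zero_iff]
  by_cases h1 : ∃ z ∈ Z, z < t
  · by_cases h2 : ∃ z ∈ Z, t < z
    · obtain ⟨a, ha, b, hb, hat, htb, hab⟩ := exists_adjacent htZ h1 h2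
      have nZ : ∀ u ∈ Z, a < u → u < b → False := fun u hu h1 h2 => by
        rcases hab u hu with h' | h' <;> linarith
      have nZ' : ∀ s, (∃ z ∈ Z, φ z = s) → φ a < s → s < φ b → False := by
        rintro _ ⟨z, hz, rfl⟩ h1 h2
        exact nZ z hz (φ.lt_iff_lt.1 h1) (φ.lt_iff_lt.1 h2)
      have e1 := sign_eval_eq_of_adjacent hat htb (fun u h1 h2 h0 => nZ u (hp u h0) h1 h2)
        (fun u h1 h2 h0 => nZ u (h.critLeft u h0) h1 h2)
      have e2 := sign_eval_eq_of_adjacent (φ.lt_iff_lt.2 hat) (φ.lt_iff_lt.2 htb)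
        (fun u h1 h2 h0 => nZ' u (hq u h0) h1 h2)
        (fun u h1 h2 h0 => nZ' u (h.critRight u h0) h1 h2)
      rcases e1 with ⟨h0, e1⟩ | ⟨h0, -, e1⟩ <;> rcases e2 with ⟨h0', e2⟩ | ⟨h0', -, e2⟩
      · rw [e1, e2, h.sign a ha]
      · exact absurd ((hsz a ha).2 h0') h0
      · exact absurd ((hsz a ha).1 h0) h0'
      · rw [e1, e2, h.sign b hb]
    · push Not at h2
      obtain ⟨m, hm, hmax⟩ := Z.exists_max_image id hne
      have hmt := h2 m hm
      rw [← sign_eval_eq_of_ne_zero hmt fun u h1 _ h0 => ?_, h.sign m hm,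
        sign_eval_eq_of_ne_zero (φ.le_iff_le.2 hmt) fun s h1 _ h0 => ?_]
      · obtain ⟨-, z, hz, hlt⟩ := h.boundRight s h0
        exact absurd (φ.lt_iff_lt.1 (h1.trans_lt hlt)) (not_lt.2 (hmax z hz))
      · obtain ⟨-, z, hz, hlt⟩ := h.boundLeft u h0
        exact absurd (h1.trans_lt hlt) (not_lt.2 (hmax z hz))
  · push Not at h1
    obtain ⟨m, hm, hmin⟩ := Z.exists_min_image id hne
    have hmt := h1 m hm
    rw [sign_eval_eq_of_ne_zero hmt fun u _ h1 h0 => ?_, h.sign m hm,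
      sign_eval_eq_of_ne_zero (φ.le_iff_le.2 hmt) fun s _ h1 h0 => ?_]
    · obtain ⟨⟨z, hz, hlt⟩, -⟩ := h.boundRight s h0
      exact absurd (φ.lt_iff_lt.1 (hlt.trans_le h1)) (not_lt.2 (hmin z hz))
    · obtain ⟨⟨z, hz, hlt⟩, -⟩ := h.boundLeft u h0
      exact absurd (hlt.trans_le h1) (not_lt.2 (hmin z hz))

theorem eventually_sign_eval_atTop (p : ℝ[X]) :
    ∀ᶠ t in Filter.atTop, SignType.sign (p.eval t) = SignType.sign p.leadingCoeff := by
  obtain ⟨f, hf, h⟩ := p.isEquivalent_atTop_lead.exists_eq_mul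
  filter_upwards [h, Filter.eventually_gt_atTop 0, hf.eventually_const_lt one_pos] with t ht h0 h1
  rw [ht, Pi.mul_apply, sign_mul, sign_mul, sign_pos (pow_pos h0 _), sign_pos h1, mul_one, one_mul]

theorem eventually_sign_eval_atBot (p : ℝ[X]) :
    ∀ᶠ t in Filter.atBot, SignType.sign (p.eval t) =
      SignType.sign ((-1) ^ p.natDegree * p.leadingCoeff) := by
  have h := Filter.tendsto_neg_atBot_atTop.eventually (eventually_sign_eval_atTop (p.comp (-X)))
  filter_upwards [h] with t ht
  rw [eval_comp] at ht
  simp only [eval_neg, eval_X, neg_neg] at ht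
  rw [ht, leadingCoeff_comp (by simp)]
  simp [mul_comm]

/-- If the signs of `p` and `q` match at marked points that contain all critical points, then the
matching extends to the whole line. -/
theorem exists_orderIso_sign_eq {p q : ℝ[X]} {Z : Finset ℝ} {φ : ℝ ≃o ℝ}
    (hdeg : p.natDegree = q.natDegree) (hp0 : p ≠ 0)
    (hlead : SignType.sign p.leadingCoeff = SignType.sign q.leadingCoeff)
    (hcp : ∀ t, p.derivative.eval t = 0 → t ∈ Z)
    (hcq : ∀ s, q.derivative.eval s = 0 → ∃ z ∈ Z, φ z = s)
    (hsign : ∀ z ∈ Z, SignType.sign (p.eval z) = SignType.sign (q.eval (φ z))) :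
    ∃ ψ : ℝ ≃o ℝ, (∀ z ∈ Z, ψ z = φ z) ∧
      ∀ t, SignType.sign (p.eval t) = SignType.sign (q.eval (ψ t)) := by
  have hlp : p.leadingCoeff ≠ 0 := leadingCoeff_ne_zero.2 hp0
  have hlq : q.leadingCoeff ≠ 0 := fun h => hlp (by
    rwa [h, sign_zero, sign_eq_zero_iff] at hlead)
  have hq0 : q ≠ 0 := leadingCoeff_ne_zero.1 hlq
  have root_lt : ∀ f : ℝ[X], f ≠ 0 → ∀ᶠ b in Filter.atTop, ∀ t, f.eval t = 0 → t < b := by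
    intro f hf
    have : ∀ᶠ b in Filter.atTop, ∀ t ∈ f.roots.toFinset, t < b :=
      (Filter.eventually_all_finset _).2 fun t _ => Filter.eventually_gt_atTop t
    filter_upwards [this] with b hb t ht
    exact hb t (by simpa [hf] using ht)
  have lt_root : ∀ f : ℝ[X], f ≠ 0 → ∀ᶠ b in Filter.atBot, ∀ t, f.eval t = 0 → b < t := by
    intro f hf
    have : ∀ᶠ b in Filter.atBot, ∀ t ∈ f.roots.toFinset, b < t :=
      (Filter.eventually_all_finset _).2 fun t _ => Filter.eventually_lt_atBot t
    filter_upwards [this] with b hb t ht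
    exact hb t (by simpa [hf] using ht)
  -- Two marks are added outside all roots. The signs there depend only on the degree and the sign
  -- of the leading coefficient, which agree for `p` and `q`.
  obtain ⟨b, hb1, hb2, hb3, hb4⟩ := ((eventually_sign_eval_atTop p).and
    ((φ.tendsto_atTop.eventually (eventually_sign_eval_atTop q)).and
    ((root_lt p hp0).and (φ.tendsto_atTop.eventually (root_lt q hq0))))).exists
  obtain ⟨a, ha1, ha2, ha3, ha4⟩ := ((eventually_sign_eval_atBot p).and
    ((φ.tendsto_atBot.eventually (eventually_sign_eval_atBot q)).and
    ((lt_root p hp0).and (φ.tendsto_atBot.eventually (lt_root q hq0))))).exists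
  have hm : Matched p q (insert a (insert b Z)) φ := by
    refine ⟨fun t ht => by simp [hcp t ht], fun s hs => ?_, ?_, fun t ht => ?_, fun s hs => ?_⟩
    · obtain ⟨z, hz, h⟩ := hcq s hs
      exact ⟨z, by simp [hz], h⟩
    · intro z hz
      simp only [Finset.mem_insert] at hz
      rcases hz with rfl | rfl | hz
      · rw [ha1, ha2, hdeg, sign_mul, sign_mul, hlead]
      · rw [hb1, hb2, hlead]
      · exact hsign z hz
    · exact ⟨⟨a, by simp, ha3 t ht⟩, b, by simp, hb3 t ht⟩
    · exact ⟨⟨a, by simp, ha4 s hs⟩, b, by simp, hb4 s hs⟩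
  -- The roots of `p` are marked first; then the matching is inverted and the roots of `q` are
  -- marked in the same way.
  obtain ⟨ψ, Y, hZY, hψ, hm1, hY⟩ := hm.insert_roots
  obtain ⟨χ, X, hYX, hχ, hm2, hX⟩ := hm1.symm.insert_roots
  have hm3 := hm2.symm
  have hsub : ∀ y ∈ Y, χ.symm y = ψ y ∧ y ∈ X.image χ := by
    intro y hy
    have h1 : χ (ψ y) = y := by
      rw [hχ _ (Finset.mem_image_of_mem _ hy)]; simp
    exact ⟨by rw [OrderIso.symm_apply_eq]; exact h1.symm,
      Finset.mem_image.2 ⟨ψ y, hYX (Finset.mem_image_of_mem _ hy), h1⟩⟩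
  refine ⟨χ.symm, fun z hz => ?_, hm3.sign_eq ?_ ?_ ?_⟩
  · have hz' : z ∈ insert a (insert b Z) := by simp [hz]
    rw [(hsub z (hZY hz')).1, hψ z hz']
  · exact ⟨a, (hsub a (hZY (by simp))).2⟩
  · exact fun t ht => (hsub t (hY t ht)).2
  · exact fun s hs => ⟨χ s, Finset.mem_image_of_mem _ (hX s hs), by simp⟩

end NuclearFace

/-! ### Sign diagrams of parametrized polynomials: the Cohen–Hörmander induction. -/

namespace NuclearFace

open Polynomial

section Pseudo

variable {R : Type*} [CommRing R]

/-- Division without inverting a coefficient: `P` is multiplied by `Q.coeff e` before its top term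
is cancelled. Only `natDegree ≤ e` is needed, so `Q.coeff e` may vanish. -/
theorem exists_pseudo_rem (Q : R[X]) (e : ℕ) (hQ : Q.natDegree ≤ e) :
    ∀ (n : ℕ) (P : R[X]), P.degree < n →
      ∃ (N : ℕ) (A S : R[X]), C (Q.coeff e ^ N) * P = A * Q + S ∧ S.degree < e := by
  intro n
  induction n with
  | zero =>
    intro P hP
    exact ⟨0, 0, P, by simp, hP.trans_le (by exact_mod_cast Nat.zero_le e)⟩
  | succ n ih =>
    intro P hP
    by_cases hne : n < e
    · exact ⟨0, 0, P, by simp, hP.trans_le (by exact_mod_cast hne)⟩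
    push Not at hne
    obtain ⟨N, A, S, h, hS⟩ := ih (C (Q.coeff e) * P - C (P.coeff n) * X ^ (n - e) * Q) (by
      rw [degree_lt_iff_coeff_zero] at hP ⊢
      intro m hm
      rw [coeff_sub, coeff_C_mul, mul_assoc, coeff_C_mul, coeff_X_pow_mul', if_pos (by omega)]
      rcases hm.eq_or_lt with rfl | hm
      · rw [show n - (n - e) = e by omega]
        ring
      · rw [hP m hm, coeff_eq_zero_of_natDegree_lt (p := Q) (n := m - (n - e)) (by omega)]
        ring)
    refine ⟨N + 1, A + C (Q.coeff e ^ N) * C (P.coeff n) * X ^ (n - e), S, ?_, hS⟩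
    rw [pow_succ, C_mul]
    linear_combination h

end Pseudo

variable {ι : Type}

/-- Polynomials agree in sign at two parameter points. -/
def SignAgree (𝒬 : List (MvPolynomial ι ℝ)) (x y : ι → ℝ) : Prop :=
  ∀ Q ∈ 𝒬, SignType.sign (MvPolynomial.eval x Q) = SignType.sign (MvPolynomial.eval y Q)

theorem SignAgree.mono {𝒬 𝒬' : List (MvPolynomial ι ℝ)} {x y : ι → ℝ} (h : SignAgree 𝒬 x y)
    (hs : 𝒬' ⊆ 𝒬) : SignAgree 𝒬' x y := fun Q hQ => h Q (hs hQ)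

/-- Specialization of the coefficients at a parameter point. -/
noncomputable def spec (x : ι → ℝ) (P : (MvPolynomial ι ℝ)[X]) : ℝ[X] :=
  P.map (MvPolynomial.eval x)

/-- A family of parametrized polynomials has the same sign diagram at two parameter points. -/
def SameDiagram (L : List (MvPolynomial ι ℝ)[X]) (x y : ι → ℝ) : Prop :=
  ∃ φ : ℝ ≃o ℝ, ∀ P ∈ L, ∀ t,
    SignType.sign ((spec x P).eval t) = SignType.sign ((spec y P).eval (φ t))

/-- The sign diagram of a parametrized family depends on finitely many signs only. -/
def DiagramDetermined (L : List (MvPolynomial ι ℝ)[X]) : Prop :=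
  ∃ 𝒬 : List (MvPolynomial ι ℝ), ∀ x y, SignAgree 𝒬 x y → SameDiagram L x y

/-- At a root of the specialized `Q` the division identity reads `q ^ N * P = S`, where `q` is the
value of `Q.coeff e`. One more factor `q ^ N` makes the multiplier the positive number `q ^ (2 *
N)`, so signs agree. `Q` is truncated at `e` because specialization can lower its degree. -/
theorem exists_param_rem (P Q : (MvPolynomial ι ℝ)[X]) (e : ℕ) :
    ∃ S : (MvPolynomial ι ℝ)[X], S.degree < e ∧ ∀ (x : ι → ℝ) (t : ℝ),
      MvPolynomial.eval x (Q.coeff e) ≠ 0 → (spec x Q).natDegree ≤ e → (spec x Q).eval t = 0 →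
        SignType.sign ((spec x P).eval t) = SignType.sign ((spec x S).eval t) := by
  set T : (MvPolynomial ι ℝ)[X] := ∑ i ∈ Finset.range (e + 1), C (Q.coeff i) * X ^ i with hT
  have hc : ∀ m, T.coeff m = if m ≤ e then Q.coeff m else 0 := by
    intro m
    simp [hT, coeff_C_mul, coeff_X_pow]
  have hTd : T.natDegree ≤ e := natDegree_le_iff_coeff_eq_zero.2 fun m hm => by
    rw [hc, if_neg (by omega)]
  obtain ⟨N, A, S, h, hS⟩ := exists_pseudo_rem T e hTd (P.natDegree + 1) P
    (degree_le_natDegree.trans_lt (by exact_mod_cast Nat.lt_succ_self _))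
  have hTe : T.coeff e = Q.coeff e := by rw [hc, if_pos le_rfl]
  rw [hTe] at h
  refine ⟨C (Q.coeff e ^ N) * S, ?_, fun x t hx hd ht => ?_⟩
  · rw [degree_lt_iff_coeff_zero] at hS ⊢
    intro m hm
    rw [coeff_C_mul, hS m hm, mul_zero]
  · have hTQ : spec x T = spec x Q := by
      ext m
      rw [spec, spec, coeff_map, coeff_map, hc]
      split_ifs with hm
      · rfl
      · have := coeff_eq_zero_of_natDegree_lt (p := spec x Q) (n := m) (by omega)
        rw [spec, coeff_map] at this
        rw [this, map_zero]
    have h' := congrArg (fun f => (spec x f).eval t) h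
    rw [← hTQ] at ht
    simp only [spec, Polynomial.map_mul, Polynomial.map_add, eval_mul, eval_add, map_C, eval_C] at h' ht ⊢
    rw [ht, mul_zero, zero_add] at h'
    rw [map_pow] at h' ⊢
    rw [← h', ← mul_assoc, ← pow_add, ← two_mul, pow_mul, sign_mul,
      sign_pos (pow_pos (by positivity) _), one_mul]

/-- A pseudo-remainder of `P` by the truncation of `Q` to degree `e`. -/
noncomputable def paramRem (P Q : (MvPolynomial ι ℝ)[X]) (e : ℕ) : (MvPolynomial ι ℝ)[X] :=
  (exists_param_rem P Q e).choose

theorem degree_paramRem (P Q : (MvPolynomial ι ℝ)[X]) (e : ℕ) : (paramRem P Q e).degree < e :=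
  (exists_param_rem P Q e).choose_spec.1

theorem sign_paramRem (P Q : (MvPolynomial ι ℝ)[X]) {x : ι → ℝ} {t : ℝ} (hQ : spec x Q ≠ 0)
    (ht : (spec x Q).eval t = 0) :
    SignType.sign ((spec x P).eval t) =
      SignType.sign ((spec x (paramRem P Q (spec x Q).natDegree)).eval t) := by
  refine (exists_param_rem P Q _).choose_spec.2 x t ?_ le_rfl ht
  rw [← coeff_map]
  exact leadingCoeff_ne_zero.2 hQ

theorem SignAgree.spec_natDegree {x y : ι → ℝ}
    {P : (MvPolynomial ι ℝ)[X]}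
    (h : SignAgree ((List.range (P.natDegree + 1)).map P.coeff) x y) :
    (∀ i, SignType.sign ((spec x P).coeff i) = SignType.sign ((spec y P).coeff i)) ∧
      (spec x P).natDegree = (spec y P).natDegree := by
  have h1 : ∀ i, SignType.sign ((spec x P).coeff i) = SignType.sign ((spec y P).coeff i) := by
    intro i
    rw [spec, spec, coeff_map, coeff_map]
    by_cases hi : i ≤ P.natDegree
    · exact h _ (List.mem_map.2 ⟨i, List.mem_range.2 (by omega), rfl⟩)
    · rw [coeff_eq_zero_of_natDegree_lt (by omega), (MvPolynomial.eval x).map_zero,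
        (MvPolynomial.eval y).map_zero]
  have h0 : ∀ i, (spec x P).coeff i = 0 ↔ (spec y P).coeff i = 0 := fun i => by
    rw [← sign_eq_zero_iff, h1, sign_eq_zero_iff]
  refine ⟨h1, le_antisymm ?_ ?_⟩
  · exact natDegree_le_iff_coeff_eq_zero.2 fun m hm =>
      (h0 m).2 (coeff_eq_zero_of_natDegree_lt hm)
  · exact natDegree_le_iff_coeff_eq_zero.2 fun m hm =>
      (h0 m).1 (coeff_eq_zero_of_natDegree_lt hm)

/-- The marks are the roots of `P'` and of the members of `L`. They include the critical points of
`P`, and the sign of `P` at a root of `Q` is that of a remainder, already matched by `φ`. So the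
matching extends to `P`, and it still serves the other members because their roots are marks. -/
theorem SameDiagram.cons {L : List (MvPolynomial ι ℝ)[X]} {P : (MvPolynomial ι ℝ)[X]}
    {x y : ι → ℝ}
    (h : SameDiagram (P.derivative :: L ++ (P.derivative :: L).flatMap
      fun Q => (List.range (Q.natDegree + 1)).map (paramRem P Q)) x y)
    (hc : ∀ Q ∈ P :: P.derivative :: L,
      SignAgree ((List.range (Q.natDegree + 1)).map Q.coeff) x y)
    (hd : (spec x P).natDegree ≠ 0) :
    SameDiagram (P :: L) x y := by
  classical
  obtain ⟨φ, hφ⟩ := h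
  set M := P.derivative :: L with hM
  have hφM : ∀ Q ∈ M, ∀ t,
      SignType.sign ((spec x Q).eval t) = SignType.sign ((spec y Q).eval (φ t)) :=
    fun Q hQ => hφ Q (List.mem_append_left _ hQ)
  -- Members that specialize to zero are left out, since they vanish everywhere; they are treated
  -- separately at the end.
  set Z : Finset ℝ := (M.toFinset.filter fun Q => spec x Q ≠ 0).biUnion
    fun Q => (spec x Q).roots.toFinset with hZ
  have memZ : ∀ t, t ∈ Z ↔ ∃ Q ∈ M, spec x Q ≠ 0 ∧ (spec x Q).eval t = 0 := by
    intro t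
    simp only [hZ, Finset.mem_biUnion, Finset.mem_filter, List.mem_toFinset,
      Multiset.mem_toFinset, mem_roots', IsRoot]
    constructor
    · rintro ⟨Q, ⟨h1, h2⟩, -, h3⟩
      exact ⟨Q, h1, h2, h3⟩
    · rintro ⟨Q, h1, h2, h3⟩
      exact ⟨Q, ⟨h1, h2⟩, h2, h3⟩
  have hcP := (hc P (by simp)).spec_natDegree
  have hp0 : spec x P ≠ 0 := fun h => hd (by simp [h])
  have hdx : spec x P.derivative = (spec x P).derivative := derivative_map .. |>.symm
  have hdy : spec y P.derivative = (spec y P).derivative := derivative_map .. |>.symm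
  have hd0 : spec x P.derivative ≠ 0 := fun h => hd (by
    rw [hdx] at h
    exact derivative_eq_zero.1 h)
  have hcrit : ∀ t, (spec x P).derivative.eval t = 0 → t ∈ Z := fun t ht =>
    (memZ t).2 ⟨P.derivative, by simp [hM], hd0, by rwa [hdx]⟩
  obtain ⟨ψ, hψZ, hψ⟩ := exists_orderIso_sign_eq (φ := φ) (Z := Z) hcP.2 hp0
    (by rw [leadingCoeff, leadingCoeff, ← hcP.2, hcP.1]) hcrit
    (fun s hs => ⟨φ.symm s, hcrit _ (by
      rw [← hdx, ← sign_eq_zero_iff, hφM _ (by simp [hM]), hdy, φ.apply_symm_apply, hs, sign_zero]),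
      by simp⟩)
    (fun z hz => by
      obtain ⟨Q, hQ, h1, h2⟩ := (memZ z).1 hz
      have hcQ := (hc Q (List.mem_cons_of_mem _ hQ)).spec_natDegree
      have h3 : (spec y Q).eval (φ z) = 0 := by
        rw [← sign_eq_zero_iff, ← hφM Q hQ, h2, sign_zero]
      have h4 : spec y Q ≠ 0 := fun h0 => h1 (by
        ext i
        have := hcQ.1 i
        rw [h0, coeff_zero, sign_zero, sign_eq_zero_iff] at this
        rw [this, coeff_zero])
      rw [sign_paramRem P Q h1 h2, sign_paramRem P Q h4 h3, ← hcQ.2]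
      refine hφ _ (List.mem_append_right _ (List.mem_flatMap.2 ⟨Q, hQ, List.mem_map.2
        ⟨_, List.mem_range.2 (Nat.lt_succ_of_le natDegree_map_le), rfl⟩⟩)) z)
  refine ⟨ψ, fun Q hQ => ?_⟩
  rcases List.mem_cons.1 hQ with rfl | hQ
  · exact hψ
  have hQM : Q ∈ M := List.mem_cons_of_mem _ hQ
  by_cases h0 : spec x Q = 0
  · intro t
    have h1 : spec y Q = 0 := by
      have hcQ := (hc Q (by simp [hQM])).spec_natDegree
      ext i
      have := hcQ.1 i
      rw [h0, coeff_zero, sign_zero, eq_comm, sign_eq_zero_iff] at this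
      rw [this, coeff_zero]
    rw [h0, h1]; simp
  · exact sign_eval_orderIso_congr hψZ (fun t ht => (memZ t).2 ⟨Q, hQM, h0, ht⟩) (hφM Q hQM)

/-- A polynomial of degree at most `d` is traded for polynomials of degree below `d`. Where its
coefficient at `d` vanishes, the top term is dropped; elsewhere the derivative and the remainders
suffice. The signs needed for both branches are collected, together with those of all coefficients
involved. -/
theorem diagramDetermined_cons {d : ℕ} {P : (MvPolynomial ι ℝ)[X]}
    {L : List (MvPolynomial ι ℝ)[X]} (hP : P.degree < (d + 1 : ℕ))
    (hL : ∀ Q ∈ L, Q.degree < (d + 1 : ℕ))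
    (ih : ∀ M : List (MvPolynomial ι ℝ)[X], (∀ Q ∈ M, Q.degree < d) →
      DiagramDetermined (L ++ M)) : DiagramDetermined (P :: L) := by
  have herase : (P - C (P.coeff d) * X ^ d).degree < (d : WithBot ℕ) := by
    rw [degree_lt_iff_coeff_zero] at hP ⊢
    intro m hm
    rw [coeff_sub, coeff_C_mul, coeff_X_pow]
    split_ifs with h
    · rw [h]; ring
    · rw [hP m (by omega)]; ring
  have hderiv : P.derivative.degree < d := by
    rw [degree_lt_iff_coeff_zero] at hP ⊢
    intro m hm
    rw [coeff_derivative, hP _ (by omega), zero_mul]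
  obtain ⟨𝒬₁, h₁⟩ := ih [P - C (P.coeff d) * X ^ d] (by simpa using herase)
  obtain ⟨𝒬₂, h₂⟩ := ih (P.derivative :: (P.derivative :: L).flatMap
      fun Q => (List.range (Q.natDegree + 1)).map (paramRem P Q)) (by
    intro S hS
    rcases List.mem_cons.1 hS with rfl | hS
    · exact hderiv
    obtain ⟨Q, hQ, hS⟩ := List.mem_flatMap.1 hS
    obtain ⟨e, he, rfl⟩ := List.mem_map.1 hS
    refine (degree_paramRem P Q e).trans_le ?_
    have hQd : Q.degree < (d + 1 : ℕ) := by
      rcases List.mem_cons.1 hQ with rfl | hQ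
      · exact hderiv.trans (by exact_mod_cast Nat.lt_succ_self d)
      · exact hL Q hQ
    have : Q.natDegree ≤ d := natDegree_le_iff_coeff_eq_zero.2
      fun m hm => (degree_lt_iff_coeff_zero _ _).1 hQd m hm
    have he := List.mem_range.1 he
    exact_mod_cast (show e ≤ d by omega))
  refine ⟨𝒬₁ ++ 𝒬₂ ++ (P :: P.derivative :: L).flatMap
    (fun Q => (List.range (Q.natDegree + 1)).map Q.coeff) ++ [P.coeff d], fun x y hxy => ?_⟩
  have hcd : SignType.sign (MvPolynomial.eval x (P.coeff d)) =
    SignType.sign (MvPolynomial.eval y (P.coeff d)) := hxy _ (by simp)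
  have hd1 : ∀ x : ι → ℝ, (spec x P).natDegree ≤ d := fun x =>
    natDegree_map_le.trans (natDegree_le_iff_coeff_eq_zero.2
      fun m hm => (degree_lt_iff_coeff_zero _ _).1 hP m hm)
  by_cases hx : MvPolynomial.eval x (P.coeff d) = 0
  · have hy : MvPolynomial.eval y (P.coeff d) = 0 := by
      rwa [hx, sign_zero, eq_comm, sign_eq_zero_iff] at hcd
    obtain ⟨φ, hφ⟩ := h₁ x y (hxy.mono (by intro a ha; simp [ha]))
    refine ⟨φ, fun Q hQ t => ?_⟩
    rcases List.mem_cons.1 hQ with rfl | hQ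
    · have := hφ (Q - C (Q.coeff d) * X ^ d) (by simp) t
      simpa [spec, hx, hy] using this
    · exact hφ Q (by simp [hQ]) t
  · rcases Nat.eq_zero_or_pos d with rfl | hdpos
    · obtain ⟨φ, hφ⟩ := h₁ x y (hxy.mono (by intro a ha; simp [ha]))
      refine ⟨φ, fun Q hQ t => ?_⟩
      rcases List.mem_cons.1 hQ with rfl | hQ
      · rw [eq_C_of_natDegree_eq_zero (Nat.le_zero.1 (hd1 x)),
          eq_C_of_natDegree_eq_zero (Nat.le_zero.1 (hd1 y)), eval_C, eval_C]
        simpa [spec] using hcd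
      · exact hφ Q (by simp [hQ]) t
    · refine SameDiagram.cons ?_ (fun Q hQ => hxy.mono fun a ha => ?_) ?_
      · obtain ⟨φ, hφ⟩ := h₂ x y (hxy.mono (by intro a ha; simp [ha]))
        refine ⟨φ, fun Q hQ => hφ Q ?_⟩
        simp only [List.cons_append, List.mem_cons, List.mem_append] at hQ ⊢
        tauto
      · simp only [List.mem_append]
        exact Or.inl (Or.inr (List.mem_flatMap.2 ⟨Q, hQ, ha⟩))
      · have : (spec x P).coeff d ≠ 0 := by rwa [spec, coeff_map]
        have := le_natDegree_of_ne_zero this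
        omega

/-- Outer induction on the degree bound, inner induction on the number of polynomials allowed to
reach it; the arbitrarily many new ones all have smaller degree. -/
theorem diagramDetermined (L : List (MvPolynomial ι ℝ)[X]) : DiagramDetermined L := by
  have key : ∀ (d : ℕ) (L : List (MvPolynomial ι ℝ)[X]), (∀ P ∈ L, P.degree < d) →
      DiagramDetermined L := by
    intro d
    induction d with
    | zero =>
      refine fun L hL => ⟨[], fun x y _ => ⟨OrderIso.refl ℝ, fun P hP t => ?_⟩⟩
      have : P = 0 := by simpa using hL P hP
      simp [this, spec]
    | succ d ih =>
      have aux : ∀ H low : List (MvPolynomial ι ℝ)[X], (∀ P ∈ H, P.degree < (d + 1 : ℕ)) →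
          (∀ P ∈ low, P.degree < d) → DiagramDetermined (H ++ low) := by
        intro H
        induction H with
        | nil => exact fun low _ hlow => ih low hlow
        | cons P H ihH =>
          intro low hH hlow
          have hlt : (d : WithBot ℕ) < (d + 1 : ℕ) := by exact_mod_cast Nat.lt_succ_self d
          refine diagramDetermined_cons (d := d) (hH P (by simp)) (fun Q hQ => ?_) fun M hM => ?_
          · rcases List.mem_append.1 hQ with hQ | hQ
            · exact hH Q (by simp [hQ])
            · exact (hlow Q hQ).trans hlt
          · change DiagramDetermined (H ++ low ++ M)
            rw [List.append_assoc]
            refine ihH _ (fun Q hQ => hH Q (by simp [hQ])) fun Q hQ => ?_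
            rcases List.mem_append.1 hQ with hQ | hQ
            · exact hlow Q hQ
            · exact hM Q hQ
      intro L hL
      simpa using aux L [] hL (by simp)
  refine key ((L.map natDegree).sum + 1) L fun P hP => degree_le_natDegree.trans_lt ?_
  exact_mod_cast Nat.lt_succ_of_le (List.le_sum_of_mem (List.mem_map_of_mem hP))

end NuclearFace

/-! ### Semialgebraic sets, Tarski–Seidenberg, and polynomial functions. -/

namespace NuclearFace

variable {ι : Type}

theorem IsSemialgebraic.inter {s t : Set (ι → ℝ)} (hs : IsSemialgebraic s)
    (ht : IsSemialgebraic t) : IsSemialgebraic (s ∩ t) := by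
  have := (hs.compl.union ht.compl).compl
  rwa [Set.compl_union, compl_compl, compl_compl] at this

theorem isSemialgebraic_univ : IsSemialgebraic (Set.univ : Set (ι → ℝ)) := by
  have := IsSemialgebraic.pos (1 : MvPolynomial ι ℝ)
  simpa using this

theorem isSemialgebraic_empty : IsSemialgebraic (∅ : Set (ι → ℝ)) := by
  simpa using (isSemialgebraic_univ (ι := ι)).compl

theorem isSemialgebraic_sign_eq (Q : MvPolynomial ι ℝ) (σ : SignType) :
    IsSemialgebraic {x | SignType.sign (MvPolynomial.eval x Q) = σ} := by
  have hp := IsSemialgebraic.pos Q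
  have hn := IsSemialgebraic.pos (-Q)
  cases σ with
  | zero =>
    convert (hp.union hn).compl using 1
    ext x
    simp only [SignType.zero_eq_zero, sign_eq_zero_iff, map_neg, Set.mem_ofPred_eq,
      Set.mem_compl_iff, Set.mem_union, not_or, not_lt]
    exact ⟨fun h => by simp [h], fun h => le_antisymm h.1 (by linarith [h.2])⟩
  | neg =>
    convert hn using 1
    ext x
    simp [SignType.neg_eq_neg_one, sign_eq_neg_one_iff]
  | pos =>
    convert hp using 1
    ext x
    simp [SignType.pos_eq_one, sign_eq_one_iff]

/-- The set is cut by the sign of the first polynomial `Q`. On each piece it coincides with its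
saturation under agreement of the remaining signs, to which the induction applies. -/
theorem SignAgree.isSemialgebraic (𝒬 : List (MvPolynomial ι ℝ)) :
    ∀ s : Set (ι → ℝ), (∀ x y, SignAgree 𝒬 x y → (x ∈ s ↔ y ∈ s)) → IsSemialgebraic s := by
  induction 𝒬 with
  | nil =>
    intro s hs
    rcases s.eq_empty_or_nonempty with rfl | ⟨y, hy⟩
    · exact isSemialgebraic_empty
    · convert isSemialgebraic_univ
      exact Set.eq_univ_of_forall fun x => (hs x y (fun Q hQ => by simp at hQ)).2 hy
  | cons Q 𝒬 ih =>
    intro s hs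
    have piece : ∀ σ : SignType, IsSemialgebraic
        ({x | SignType.sign (MvPolynomial.eval x Q) = σ} ∩
          {x | ∃ y ∈ s, SignType.sign (MvPolynomial.eval y Q) = σ ∧ SignAgree 𝒬 x y}) := by
      refine fun σ => (isSemialgebraic_sign_eq Q σ).inter (ih _ fun x y hxy => ?_)
      have trans : ∀ x y : ι → ℝ, SignAgree 𝒬 x y →
          (∃ z ∈ s, SignType.sign (MvPolynomial.eval z Q) = σ ∧ SignAgree 𝒬 x z) →
          ∃ z ∈ s, SignType.sign (MvPolynomial.eval z Q) = σ ∧ SignAgree 𝒬 y z := by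
        rintro x y hxy ⟨z, hz, h1, h2⟩
        exact ⟨z, hz, h1, fun P hP => (hxy P hP).symm.trans (h2 P hP)⟩
      exact ⟨trans x y hxy, trans y x fun P hP => (hxy P hP).symm⟩
    convert ((piece 1).union (piece 0)).union (piece (-1)) using 1
    ext x
    have key : ∀ σ, SignType.sign (MvPolynomial.eval x Q) = σ → (x ∈ s ↔
        ∃ y ∈ s, SignType.sign (MvPolynomial.eval y Q) = σ ∧ SignAgree 𝒬 x y) := by
      refine fun σ hσ => ⟨fun h => ⟨x, h, hσ, fun _ _ => rfl⟩, fun ⟨y, hy, h1, h2⟩ =>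
        (hs x y fun P hP => ?_).2 hy⟩
      rcases List.mem_cons.1 hP with rfl | hP
      · rw [hσ, h1]
      · exact h2 P hP
    simp only [Set.mem_union, Set.mem_inter_iff, Set.mem_ofPred_eq]
    constructor
    · intro hx
      rcases hσ : SignType.sign (MvPolynomial.eval x Q) with _ | _ | _
      · exact Or.inl (Or.inr ⟨rfl, (key _ hσ).1 hx⟩)
      · exact Or.inr ⟨rfl, (key _ hσ).1 hx⟩
      · exact Or.inl (Or.inl ⟨rfl, (key _ hσ).1 hx⟩)
    · rintro ((⟨h, h'⟩ | ⟨h, h'⟩) | ⟨h, h'⟩) <;> exact (key _ h).2 h'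

theorem IsSemialgebraic.exists_signAgree {s : Set (ι → ℝ)} (hs : IsSemialgebraic s) :
    ∃ 𝒬 : List (MvPolynomial ι ℝ), ∀ x y, SignAgree 𝒬 x y → (x ∈ s ↔ y ∈ s) := by
  induction hs with
  | pos p =>
    refine ⟨[p], fun x y h => ?_⟩
    rw [Set.mem_ofPred_eq, Set.mem_ofPred_eq, ← sign_eq_one_iff, h p (by simp), sign_eq_one_iff]
  | compl _ ih =>
    obtain ⟨𝒬, h⟩ := ih
    exact ⟨𝒬, fun x y hxy => not_congr (h x y hxy)⟩
  | union _ _ ih1 ih2 =>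
    obtain ⟨𝒬₁, h1⟩ := ih1
    obtain ⟨𝒬₂, h2⟩ := ih2
    exact ⟨𝒬₁ ++ 𝒬₂, fun x y hxy => or_congr
      (h1 x y (hxy.mono (List.subset_append_left _ _)))
      (h2 x y (hxy.mono (List.subset_append_right _ _)))⟩

theorem IsSemialgebraic.preimage_comp {κ : Type} (f : ι → κ) {s : Set (ι → ℝ)}
    (hs : IsSemialgebraic s) : IsSemialgebraic {x : κ → ℝ | x ∘ f ∈ s} := by
  induction hs with
  | pos p =>
    convert IsSemialgebraic.pos (MvPolynomial.rename f p) using 1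
    ext x
    simp [MvPolynomial.eval_rename]
  | compl _ ih => exact ih.compl
  | union _ _ ih1 ih2 => exact ih1.union ih2

/-- The Tarski–Seidenberg theorem: elimination of one real variable. -/
theorem IsSemialgebraic.exists_option {s : Set (Option ι → ℝ)} (hs : IsSemialgebraic s) :
    IsSemialgebraic {x : ι → ℝ | ∃ t : ℝ, (fun o : Option ι => o.elim t x) ∈ s} := by
  obtain ⟨𝒬, h𝒬⟩ := hs.exists_signAgree
  obtain ⟨𝒬', h𝒬'⟩ := diagramDetermined (𝒬.map (MvPolynomial.optionEquivLeft ℝ ι))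
  have one : ∀ x y : ι → ℝ, SignAgree 𝒬' x y →
      (∃ t : ℝ, (fun o : Option ι => o.elim t x) ∈ s) →
      ∃ t : ℝ, (fun o : Option ι => o.elim t y) ∈ s := by
    rintro x y hxy ⟨t, ht⟩
    obtain ⟨φ, hφ⟩ := h𝒬' x y hxy
    -- A witness `t` over `x` is carried by the matching to the witness `φ t` over `y`.
    refine ⟨φ t, (h𝒬 _ _ fun Q hQ => ?_).1 ht⟩
    rw [MvPolynomial.optionEquivLeft_elim_eval, MvPolynomial.optionEquivLeft_elim_eval]
    exact hφ _ (List.mem_map_of_mem hQ) t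
  exact SignAgree.isSemialgebraic 𝒬' _ fun x y hxy =>
    ⟨one x y hxy, one y x fun P hP => (hxy P hP).symm⟩

/-- The Tarski–Seidenberg theorem: projections of semialgebraic sets are semialgebraic. -/
theorem IsSemialgebraic.exists_fin {n : ℕ} {s : Set (ι ⊕ Fin n → ℝ)} (hs : IsSemialgebraic s) :
    IsSemialgebraic {x : ι → ℝ | ∃ v : Fin n → ℝ, Sum.elim x v ∈ s} := by
  induction n with
  | zero =>
    convert hs.preimage_comp (Sum.elim id Fin.elim0) using 1
    ext x
    have : ∀ v : Fin 0 → ℝ, Sum.elim x v = x ∘ Sum.elim id Fin.elim0 := fun v => by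
      ext (i | i)
      · rfl
      · exact i.elim0
    simp [this]
  | succ n ih =>
    convert ih (hs.preimage_comp (Sum.elim (fun i => some (Sum.inl i))
      (Fin.cases none fun j => some (Sum.inr j)))).exists_option using 1
    ext x
    have key : ∀ (v : Fin n → ℝ) (t : ℝ), (fun o : Option (ι ⊕ Fin n) => o.elim t (Sum.elim x v)) ∘
        (Sum.elim (fun i => some (Sum.inl i)) (Fin.cases none fun j => some (Sum.inr j))) =
        Sum.elim x (Fin.cons t v : Fin (n + 1) → ℝ) := by
      intro v t
      ext (i | i)
      · rfl
      · refine Fin.cases ?_ (fun j => ?_) i <;> simp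
    simp only [Set.mem_ofPred_eq, key]
    constructor
    · rintro ⟨v, hv⟩
      exact ⟨Fin.tail v, v 0, by rwa [Fin.cons_self_tail]⟩
    · rintro ⟨v, t, h⟩
      exact ⟨_, h⟩

theorem isSemialgebraic_forall {κ : Type*} [Finite κ] {s : κ → Set (ι → ℝ)}
    (hs : ∀ k, IsSemialgebraic (s k)) : IsSemialgebraic {x | ∀ k, x ∈ s k} := by
  classical
  have := Fintype.ofFinite κ
  have key : ∀ F : Finset κ, IsSemialgebraic {x | ∀ k ∈ F, x ∈ s k} := by
    intro F
    induction F using Finset.induction_on with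
    | empty => simpa using isSemialgebraic_univ
    | insert a F _ ih =>
      convert (hs a).inter ih using 1
      ext x
      simp
  simpa using key Finset.univ

/-- Real polynomial functions. -/
def IsPolyFun (f : (ι → ℝ) → ℝ) : Prop := ∃ p : MvPolynomial ι ℝ, ∀ x, f x = MvPolynomial.eval x p

namespace IsPolyFun

variable {f g : (ι → ℝ) → ℝ}

theorem const (c : ℝ) : IsPolyFun fun _ : ι → ℝ => c := ⟨MvPolynomial.C c, by simp⟩

theorem coord (i : ι) : IsPolyFun fun x : ι → ℝ => x i := ⟨MvPolynomial.X i, by simp⟩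

theorem add (hf : IsPolyFun f) (hg : IsPolyFun g) : IsPolyFun fun x => f x + g x := by
  obtain ⟨p, hp⟩ := hf
  obtain ⟨q, hq⟩ := hg
  exact ⟨p + q, fun x => by simp [hp, hq]⟩

theorem mul (hf : IsPolyFun f) (hg : IsPolyFun g) : IsPolyFun fun x => f x * g x := by
  obtain ⟨p, hp⟩ := hf
  obtain ⟨q, hq⟩ := hg
  exact ⟨p * q, fun x => by simp [hp, hq]⟩

theorem neg (hf : IsPolyFun f) : IsPolyFun fun x => -f x := by
  obtain ⟨p, hp⟩ := hf
  exact ⟨-p, fun x => by simp [hp]⟩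

theorem sub (hf : IsPolyFun f) (hg : IsPolyFun g) : IsPolyFun fun x => f x - g x := by
  simpa only [sub_eq_add_neg] using hf.add hg.neg

theorem pow (hf : IsPolyFun f) (n : ℕ) : IsPolyFun fun x => f x ^ n := by
  obtain ⟨p, hp⟩ := hf
  exact ⟨p ^ n, fun x => by simp [hp]⟩

theorem isSemialgebraic_nonneg (hf : IsPolyFun f) : IsSemialgebraic {x | 0 ≤ f x} := by
  obtain ⟨p, hp⟩ := hf.neg
  convert (IsSemialgebraic.pos p).compl using 1
  ext x
  simp [← hp]

theorem isSemialgebraic_le (hf : IsPolyFun f) (hg : IsPolyFun g) :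
    IsSemialgebraic {x | f x ≤ g x} := by
  simpa using (hg.sub hf).isSemialgebraic_nonneg

theorem isSemialgebraic_eq (hf : IsPolyFun f) (hg : IsPolyFun g) :
    IsSemialgebraic {x | f x = g x} := by
  convert (hf.isSemialgebraic_le hg).inter (hg.isSemialgebraic_le hf) using 1
  ext x
  exact le_antisymm_iff

end IsPolyFun

/-- Complex-valued functions with polynomial real and imaginary parts. -/
def IsCPolyFun (f : (ι → ℝ) → ℂ) : Prop :=
  IsPolyFun (fun x => (f x).re) ∧ IsPolyFun fun x => (f x).im

namespace IsCPolyFun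

variable {f g : (ι → ℝ) → ℂ}

theorem const (c : ℂ) : IsCPolyFun fun _ : ι → ℝ => c := ⟨.const _, .const _⟩

theorem add (hf : IsCPolyFun f) (hg : IsCPolyFun g) : IsCPolyFun fun x => f x + g x :=
  ⟨hf.1.add hg.1, hf.2.add hg.2⟩

theorem sub (hf : IsCPolyFun f) (hg : IsCPolyFun g) : IsCPolyFun fun x => f x - g x :=
  ⟨hf.1.sub hg.1, hf.2.sub hg.2⟩

theorem mul (hf : IsCPolyFun f) (hg : IsCPolyFun g) : IsCPolyFun fun x => f x * g x :=
  ⟨(hf.1.mul hg.1).sub (hf.2.mul hg.2), (hf.1.mul hg.2).add (hf.2.mul hg.1)⟩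

theorem conj (hf : IsCPolyFun f) : IsCPolyFun fun x => starRingEnd ℂ (f x) :=
  ⟨hf.1, hf.2.neg⟩

theorem pow (hf : IsCPolyFun f) (n : ℕ) : IsCPolyFun fun x => f x ^ n := by
  induction n with
  | zero => simpa using const (ι := ι) 1
  | succ n ih => simpa only [pow_succ] using ih.mul hf

theorem sum {κ : Type*} (s : Finset κ) {f : κ → (ι → ℝ) → ℂ} (hf : ∀ k, IsCPolyFun (f k)) :
    IsCPolyFun fun x => ∑ k ∈ s, f k x := by
  classical
  induction s using Finset.induction_on with
  | empty => simpa using const (ι := ι) 0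
  | insert a s ha ih => simpa only [Finset.sum_insert ha] using (hf a).add ih

theorem prod {κ : Type*} (s : Finset κ) {f : κ → (ι → ℝ) → ℂ} (hf : ∀ k, IsCPolyFun (f k)) :
    IsCPolyFun fun x => ∏ k ∈ s, f k x := by
  classical
  induction s using Finset.induction_on with
  | empty => simpa using const (ι := ι) 1
  | insert a s ha ih => simpa only [Finset.prod_insert ha] using (hf a).mul ih

theorem normSq (hf : IsCPolyFun f) : IsPolyFun fun x => ‖f x‖ ^ 2 := by
  have : (fun x => ‖f x‖ ^ 2) = fun x => (f x).re * (f x).re + (f x).im * (f x).im := by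
    ext x
    rw [← Complex.normSq_eq_norm_sq, Complex.normSq_apply]
  rw [this]
  exact (hf.1.mul hf.1).add (hf.2.mul hf.2)

theorem isSemialgebraic_eq (hf : IsCPolyFun f) (hg : IsCPolyFun g) :
    IsSemialgebraic {x | f x = g x} := by
  convert (hf.1.isSemialgebraic_eq hg.1).inter (hf.2.isSemialgebraic_eq hg.2) using 1
  ext x
  exact Complex.ext_iff

end IsCPolyFun

end NuclearFace

/-! ### Spectral and nuclear norms: duality and certificates. -/

namespace NuclearFace

open scoped ComplexConjugate

/-- By Carathéodory the hull is the continuous image of a simplex times a power of `s`; combinations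
of fewer points are padded with weight `0` at `z₀`. -/
theorem isCompact_convexHull_of_isCompact {E : Type*} [NormedAddCommGroup E] [NormedSpace ℝ E]
    [FiniteDimensional ℝ E] {s : Set E} (hs : IsCompact s) : IsCompact (convexHull ℝ s) := by
  classical
  rcases s.eq_empty_or_nonempty with rfl | ⟨z₀, hz₀⟩
  · simp
  set n := Module.finrank ℝ E + 1 with hn
  set f : (Fin n → ℝ) × (Fin n → E) → E := fun p => ∑ i, p.1 i • p.2 i with hf
  have hcont : Continuous f := by fun_prop
  have himg : convexHull ℝ s = f '' (stdSimplex ℝ (Fin n) ×ˢ Set.univ.pi fun _ => s) := by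
    apply Set.Subset.antisymm
    · intro x hx
      obtain ⟨κ, _, z, w, hz, hai, hw, hw1, rfl⟩ := eq_pos_convex_span_of_mem_convexHull hx
      have hcard : Fintype.card κ ≤ Fintype.card (Fin n) := by
        rw [Fintype.card_fin]
        exact hai.card_le_finrank_succ.trans (Nat.succ_le_succ (Submodule.finrank_le _))
      obtain ⟨g⟩ := Function.Embedding.nonempty_of_card_le hcard
      have hw0 : ∀ j ∉ Set.range g, Function.extend g w 0 j = 0 := fun j hj =>
        Function.extend_apply' (f := g) w 0 j hj
      refine ⟨(Function.extend g w 0, Function.extend g z fun _ => z₀), ⟨⟨fun j => ?_, ?_⟩, ?_⟩, ?_⟩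
      · by_cases hj : ∃ k, g k = j
        · obtain ⟨k, rfl⟩ := hj
          simpa [g.injective.extend_apply] using (hw k).le
        · simp [Function.extend_apply' _ _ _ hj]
      · rw [← hw1]
        exact (Fintype.sum_of_injective g g.injective _ _ hw0
          fun k => (g.injective.extend_apply _ _ _).symm).symm
      · intro j _
        by_cases hj : ∃ k, g k = j
        · obtain ⟨k, rfl⟩ := hj
          simpa [g.injective.extend_apply] using hz ⟨k, rfl⟩
        · simpa [Function.extend_apply' _ _ _ hj] using hz₀
      · refine (Fintype.sum_of_injective g g.injective _ _ (fun j hj => ?_) fun k => ?_).symm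
        · dsimp only
          rw [hw0 j hj, zero_smul]
        · dsimp only
          rw [g.injective.extend_apply, g.injective.extend_apply]
    · rintro _ ⟨⟨w, z⟩, ⟨hw, hz⟩, rfl⟩
      exact (convex_convexHull ℝ s).sum_mem (fun i _ => hw.1 i) hw.2
        fun i _ => subset_convexHull ℝ s (hz i trivial)
  rw [himg]
  exact ((isCompact_stdSimplex ℝ (Fin n)).prod (isCompact_univ_pi fun _ => hs)).image hcont

variable {d n : ℕ}

theorem tensorProd_apply (x : Fin d → EuclideanSpace ℂ (Fin n)) (i : Fin d → Fin n) :
    tensorProd x i = ∏ j, x j (i j) := rfl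

theorem inner_tensor (S T : Tensor d n) : inner ℂ S T = ∑ i, T i * conj (S i) := by
  simp [PiLp.inner_apply]

theorem norm_tensorProd (x : Fin d → EuclideanSpace ℂ (Fin n)) :
    ‖tensorProd x‖ = ∏ j, ‖x j‖ := by
  have h : ‖tensorProd x‖ ^ 2 = (∏ j, ‖x j‖) ^ 2 := by
    rw [EuclideanSpace.norm_sq_eq, ← Finset.prod_pow]
    simp only [EuclideanSpace.norm_sq_eq, tensorProd_apply, norm_prod, ← Finset.prod_pow,
      Finset.prod_univ_sum, Fintype.piFinset_univ]
  exact (pow_left_inj₀ (norm_nonneg _) (Finset.prod_nonneg fun _ _ => norm_nonneg _) two_ne_zero).1 h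

theorem tensorProd_smul (c : Fin d → ℂ) (x : Fin d → EuclideanSpace ℂ (Fin n)) :
    tensorProd (fun j => c j • x j) = (∏ j, c j) • tensorProd x := by
  ext i
  simp [tensorProd_apply, Finset.prod_mul_distrib]

theorem norm_inner_le_spectral (T : Tensor d n) {x : Fin d → EuclideanSpace ℂ (Fin n)}
    (hx : ∀ j, ‖x j‖ = 1) : ‖inner ℂ T (tensorProd x)‖ ≤ tensorSpectralNorm T := by
  refine le_csSup ⟨‖T‖, ?_⟩ ⟨x, hx, rfl⟩
  rintro _ ⟨y, hy, rfl⟩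
  refine (norm_inner_le_norm _ _).trans ?_
  rw [norm_tensorProd]
  simp [hy]

theorem spectralNorm_nonneg (T : Tensor d n) : 0 ≤ tensorSpectralNorm T :=
  Real.sSup_nonneg (by rintro _ ⟨y, _, rfl⟩; exact norm_nonneg _)

theorem spectralNorm_le {T : Tensor d n} {c : ℝ} (hc : 0 ≤ c)
    (h : ∀ x : Fin d → EuclideanSpace ℂ (Fin n), (∀ j, ‖x j‖ = 1) →
      ‖inner ℂ T (tensorProd x)‖ ≤ c) : tensorSpectralNorm T ≤ c :=
  Real.sSup_le (by rintro _ ⟨y, hy, rfl⟩; exact h y hy) hc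

theorem norm_inner_le_spectral_mul (T : Tensor d n) (x : Fin d → EuclideanSpace ℂ (Fin n)) :
    ‖inner ℂ T (tensorProd x)‖ ≤ tensorSpectralNorm T * ∏ j, ‖x j‖ := by
  by_cases h0 : ∃ j, x j = 0
  · obtain ⟨j, hj⟩ := h0
    have h1 : ∏ j, ‖x j‖ = 0 := Finset.prod_eq_zero (Finset.mem_univ j) (by simp [hj])
    have h2 : tensorProd x = 0 := norm_eq_zero.1 (by rw [norm_tensorProd, h1])
    simp [h1, h2]
  · push Not at h0
    have hx : tensorProd x = (∏ j, ((‖x j‖ : ℝ) : ℂ)) •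
        tensorProd fun j => (((‖x j‖ : ℝ) : ℂ)⁻¹) • x j := by
      rw [← tensorProd_smul]
      congr 1
      ext1 j
      rw [smul_smul, mul_inv_cancel₀ (by simpa using h0 j), one_smul]
    rw [hx, inner_smul_right, norm_mul, norm_prod, mul_comm]
    simp only [Complex.norm_real, norm_norm]
    refine mul_le_mul_of_nonneg_right (norm_inner_le_spectral T fun j => ?_)
      (Finset.prod_nonneg fun _ _ => norm_nonneg _)
    rw [norm_smul, norm_inv, Complex.norm_real, norm_norm, inv_mul_cancel₀ (by simpa using h0 j)]

theorem norm_apply_le_spectral (T : Tensor d n) (i : Fin d → Fin n) :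
    ‖T i‖ ≤ tensorSpectralNorm T := by
  classical
  have h := norm_inner_le_spectral T (x := fun j => EuclideanSpace.single (i j) (1 : ℂ)) (by simp)
  have : inner ℂ T (tensorProd fun j => EuclideanSpace.single (i j) (1 : ℂ)) = conj (T i) := by
    rw [inner_tensor, Finset.sum_eq_single i]
    · simp [tensorProd_apply]
    · intro k _ hk
      obtain ⟨j, hj⟩ := Function.ne_iff.1 hk
      rw [tensorProd_apply, Finset.prod_eq_zero (Finset.mem_univ j) (by simp [hj]), zero_mul]
    · simp
  rwa [this, Complex.norm_conj] at h

/-- Needed because `sSup` of an unbounded set is `0` by convention. The spectral norm bounds every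
entry of `X`, so the pairing is bounded by the sum of the moduli of the entries of `T`. -/
theorem bddAbove_nuclear (T : Tensor d n) :
    BddAbove {c : ℝ | ∃ X : Tensor d n, tensorSpectralNorm X ≤ 1 ∧ c = (inner ℂ X T).re} := by
  refine ⟨∑ i, ‖T i‖, ?_⟩
  rintro _ ⟨X, hX, rfl⟩
  refine (Complex.re_le_norm _).trans ?_
  rw [inner_tensor]
  refine (norm_sum_le _ _).trans (Finset.sum_le_sum fun i _ => ?_)
  rw [norm_mul, Complex.norm_conj]
  exact mul_le_of_le_one_right (norm_nonneg _) ((norm_apply_le_spectral X i).trans hX)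

theorem re_inner_le_nuclear {X T : Tensor d n} (hX : tensorSpectralNorm X ≤ 1) :
    (inner ℂ X T).re ≤ nuclearNorm T :=
  le_csSup (bddAbove_nuclear T) ⟨X, hX, rfl⟩

theorem spectralNorm_smul_le (c : ℂ) (X : Tensor d n) :
    tensorSpectralNorm (c • X) ≤ ‖c‖ * tensorSpectralNorm X :=
  spectralNorm_le (mul_nonneg (norm_nonneg _) (spectralNorm_nonneg X)) fun x hx => by
    rw [inner_smul_left, norm_mul, Complex.norm_conj]
    exact mul_le_mul_of_nonneg_left (norm_inner_le_spectral X hx) (norm_nonneg _)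

theorem re_inner_le_mul_nuclear {X : Tensor d n} {s : ℝ} (hs : 0 < s)
    (hX : tensorSpectralNorm X ≤ s) (T : Tensor d n) :
    (inner ℂ X T).re ≤ s * nuclearNorm T := by
  have h := re_inner_le_nuclear (X := ((s⁻¹ : ℝ) : ℂ) • X) (T := T) (by
    refine (spectralNorm_smul_le _ _).trans ?_
    rw [Complex.norm_real, norm_inv, Real.norm_of_nonneg hs.le, inv_mul_le_iff₀ hs, mul_one]
    exact hX)
  rw [inner_smul_left, Complex.conj_ofReal, Complex.re_ofReal_mul, inv_mul_le_iff₀ hs] at h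
  exact h

theorem nuclearNorm_sum_le {r : ℕ} (x : Fin r → Fin d → EuclideanSpace ℂ (Fin n)) :
    nuclearNorm (∑ i, tensorProd (x i)) ≤ ∑ i, ∏ j, ‖x i j‖ := by
  refine Real.sSup_le ?_ (Finset.sum_nonneg fun i _ => Finset.prod_nonneg fun _ _ => norm_nonneg _)
  rintro _ ⟨X, hX, rfl⟩
  rw [inner_sum, Complex.re_sum]
  refine Finset.sum_le_sum fun i _ => (Complex.re_le_norm _).trans
    ((norm_inner_le_spectral_mul X (x i)).trans ?_)
  exact mul_le_of_le_one_left (Finset.prod_nonneg fun _ _ => norm_nonneg _) hX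

/-- A decomposition certified by a dual tensor is nuclear. -/
theorem isNuclearDecomposition_of_le {r : ℕ} {T X : Tensor d n} {s : ℝ} (hs : 0 < s)
    (hX : tensorSpectralNorm X ≤ s) {x : Fin r → Fin d → EuclideanSpace ℂ (Fin n)}
    (hT : T = ∑ i, tensorProd (x i))
    (h : s * ∑ i, ∏ j, ‖x i j‖ ≤ (inner ℂ X T).re) : IsNuclearDecomposition T x := by
  refine ⟨hT, le_antisymm ?_ ?_⟩
  · rw [hT]
    exact nuclearNorm_sum_le x
  · exact le_of_mul_le_mul_left (h.trans (re_inner_le_mul_nuclear hs hX T)) hs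

/-- The product tensors of unit vectors. -/
def unitProducts (d n : ℕ) : Set (Tensor d n) :=
  {P | ∃ x : Fin d → EuclideanSpace ℂ (Fin n), (∀ j, ‖x j‖ = 1) ∧ P = tensorProd x}

theorem isCompact_unitProducts : IsCompact (unitProducts d n) := by
  have h : unitProducts d n = tensorProd ''
      (Set.univ.pi fun _ : Fin d => Metric.sphere (0 : EuclideanSpace ℂ (Fin n)) 1) := by
    ext P
    simp only [unitProducts, Set.mem_ofPred_eq, Set.mem_image, Set.mem_univ_pi, mem_sphere_zero_iff_norm]
    exact ⟨fun ⟨x, hx, h⟩ => ⟨x, hx, h.symm⟩, fun ⟨x, hx, h⟩ => ⟨x, hx, h.symm⟩⟩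
  rw [h]
  refine (isCompact_univ_pi fun _ => isCompact_sphere _ _).image ?_
  refine (PiLp.continuous_toLp 2 _).comp (continuous_pi fun i => ?_)
  exact continuous_finsetProd _ fun j _ =>
    (EuclideanSpace.proj (𝕜 := ℂ) (i j)).continuous.comp (continuous_apply j)

/-- The nuclear unit ball lies in the convex hull of the unit product tensors. -/
theorem mem_convexHull_of_nuclearNorm_le_one [NeZero d] [NeZero n] {S : Tensor d n}
    (hS : nuclearNorm S ≤ 1) : S ∈ convexHull ℝ (unitProducts d n) := by
  classical
  by_contra hn
  obtain ⟨f, u, hf, hu⟩ := RCLike.geometric_hahn_banach_closed_point (𝕜 := ℂ)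
    (convex_convexHull ℝ (unitProducts d n))
    (isCompact_convexHull_of_isCompact isCompact_unitProducts).isClosed hn
  set X : Tensor d n := (InnerProductSpace.toDual ℂ (Tensor d n)).symm f with hX
  have hfX : ∀ v, f v = inner ℂ X v := fun v => by simp [hX]
  have key : ∀ x : Fin d → EuclideanSpace ℂ (Fin n), (∀ j, ‖x j‖ = 1) →
      ‖inner ℂ X (tensorProd x)‖ < u := by
    intro x hx
    -- A phase `c` makes the pairing real and nonnegative. Absorbed into the factor with index `0`,
    -- it keeps the tensor a unit product, so a bound on real parts bounds the modulus.
    obtain ⟨c, hc, h⟩ : ∃ c : ℂ, ‖c‖ = 1 ∧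
        c * inner ℂ X (tensorProd x) = ‖inner ℂ X (tensorProd x)‖ := by
      by_cases h0 : inner ℂ X (tensorProd x) = 0
      · exact ⟨1, by simp, by simp [h0]⟩
      · have hne : ((‖inner ℂ X (tensorProd x)‖ : ℝ) : ℂ) ≠ 0 := by simpa using h0
        refine ⟨‖inner ℂ X (tensorProd x)‖ / inner ℂ X (tensorProd x), ?_, div_mul_cancel₀ _ h0⟩
        rw [norm_div, Complex.norm_real, norm_norm, div_self (by simpa using h0)]
    have hmem : c • tensorProd x ∈ unitProducts d n := by
      refine ⟨fun j => (if j = 0 then c else 1) • x j, fun j => ?_, ?_⟩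
      · rw [norm_smul, hx j, mul_one]
        split_ifs <;> simp [hc]
      · rw [tensorProd_smul]
        simp
    have := hf _ (subset_convexHull ℝ _ hmem)
    rw [hfX, inner_smul_right, h] at this
    simpa using this
  have hu0 : 0 < u := (norm_nonneg _).trans_lt
    (key (fun _ => EuclideanSpace.single 0 1) fun _ => by simp)
  have h1 := re_inner_le_mul_nuclear hu0 (spectralNorm_le hu0.le fun x hx => (key x hx).le) S
  rw [hfX] at hu
  have h2 : u * nuclearNorm S ≤ u := mul_le_of_le_one_right hu0.le hS
  exact absurd (hu.trans_le (h1.trans h2)) (lt_irrefl _)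

theorem nuclearRank_le {r : ℕ} {T : Tensor d n} {x : Fin r → Fin d → EuclideanSpace ℂ (Fin n)}
    (h : IsNuclearDecomposition T x) : nuclearRank T ≤ r :=
  sInf_le ⟨r, x, h, rfl⟩

theorem tensorRank_le_nuclearRank (T : Tensor d n) : tensorRank T ≤ nuclearRank T :=
  sInf_le_sInf fun _ ⟨r, x, h, hk⟩ => ⟨r, x, h.1, hk⟩

end NuclearFace

/-! ### Symmetric cubic tensors, and the maximizers of the pairing with `W₃`. -/

namespace NuclearFace

open scoped ComplexConjugate

theorem forall_index {p : (Fin 3 → Fin 2) → Prop} : (∀ i, p i) ↔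
    (p ![0, 0, 0] ∧ p ![0, 0, 1] ∧ p ![0, 1, 0] ∧ p ![0, 1, 1]) ∧
      p ![1, 0, 0] ∧ p ![1, 0, 1] ∧ p ![1, 1, 0] ∧ p ![1, 1, 1] := by
  refine ⟨fun h => by simp [h], fun h i => ?_⟩
  have hi : i = ![i 0, i 1, i 2] := by
    ext j
    fin_cases j <;> rfl
  rw [hi]
  generalize i 0 = a, i 1 = b, i 2 = c
  fin_cases a <;> fin_cases b <;> fin_cases c <;> simp_all

theorem sum_index {M : Type*} [AddCommMonoid M] (f : (Fin 3 → Fin 2) → M) :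
    ∑ i, f i = f ![0, 0, 0] + f ![0, 0, 1] + f ![0, 1, 0] + f ![0, 1, 1] +
      f ![1, 0, 0] + f ![1, 0, 1] + f ![1, 1, 0] + f ![1, 1, 1] := by
  have h : (Finset.univ : Finset (Fin 3 → Fin 2)) = {![0, 0, 0], ![0, 0, 1], ![0, 1, 0], ![0, 1, 1],
      ![1, 0, 0], ![1, 0, 1], ![1, 1, 0], ![1, 1, 1]} := by decide
  rw [h, Finset.sum_insert (by decide), Finset.sum_insert (by decide), Finset.sum_insert (by decide),
    Finset.sum_insert (by decide), Finset.sum_insert (by decide), Finset.sum_insert (by decide),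
    Finset.sum_insert (by decide), Finset.sum_singleton]
  simp only [add_assoc]

/-- The symmetric tensor with entries `a, b, c, d` at indices with `0, 1, 2, 3` ones. -/
def symCubic (a b c d : ℂ) : Tensor 3 2 :=
  WithLp.toLp 2 fun i => ![![![a, b], ![b, c]], ![![b, c], ![c, d]]] (i 0) (i 1) (i 2)

theorem tensor_ext {S T : Tensor 3 2} (h : ∀ a b c : Fin 2, S ![a, b, c] = T ![a, b, c]) : S = T := by
  ext i
  revert i
  rw [forall_index]
  simp [h]

theorem symCubic_apply (a b c d : ℂ) (i j k : Fin 2) :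
    symCubic a b c d ![i, j, k] = ![![![a, b], ![b, c]], ![![b, c], ![c, d]]] i j k := rfl

theorem symCubic_inj {a b c d a' b' c' d' : ℂ} :
    symCubic a b c d = symCubic a' b' c' d' ↔ a = a' ∧ b = b' ∧ c = c' ∧ d = d' := by
  refine ⟨fun h => ?_, by rintro ⟨rfl, rfl, rfl, rfl⟩; rfl⟩
  have h' : ∀ i j k : Fin 2, symCubic a b c d ![i, j, k] = symCubic a' b' c' d' ![i, j, k] :=
    fun i j k => by rw [h]
  exact ⟨h' 0 0 0, h' 0 0 1, h' 0 1 1, h' 1 1 1⟩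

theorem symCubic_add (a b c d a' b' c' d' : ℂ) :
    symCubic a b c d + symCubic a' b' c' d' = symCubic (a + a') (b + b') (c + c') (d + d') := by
  refine tensor_ext fun i j k => ?_
  rw [PiLp.add_apply, symCubic_apply, symCubic_apply, symCubic_apply]
  fin_cases i <;> fin_cases j <;> fin_cases k <;> simp

theorem symCubic_smul (t a b c d : ℂ) :
    t • symCubic a b c d = symCubic (t * a) (t * b) (t * c) (t * d) := by
  refine tensor_ext fun i j k => ?_
  rw [PiLp.smul_apply, symCubic_apply, symCubic_apply]
  fin_cases i <;> fin_cases j <;> fin_cases k <;> simp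

theorem symCubic_real_smul (t : ℝ) (a b c d : ℂ) :
    t • symCubic a b c d = symCubic (t * a) (t * b) (t * c) (t * d) := by
  refine tensor_ext fun i j k => ?_
  rw [PiLp.smul_apply, symCubic_apply, symCubic_apply]
  fin_cases i <;> fin_cases j <;> fin_cases k <;> simp

theorem inner_symCubic (a b c d : ℂ) (T : Tensor 3 2) :
    inner ℂ (symCubic a b c d) T = T ![0, 0, 0] * conj a +
      (T ![0, 0, 1] + T ![0, 1, 0] + T ![1, 0, 0]) * conj b +
      (T ![0, 1, 1] + T ![1, 0, 1] + T ![1, 1, 0]) * conj c + T ![1, 1, 1] * conj d := by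
  rw [inner_tensor, sum_index]
  simp only [symCubic_apply, Matrix.cons_val_zero, Matrix.cons_val_one]
  ring

theorem symCubic_mem (a b c d : ℂ) : symCubic a b c d ∈ symTensor 3 2 := by
  intro σ i
  have key : ∀ i : Fin 3 → Fin 2, symCubic a b c d i =
      if (i 0 : ℕ) + i 1 + i 2 = 0 then a else if (i 0 : ℕ) + i 1 + i 2 = 1 then b else
        if (i 0 : ℕ) + i 1 + i 2 = 2 then c else d := by
    rw [forall_index]
    simp [symCubic_apply]
  have hs : ∀ i : Fin 3 → Fin 2, (i 0 : ℕ) + i 1 + i 2 = ∑ j, (i j : ℕ) := fun i => by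
    rw [Fin.sum_univ_three]
  rw [key, key, hs, hs]
  simp only [Function.comp_apply]
  rw [Equiv.sum_comp σ fun j => (i j : ℕ)]

theorem tensorProd_three (x : Fin 3 → EuclideanSpace ℂ (Fin 2)) (i j k : Fin 2) :
    tensorProd x ![i, j, k] = x 0 i * x 1 j * x 2 k := by
  rw [tensorProd_apply, Fin.prod_univ_three]
  rfl

theorem tensorPow_eq (u : EuclideanSpace ℂ (Fin 2)) :
    tensorPow 3 u = symCubic (u 0 ^ 3) (u 0 ^ 2 * u 1) (u 0 * u 1 ^ 2) (u 1 ^ 3) := by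
  refine tensor_ext fun i j k => ?_
  rw [tensorPow, tensorProd_three, symCubic_apply]
  fin_cases i <;> fin_cases j <;> fin_cases k <;> simp <;> first | ring1 | (left; ring1)

theorem W₃_eq : W₃ = symCubic 0 1 0 0 := by
  refine tensor_ext fun i j k => ?_
  rw [W₃, PiLp.add_apply, PiLp.add_apply, tensorProd_three, tensorProd_three, tensorProd_three,
    symCubic_apply]
  fin_cases i <;> fin_cases j <;> fin_cases k <;> simp [e₁, e₂]

theorem inner_W₃ (T : Tensor 3 2) :
    inner ℂ W₃ T = T ![0, 0, 1] + T ![0, 1, 0] + T ![1, 0, 0] := by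
  rw [W₃_eq, inner_symCubic]
  simp

theorem norm_sq_two (x : EuclideanSpace ℂ (Fin 2)) : ‖x‖ ^ 2 = ‖x 0‖ ^ 2 + ‖x 1‖ ^ 2 := by
  rw [EuclideanSpace.norm_sq_eq, Fin.sum_univ_two]

/-- The first coordinate `√(2/3)` of a maximizer. -/
noncomputable def cP : ℝ := Real.sqrt (2 / 3)

/-- The second coordinate `1/√3` of a maximizer. -/
noncomputable def cQ : ℝ := 1 / Real.sqrt 3

theorem cP_pos : 0 < cP := Real.sqrt_pos.2 (by norm_num)

theorem cQ_pos : 0 < cQ := by unfold cQ; positivity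

theorem cP_sq : cP ^ 2 = 2 / 3 := Real.sq_sqrt (by norm_num)

theorem cQ_sq : cQ ^ 2 = 1 / 3 := by
  rw [cQ, div_pow, Real.sq_sqrt (by norm_num)]; norm_num

theorem three_mul_cP_sq_mul_cQ : 3 * (cP ^ 2 * cQ) = 2 * cQ := by rw [cP_sq]; ring

/-- A sum-of-squares certificate in the combinations `a ± b`, `a' ± b'`, valid on the product of
three unit circles. Vanishing of the squares will describe the maximizers. -/
theorem spectral_identity {a a' b b' c c' : ℝ} (ha : a ^ 2 + a' ^ 2 = 1) (hb : b ^ 2 + b' ^ 2 = 1)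
    (hc : c ^ 2 + c' ^ 2 = 1) :
    8 * cQ * (2 * cQ - (a * b * c' + a * b' * c + a' * b * c)) =
      (2 * cQ * (a' + b') - c * (a + b)) ^ 2 + (c' - cQ) ^ 2 * (a + b) ^ 2 +
      (2 * cQ * (a' - b') + c * (a - b)) ^ 2 + (c' + cQ) ^ 2 * (a - b) ^ 2 := by
  have h := cQ_sq
  have h1 : a' ^ 2 = 1 - a ^ 2 := by linarith
  have h2 : b' ^ 2 = 1 - b ^ 2 := by linarith
  have h3 : c' ^ 2 = 1 - c ^ 2 := by linarith
  ring_nf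
  simp only [h, h1, h2, h3]
  ring

theorem spectral_le {a a' b b' c c' : ℝ} (ha : a ^ 2 + a' ^ 2 = 1) (hb : b ^ 2 + b' ^ 2 = 1)
    (hc : c ^ 2 + c' ^ 2 = 1) : a * b * c' + a * b' * c + a' * b * c ≤ 2 * cQ := by
  have h := spectral_identity ha hb hc
  have h1 : 0 ≤ 8 * cQ * (2 * cQ - (a * b * c' + a * b' * c + a' * b * c)) := by
    rw [h]; positivity
  have := nonneg_of_mul_nonneg_right h1 (by linarith [cQ_pos])
  linarith

/-- Equality makes all four squares vanish. Since `c' + cQ > 0`, the last gives `a = b`, the third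
then `a' = b'`, and the second `c' = cQ`. The norm equations and the first square fix the rest. -/
theorem spectral_eq {a a' b b' c c' : ℝ} (ha : a ^ 2 + a' ^ 2 = 1) (hb : b ^ 2 + b' ^ 2 = 1)
    (hc : c ^ 2 + c' ^ 2 = 1) (a0 : 0 ≤ a) (b0 : 0 ≤ b) (c0 : 0 ≤ c) (c0' : 0 ≤ c')
    (h : 2 * cQ ≤ a * b * c' + a * b' * c + a' * b * c) :
    (a = cP ∧ a' = cQ) ∧ (b = cP ∧ b' = cQ) ∧ c = cP ∧ c' = cQ := by
  have hQ := cQ_pos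
  have hQ2 := cQ_sq
  have hid := spectral_identity ha hb hc
  have hle : 8 * cQ * (2 * cQ - (a * b * c' + a * b' * c + a' * b * c)) ≤ 0 :=
    mul_nonpos_of_nonneg_of_nonpos (by linarith) (by linarith)
  have n1 := sq_nonneg (2 * cQ * (a' + b') - c * (a + b))
  have n2 : 0 ≤ (c' - cQ) ^ 2 * (a + b) ^ 2 := by positivity
  have n3 := sq_nonneg (2 * cQ * (a' - b') + c * (a - b))
  have n4 : 0 ≤ (c' + cQ) ^ 2 * (a - b) ^ 2 := by positivity
  have z1 : 2 * cQ * (a' + b') - c * (a + b) = 0 := pow_eq_zero_iff two_ne_zero |>.1 (by linarith)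
  have z2 : (c' - cQ) ^ 2 * (a + b) ^ 2 = 0 := by linarith
  have z3 : 2 * cQ * (a' - b') + c * (a - b) = 0 := pow_eq_zero_iff two_ne_zero |>.1 (by linarith)
  have z4 : (c' + cQ) ^ 2 * (a - b) ^ 2 = 0 := by linarith
  have hab : a = b := by
    have h1 : (c' + cQ) ^ 2 ≠ 0 := by positivity
    have := (mul_eq_zero.1 z4).resolve_left h1
    have := pow_eq_zero_iff two_ne_zero |>.1 this
    linarith
  subst hab
  have hab' : a' = b' := by
    have : 2 * cQ * (a' - b') = 0 := by linarith
    have := (mul_eq_zero.1 this).resolve_left (by positivity)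
    linarith
  subst hab'
  have hca : 2 * cQ * a' = c * a := by linarith
  have ha0 : a ≠ 0 := by
    rintro rfl
    have : a' = 0 := by
      have : 2 * cQ * a' = 0 := by rw [hca, mul_zero]
      exact (mul_eq_zero.1 this).resolve_left (by positivity)
    simp [this] at ha
  have hc' : c' = cQ := by
    have h1 : (a + a) ^ 2 ≠ 0 := by
      have : 0 < a := lt_of_le_of_ne a0 ha0.symm
      positivity
    have := (mul_eq_zero.1 z2).resolve_right h1
    have := pow_eq_zero_iff two_ne_zero |>.1 this
    linarith
  have sq_inj : ∀ {u v : ℝ}, 0 ≤ u → 0 ≤ v → u ^ 2 = v ^ 2 → u = v := fun hu hv h =>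
    (pow_left_inj₀ hu hv two_ne_zero).1 h
  have hcP : c = cP := sq_inj c0 cP_pos.le (by rw [cP_sq]; rw [hc', hQ2] at hc; linarith)
  have haP : a = cP := by
    refine sq_inj a0 cP_pos.le ?_
    have h4 : (2 * cQ * a') ^ 2 = (c * a) ^ 2 := by rw [hca]
    rw [mul_pow, mul_pow, mul_pow, hQ2, hcP, cP_sq] at h4
    rw [cP_sq]
    linarith
  have ha'Q : a' = cQ := by
    have : 2 * cQ * a' = 2 * cQ * cQ := by
      rw [hca, hcP, haP, ← sq, cP_sq, mul_assoc, ← sq, hQ2]; norm_num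
    exact mul_left_cancel₀ (by positivity) this
  exact ⟨⟨haP, ha'Q⟩, ⟨haP, ha'Q⟩, hcP, hc'⟩

/-- The points of the affine span of the face, in the coordinates `x, y`. -/
noncomputable def facePoint (x y : ℂ) : Tensor 3 2 :=
  symCubic (cP ^ 3 * x) (cP ^ 2 * cQ) (cP * cQ ^ 2 * conj x) (cQ ^ 3 * conj y)

theorem inner_W₃_facePoint (x y : ℂ) : inner ℂ W₃ (facePoint x y) = ((2 * cQ : ℝ) : ℂ) := by
  rw [inner_W₃, facePoint, ← three_mul_cP_sq_mul_cQ]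
  simp only [symCubic_apply, Matrix.cons_val_zero, Matrix.cons_val_one]
  push_cast
  ring

theorem norm_eq_one_sq {x : EuclideanSpace ℂ (Fin 2)} (h : ‖x‖ = 1) :
    ‖x 0‖ ^ 2 + ‖x 1‖ ^ 2 = 1 := by rw [← norm_sq_two, h, one_pow]

theorem norm_inner_W₃_le (x : Fin 3 → EuclideanSpace ℂ (Fin 2)) (hx : ∀ j, ‖x j‖ = 1) :
    ‖inner ℂ W₃ (tensorProd x)‖ ≤ 2 * cQ := by
  rw [inner_W₃, tensorProd_three, tensorProd_three, tensorProd_three]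
  refine (norm_add₃_le).trans ?_
  simp only [norm_mul]
  exact spectral_le (norm_eq_one_sq (hx 0)) (norm_eq_one_sq (hx 1)) (norm_eq_one_sq (hx 2))

theorem eq_of_norm_le_re {z : ℂ} {r : ℝ} (h1 : ‖z‖ ≤ r) (h2 : r ≤ z.re) : z = r := by
  have h3 : z.re = ‖z‖ := le_antisymm (Complex.re_le_norm z) (h1.trans h2)
  have h4 : z.re = r := le_antisymm (h3.le.trans h1) h2
  have h5 := Complex.sq_norm z
  rw [Complex.normSq_apply, ← h3] at h5
  apply Complex.ext
  · simpa using h4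
  · have : z.im * z.im = 0 := by nlinarith
    simpa using this

/-- The moduli are given by `spectral_eq`. Each of the three summands of the pairing has modulus `cP
^ 2 * cQ`, and their real parts add up to the maximum, so each equals that number. The entry at
`000` defines `w`, and the multiplicative relations among entries of a product tensor determine the
other four. -/
theorem unit_maximizer {x : Fin 3 → EuclideanSpace ℂ (Fin 2)} (hx : ∀ j, ‖x j‖ = 1)
    (h : 2 * cQ ≤ (inner ℂ W₃ (tensorProd x)).re) :
    ∃ w : ℂ, ‖w‖ = 1 ∧ tensorProd x = facePoint w (w ^ 2) := by
  have hP := cP_pos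
  have hQ := cQ_pos
  rw [inner_W₃, tensorProd_three, tensorProd_three, tensorProd_three] at h
  have hle : ∀ z : ℂ, z.re ≤ ‖z‖ := Complex.re_le_norm
  have key := spectral_eq (norm_eq_one_sq (hx 0)) (norm_eq_one_sq (hx 1)) (norm_eq_one_sq (hx 2))
    (norm_nonneg _) (norm_nonneg _) (norm_nonneg _) (norm_nonneg _) (by
      refine h.trans ((hle _).trans ((norm_add₃_le).trans (le_of_eq ?_)))
      simp only [norm_mul])
  generalize hx0 : x 0 0 = x0 at *
  generalize hx1 : x 0 1 = x1 at *
  generalize hy0 : x 1 0 = y0 at *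
  generalize hy1 : x 1 1 = y1 at *
  generalize hz0 : x 2 0 = z0 at *
  generalize hz1 : x 2 1 = z1 at *
  obtain ⟨⟨n1, n2⟩, ⟨n3, n4⟩, n5, n6⟩ := key
  rw [← three_mul_cP_sq_mul_cQ, Complex.add_re, Complex.add_re] at h
  have m1 : ‖x0 * y0 * z1‖ = cP ^ 2 * cQ := by rw [norm_mul, norm_mul, n1, n3, n6]; ring
  have m2 : ‖x0 * y1 * z0‖ = cP ^ 2 * cQ := by rw [norm_mul, norm_mul, n1, n4, n5]; ring
  have m3 : ‖x1 * y0 * z0‖ = cP ^ 2 * cQ := by rw [norm_mul, norm_mul, n2, n3, n5]; ring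
  have l1 := hle (x0 * y0 * z1)
  have l2 := hle (x0 * y1 * z0)
  have l3 := hle (x1 * y0 * z0)
  rw [m1] at l1
  rw [m2] at l2
  rw [m3] at l3
  have e1 := eq_of_norm_le_re m1.le (by linarith)
  have e2 := eq_of_norm_le_re m2.le (by linarith)
  have e3 := eq_of_norm_le_re m3.le (by linarith)
  push_cast at e1 e2 e3
  have hPc : (cP : ℂ) ≠ 0 := by exact_mod_cast hP.ne'
  set w : ℂ := x0 * y0 * z0 / (cP : ℂ) ^ 3 with hw
  have hxyz : x0 * y0 * z0 = cP ^ 3 * w := by rw [hw]; field_simp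
  have hw1 : ‖w‖ = 1 := by
    rw [hw, norm_div, norm_mul, norm_mul, n1, n3, n5, norm_pow, Complex.norm_real,
      Real.norm_of_nonneg hP.le]
    field_simp
  have hw0 : w ≠ 0 := fun h0 => by simp [h0] at hw1
  have hww : w * conj w = 1 := by rw [Complex.mul_conj, Complex.normSq_eq_norm_sq, hw1]; simp
  have hne : (cP : ℂ) ^ 3 * w ≠ 0 := mul_ne_zero (pow_ne_zero _ hPc) hw0
  -- This covers the entries with two ones: the entry at `000` times such an entry is a product of
  -- two entries with a single one.
  have two : ∀ u : ℂ, cP ^ 3 * w * u = (cP ^ 2 * cQ) * (cP ^ 2 * cQ) →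
      u = cP * cQ ^ 2 * conj w := by
    intro u hu
    refine mul_left_cancel₀ hne (hu.trans ?_)
    linear_combination (-(cP : ℂ) ^ 4 * cQ ^ 2) * hww
  refine ⟨w, hw1, tensor_ext fun i j k => ?_⟩
  have f1 : x0 * y1 * z1 = cP * cQ ^ 2 * conj w := two _ (by
    rw [← hxyz]; nth_rewrite 1 [← e1]; rw [← e2]; ring)
  have f2 : x1 * y0 * z1 = cP * cQ ^ 2 * conj w := two _ (by
    rw [← hxyz]; nth_rewrite 1 [← e1]; rw [← e3]; ring)
  have f3 : x1 * y1 * z0 = cP * cQ ^ 2 * conj w := two _ (by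
    rw [← hxyz]; nth_rewrite 1 [← e2]; rw [← e3]; ring)
  have f4 : x1 * y1 * z1 = cQ ^ 3 * conj (w ^ 2) := by
    refine mul_left_cancel₀ (pow_ne_zero 2 hne) ?_
    have : (cP ^ 3 * w) ^ 2 * (x1 * y1 * z1) = (cP ^ 2 * cQ) ^ 3 := by
      rw [← hxyz]
      calc _ = (x0 * y0 * z1) * (x0 * y1 * z0) * (x1 * y0 * z0) := by ring
        _ = _ := by rw [e1, e2, e3]; ring
    rw [this, map_pow]
    linear_combination (-(cP : ℂ) ^ 6 * cQ ^ 3 * (w * conj w + 1)) * hww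
  rw [tensorProd_three, facePoint, symCubic_apply]
  subst hx0 hx1 hy0 hy1 hz0 hz1
  fin_cases i <;> fin_cases j <;> fin_cases k
  exacts [hxyz, e1, e2, f1, e3, f2, f3, f4]

end NuclearFace

/-! ### The face as the convex hull of the curve `(w, w²)`. -/

namespace NuclearFace

open scoped ComplexConjugate

theorem wVec_zero (ζ : ℂ) : wVec ζ 0 = cP * ζ := by simp [wVec, e₁, e₂, cP]

theorem wVec_one (ζ : ℂ) : wVec ζ 1 = cQ * conj ζ ^ 2 := by simp [wVec, e₁, e₂, cQ]

theorem norm_wVec {ζ : ℂ} (h : ‖ζ‖ = 1) : ‖wVec ζ‖ = 1 := by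
  have h2 : ‖wVec ζ‖ ^ 2 = 1 ^ 2 := by
    rw [norm_sq_two, wVec_zero, wVec_one, norm_mul, norm_mul, norm_pow, Complex.norm_conj, h,
      Complex.norm_real, Complex.norm_real, Real.norm_of_nonneg cP_pos.le,
      Real.norm_of_nonneg cQ_pos.le, mul_one, one_pow, mul_one, cP_sq, cQ_sq]
    norm_num
  exact (pow_left_inj₀ (norm_nonneg _) zero_le_one two_ne_zero).1 h2

theorem mul_conj_of_norm_one {ζ : ℂ} (h : ‖ζ‖ = 1) : ζ * conj ζ = 1 := by
  rw [Complex.mul_conj, Complex.normSq_eq_norm_sq, h]; simp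

/-- Any unimodular `w` is a cube `ζ ^ 3`, so every point of the curve is a symmetric product of unit
vectors. -/
theorem tensorPow_wVec {ζ : ℂ} (h : ‖ζ‖ = 1) :
    tensorPow 3 (wVec ζ) = facePoint (ζ ^ 3) ((ζ ^ 3) ^ 2) := by
  have hc := mul_conj_of_norm_one h
  rw [tensorPow_eq, facePoint, symCubic_inj, wVec_zero, wVec_one]
  simp only [map_pow]
  refine ⟨by ring, ?_, ?_, by ring⟩
  · linear_combination (cP : ℂ) ^ 2 * cQ * (ζ * conj ζ + 1) * hc
  · linear_combination (cP : ℂ) * cQ ^ 2 * conj ζ ^ 3 * hc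

theorem spectralNorm_W₃ : tensorSpectralNorm W₃ = 2 * cQ := by
  refine le_antisymm (spectralNorm_le (by linarith [cQ_pos]) norm_inner_W₃_le) ?_
  have h := norm_inner_le_spectral W₃ (x := fun _ => wVec 1) fun _ => norm_wVec (by simp)
  have h2 := tensorPow_wVec (ζ := 1) (by simp)
  rw [tensorPow] at h2
  rw [h2, inner_W₃_facePoint, Complex.norm_real, Real.norm_of_nonneg (by linarith [cQ_pos])] at h
  exact h

/-- The coordinates of the points of the face: the convex hull of the curve `(w, w²)`, `|w| = 1`. -/
def faceRegion : Set (ℂ × ℂ) := {p | ‖p.1‖ ≤ 1 ∧ ‖p.2 - p.1 ^ 2‖ ≤ 1 - ‖p.1‖ ^ 2}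

theorem norm_sq_convex_comb {a b : ℝ} (hab : a + b = 1) (x x' : ℂ) :
    ‖(a : ℂ) * x + b * x'‖ ^ 2 = a * ‖x‖ ^ 2 + b * ‖x'‖ ^ 2 - a * b * ‖x - x'‖ ^ 2 := by
  have : b = 1 - a := by linarith
  subst this
  simp only [Complex.sq_norm, Complex.normSq_apply, Complex.add_re, Complex.add_im, Complex.mul_re,
    Complex.mul_im, Complex.sub_re, Complex.sub_im, Complex.ofReal_re, Complex.ofReal_im]
  ring

/-- Under a convex combination `y - x ^ 2` acquires the extra term `a * b * (x - x') ^ 2`, while `1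
- ‖x‖ ^ 2` gains exactly its modulus. -/
theorem convex_faceRegion : Convex ℝ faceRegion := by
  rintro ⟨x, y⟩ ⟨h1, h2⟩ ⟨x', y'⟩ ⟨h1', h2'⟩ a b ha hb hab
  simp only at h1 h2 h1' h2'
  simp only [faceRegion, Prod.smul_mk, Prod.mk_add_mk, Complex.real_smul, Set.mem_ofPred_eq]
  refine ⟨?_, ?_⟩
  · refine (norm_add_le _ _).trans ?_
    rw [norm_mul, norm_mul, Complex.norm_real, Complex.norm_real, Real.norm_of_nonneg ha,
      Real.norm_of_nonneg hb]
    nlinarith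
  · rw [norm_sq_convex_comb hab]
    have habc : (a : ℂ) + b = 1 := by exact_mod_cast hab
    have e : (a : ℂ) * y + b * y' - (a * x + b * x') ^ 2 =
        a * (y - x ^ 2) + b * (y' - x' ^ 2) + (a * b) * (x - x') ^ 2 := by
      linear_combination (-(a : ℂ) * x ^ 2 - b * x' ^ 2) * habc
    rw [e]
    refine (norm_add₃_le).trans ?_
    rw [norm_mul, norm_mul, norm_mul, norm_mul, Complex.norm_real, Complex.norm_real,
      Real.norm_of_nonneg ha, Real.norm_of_nonneg hb, norm_pow]
    nlinarith [mul_le_mul_of_nonneg_left h2 ha, mul_le_mul_of_nonneg_left h2' hb]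

theorem facePoint_comb {a b : ℝ} (hab : a + b = 1) (x y x' y' : ℂ) :
    a • facePoint x y + b • facePoint x' y' = facePoint (a * x + b * x') (a * y + b * y') := by
  have habc : (a : ℂ) + b = 1 := by exact_mod_cast hab
  simp only [facePoint, symCubic_real_smul, symCubic_add, symCubic_inj, map_add, map_mul,
    Complex.conj_ofReal]
  refine ⟨by ring, ?_, by ring, by ring⟩
  linear_combination ((cP : ℂ) ^ 2 * cQ) * habc

theorem atom_mem_faceRegion {w : ℂ} (h : ‖w‖ = 1) : (w, w ^ 2) ∈ faceRegion := by
  simp [faceRegion, h]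

/-- The set `C` of tensors that respect the bound, and have face coordinates in the region if they
attain it, is convex: a proper combination attains the bound only if both ends do. It contains the
unit products by `unit_maximizer`. -/
theorem exists_facePoint_of_mem_convexHull {S : Tensor 3 2}
    (hS : S ∈ convexHull ℝ (unitProducts 3 2)) (h : 2 * cQ ≤ (inner ℂ W₃ S).re) :
    ∃ x y, (x, y) ∈ faceRegion ∧ S = facePoint x y := by
  set C : Set (Tensor 3 2) := {S | (inner ℂ W₃ S).re ≤ 2 * cQ ∧
    (2 * cQ ≤ (inner ℂ W₃ S).re → ∃ x y, (x, y) ∈ faceRegion ∧ S = facePoint x y)} with hC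
  have hconv : Convex ℝ C := by
    rintro S ⟨h1, h2⟩ T ⟨h1', h2'⟩ a b ha hb hab
    have e : (inner ℂ W₃ (a • S + b • T)).re = a * (inner ℂ W₃ S).re + b * (inner ℂ W₃ T).re := by
      let l : Tensor 3 2 →L[ℝ] ℝ := Complex.reCLM.comp ((innerSL ℂ W₃).restrictScalars ℝ)
      change l (a • S + b • T) = a * l S + b * l T
      rw [map_add, map_smul, map_smul, smul_eq_mul, smul_eq_mul]
    have hab2 : a * (2 * cQ) + b * (2 * cQ) = 2 * cQ := by rw [← add_mul, hab, one_mul]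
    have i1 := mul_le_mul_of_nonneg_left h1 ha
    have i2 := mul_le_mul_of_nonneg_left h1' hb
    refine ⟨?_, fun hle => ?_⟩
    · rw [e]; linarith
    · rw [e] at hle
      rcases ha.eq_or_lt with rfl | ha'
      · have : b = 1 := by linarith
        subst this
        simpa using h2' (by simpa using hle)
      rcases hb.eq_or_lt with rfl | hb'
      · have : a = 1 := by linarith
        subst this
        simpa using h2 (by simpa using hle)
      have g1 : 2 * cQ ≤ (inner ℂ W₃ S).re := by
        by_contra hn
        push Not at hn
        linarith [mul_lt_mul_of_pos_left hn ha']
      have g2 : 2 * cQ ≤ (inner ℂ W₃ T).re := by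
        by_contra hn
        push Not at hn
        linarith [mul_lt_mul_of_pos_left hn hb']
      obtain ⟨x, y, hxy, rfl⟩ := h2 g1
      obtain ⟨x', y', hxy', rfl⟩ := h2' g2
      refine ⟨_, _, ?_, facePoint_comb hab x y x' y'⟩
      simpa using convex_faceRegion hxy hxy' ha hb hab
  have hsub : unitProducts 3 2 ⊆ C := by
    rintro _ ⟨x, hx, rfl⟩
    refine ⟨(Complex.re_le_norm _).trans (norm_inner_W₃_le x hx), fun hle => ?_⟩
    obtain ⟨w, hw, e⟩ := unit_maximizer hx hle
    exact ⟨w, w ^ 2, atom_mem_faceRegion hw, e⟩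
  exact (convexHull_min hsub hconv hS).2 h

/-- A chord of the unit circle through `x` in direction `g`. -/
theorem exists_two_atoms {x γ : ℂ} (hx : ‖x‖ < 1) (hγ : ‖γ‖ = 1) :
    ∃ (t : ℝ) (w₁ w₂ : ℂ), 0 ≤ t ∧ t ≤ 1 ∧ ‖w₁‖ = 1 ∧ ‖w₂‖ = 1 ∧
      x = t * w₁ + (1 - t) * w₂ ∧
      x ^ 2 + (1 - ‖x‖ ^ 2 : ℝ) * γ = t * w₁ ^ 2 + (1 - t) * w₂ ^ 2 := by
  obtain ⟨g, hg⟩ := IsAlgClosed.exists_pow_nat_eq γ two_pos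
  have hgn : ‖g‖ = 1 := by
    have : ‖g‖ ^ 2 = 1 ^ 2 := by rw [← norm_pow, hg, hγ, one_pow]
    exact (pow_left_inj₀ (norm_nonneg _) zero_le_one two_ne_zero).1 this
  set m : ℝ := x.re * g.re + x.im * g.im with hm
  set D : ℝ := 1 - ‖x‖ ^ 2 with hD
  have hD0 : 0 < D := by
    have := norm_nonneg x
    nlinarith
  have hpos : 0 < m ^ 2 + D := by positivity
  set r : ℝ := Real.sqrt (m ^ 2 + D) with hr
  have hr0 : 0 < r := Real.sqrt_pos.2 hpos
  have hr2 : r ^ 2 = m ^ 2 + D := Real.sq_sqrt hpos.le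
  have hmr : |m| ≤ r := Real.abs_le_sqrt (by linarith)
  have hcirc : ∀ s : ℝ, s ^ 2 + 2 * m * s = D → ‖x + s * g‖ = 1 := by
    intro s hs
    have : ‖x + s * g‖ ^ 2 = 1 ^ 2 := by
      have e : ‖x + s * g‖ ^ 2 = ‖x‖ ^ 2 + 2 * m * s + s ^ 2 * ‖g‖ ^ 2 := by
        simp only [Complex.sq_norm, Complex.normSq_apply, Complex.add_re, Complex.add_im,
          Complex.mul_re, Complex.mul_im, Complex.ofReal_re, Complex.ofReal_im, hm]
        ring
      rw [e, hgn]
      linarith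
    exact (pow_left_inj₀ (norm_nonneg _) zero_le_one two_ne_zero).1 this
  have hrc : (r : ℂ) ≠ 0 := by exact_mod_cast hr0.ne'
  have hr2c : (r : ℂ) ^ 2 = m ^ 2 + D := by exact_mod_cast hr2
  -- The line `x + s * g` meets the circle at the roots `s = -m ± r` of `s ^ 2 + 2 * m * s = D`. The
  -- weights make the mean of `s` zero; the mean of `s ^ 2` is then minus the product of the roots,
  -- that is `D`.
  refine ⟨(r + m) / (2 * r), x + ((-m + r : ℝ) : ℂ) * g, x + ((-m - r : ℝ) : ℂ) * g,
    ?_, ?_, hcirc _ (by linear_combination hr2), hcirc _ (by linear_combination hr2), ?_, ?_⟩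
  · exact div_nonneg (by linarith [neg_abs_le m]) (by linarith)
  · rw [div_le_one (by linarith)]
    linarith [le_abs_self m]
  · push_cast
    field_simp
    ring
  · rw [← hg]
    push_cast
    field_simp
    linear_combination (-2 * r * g ^ 2) * hr2c

theorem exists_unimodular_midpoint {γ : ℂ} (hγ : ‖γ‖ ≤ 1) :
    ∃ γ₁ γ₂ : ℂ, ‖γ₁‖ = 1 ∧ ‖γ₂‖ = 1 ∧ γ = (γ₁ + γ₂) / 2 := by
  obtain ⟨e, he, hγe⟩ : ∃ e : ℂ, ‖e‖ = 1 ∧ γ = ‖γ‖ * e := by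
    by_cases h0 : γ = 0
    · exact ⟨1, by simp, by simp [h0]⟩
    · have hn : (‖γ‖ : ℂ) ≠ 0 := by simpa using h0
      refine ⟨γ / ‖γ‖, ?_, by field_simp⟩
      rw [norm_div, Complex.norm_real, norm_norm, div_self (by simpa using h0)]
  set ρ := ‖γ‖ with hρ
  have hρ0 : 0 ≤ ρ := norm_nonneg γ
  have hs : Real.sqrt (1 - ρ ^ 2) ^ 2 = 1 - ρ ^ 2 := Real.sq_sqrt (by nlinarith)
  set s := Real.sqrt (1 - ρ ^ 2)
  have hn : ∀ σ : ℝ, σ ^ 2 = 1 - ρ ^ 2 → ‖(⟨ρ, σ⟩ : ℂ) * e‖ = 1 := by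
    intro σ hσ
    rw [norm_mul, he, mul_one]
    have : ‖(⟨ρ, σ⟩ : ℂ)‖ ^ 2 = 1 ^ 2 := by
      rw [Complex.sq_norm, Complex.normSq_mk]; linarith
    exact (pow_left_inj₀ (norm_nonneg _) zero_le_one two_ne_zero).1 this
  refine ⟨⟨ρ, s⟩ * e, ⟨ρ, -s⟩ * e, hn s hs, hn (-s) (by linarith [neg_sq s]), ?_⟩
  have : (⟨ρ, s⟩ : ℂ) + ⟨ρ, -s⟩ = 2 * ρ := by
    apply Complex.ext <;> simp [two_mul]
  rw [← add_mul, this, hγe]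
  ring

/-- For `‖x‖ < 1` the quotient `(y - x ^ 2) / (1 - ‖x‖ ^ 2)` lies in the unit disc, hence is the
midpoint of two unimodular numbers. Each of these gives a chord through `x` with two atoms. For `‖x‖
= 1` the region forces `y = x ^ 2`. -/
theorem exists_four_atoms {x y : ℂ} (h : (x, y) ∈ faceRegion) :
    ∃ (t : Fin 4 → ℝ) (w : Fin 4 → ℂ), (∀ i, 0 ≤ t i) ∧ ∑ i, t i = 1 ∧ (∀ i, ‖w i‖ = 1) ∧
      x = ∑ i, t i * w i ∧ y = ∑ i, t i * w i ^ 2 := by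
  obtain ⟨h1, h2⟩ := h
  simp only at h1 h2
  rcases h1.eq_or_lt with h1 | h1
  · refine ⟨fun _ => 1 / 4, fun _ => x, fun _ => by norm_num, by simp, fun _ => h1, ?_, ?_⟩
    · simp
    · rw [h1] at h2
      have : y - x ^ 2 = 0 := by simpa using h2
      rw [sub_eq_zero.1 this]
      simp
  · have hD0 : 0 < 1 - ‖x‖ ^ 2 := by
      have := norm_nonneg x
      nlinarith
    have hDc : ((1 - ‖x‖ ^ 2 : ℝ) : ℂ) ≠ 0 := by exact_mod_cast hD0.ne'
    obtain ⟨γ₁, γ₂, n1, n2, hγ⟩ := exists_unimodular_midpoint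
      (γ := (y - x ^ 2) / (1 - ‖x‖ ^ 2 : ℝ)) (by
        rw [norm_div, Complex.norm_real, Real.norm_of_nonneg hD0.le, div_le_one hD0]
        exact h2)
    obtain ⟨t, w₁, w₂, ht0, ht1, hw1, hw2, e1, e2⟩ := exists_two_atoms h1 n1
    obtain ⟨s, w₃, w₄, hs0, hs1, hw3, hw4, e3, e4⟩ := exists_two_atoms h1 n2
    refine ⟨![t / 2, (1 - t) / 2, s / 2, (1 - s) / 2], ![w₁, w₂, w₃, w₄], ?_, ?_, ?_, ?_, ?_⟩
    · intro i
      fin_cases i <;> simp <;> linarith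
    · simp [Fin.sum_univ_four]; ring
    · intro i
      fin_cases i <;> simp [hw1, hw2, hw3, hw4]
    · simp [Fin.sum_univ_four]
      linear_combination e1 / 2 + e3 / 2
    · rw [div_eq_iff hDc] at hγ
      simp [Fin.sum_univ_four]
      linear_combination hγ + e2 / 2 + e4 / 2

theorem tensorProd_smul_head (c : ℂ) (u : EuclideanSpace ℂ (Fin 2)) :
    tensorProd ![c • u, u, u] = c • tensorPow 3 u := by
  refine tensor_ext fun i j k => ?_
  rw [PiLp.smul_apply, tensorPow, tensorProd_three, tensorProd_three]
  simp [mul_assoc]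

theorem norm_prod_smul_head {c : ℝ} (hc : 0 ≤ c) {u : EuclideanSpace ℂ (Fin 2)} (hu : ‖u‖ = 1) :
    ∏ j, ‖(![(c : ℂ) • u, u, u] : Fin 3 → _) j‖ = c := by
  simp [Fin.prod_univ_three, norm_smul, hu, abs_of_nonneg hc]

/-- Every atom pairs with `W₃` to the full spectral norm `2 * cQ`, so `W₃` certifies any nonnegative
combination. -/
theorem isNuclearDecomposition_of_atoms {r : ℕ} {S : Tensor 3 2} {t : Fin r → ℝ} {ζ : Fin r → ℂ}
    (ht : ∀ i, 0 ≤ t i) (hζ : ∀ i, ‖ζ i‖ = 1)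
    (hS : S = ∑ i, (t i : ℂ) • tensorPow 3 (wVec (ζ i))) :
    IsNuclearDecomposition S fun i => ![(t i : ℂ) • wVec (ζ i), wVec (ζ i), wVec (ζ i)] := by
  refine isNuclearDecomposition_of_le (s := 2 * cQ) (by linarith [cQ_pos]) spectralNorm_W₃.le ?_ ?_
  · simp only [tensorProd_smul_head, hS]
  · simp only [fun i => norm_prod_smul_head (ht i) (norm_wVec (hζ i))]
    rw [hS, inner_sum, Complex.re_sum, Finset.mul_sum]
    refine Finset.sum_le_sum fun i _ => ?_
    rw [inner_smul_right, tensorPow_wVec (hζ i), inner_W₃_facePoint, ← Complex.ofReal_mul,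
      Complex.ofReal_re, mul_comm]

theorem sum_smul_facePoint {r : ℕ} {t : Fin r → ℝ} (ht : ∑ i, t i = 1) (x y : Fin r → ℂ) :
    ∑ i, (t i : ℂ) • facePoint (x i) (y i) = facePoint (∑ i, t i * x i) (∑ i, t i * y i) := by
  have htc : ∑ i, (t i : ℂ) = 1 := by exact_mod_cast ht
  have hs : ∀ (s : Finset (Fin r)) (a b c d : Fin r → ℂ), ∑ i ∈ s, symCubic (a i) (b i) (c i) (d i) =
      symCubic (∑ i ∈ s, a i) (∑ i ∈ s, b i) (∑ i ∈ s, c i) (∑ i ∈ s, d i) := by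
    intro s a b c d
    classical
    induction s using Finset.induction_on with
    | empty =>
      refine tensor_ext fun i j k => ?_
      rw [symCubic_apply]
      fin_cases i <;> fin_cases j <;> fin_cases k <;> simp
    | insert j s hj ih =>
      simp only [Finset.sum_insert hj, ih, symCubic_add]
  simp only [facePoint, symCubic_smul, hs, symCubic_inj, map_sum, map_mul, Complex.conj_ofReal,
    Finset.mul_sum]
  refine ⟨Finset.sum_congr rfl fun i _ => by ring, ?_, Finset.sum_congr rfl fun i _ => by ring,
    Finset.sum_congr rfl fun i _ => by ring⟩
  rw [← Finset.sum_mul, htc, one_mul]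

theorem exists_decomposition_facePoint {x y : ℂ} (h : (x, y) ∈ faceRegion) :
    ∃ (t : Fin 4 → ℝ) (ζ : Fin 4 → ℂ), (∀ i, 0 ≤ t i) ∧ ∑ i, t i = 1 ∧ (∀ i, ‖ζ i‖ = 1) ∧
      facePoint x y = ∑ i, (t i : ℂ) • tensorPow 3 (wVec (ζ i)) := by
  obtain ⟨t, w, ht, hsum, hw, rfl, rfl⟩ := exists_four_atoms h
  choose ζ hζ using fun i => IsAlgClosed.exists_pow_nat_eq (w i) three_pos
  have hζ1 : ∀ i, ‖ζ i‖ = 1 := by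
    intro i
    have : ‖ζ i‖ ^ 3 = 1 ^ 3 := by rw [← norm_pow, hζ, hw, one_pow]
    exact (pow_left_inj₀ (norm_nonneg _) zero_le_one three_ne_zero).1 this
  refine ⟨t, ζ, ht, hsum, hζ1, ?_⟩
  simp only [fun i => tensorPow_wVec (hζ1 i), hζ]
  rw [sum_smul_facePoint hsum]

theorem face_W₃_eq : face W₃ = {S | ∃ x y, (x, y) ∈ faceRegion ∧ S = facePoint x y} := by
  ext S
  constructor
  · rintro ⟨⟨_, h1⟩, h2⟩
    rw [spectralNorm_W₃] at h2
    exact exists_facePoint_of_mem_convexHull (mem_convexHull_of_nuclearNorm_le_one h1) h2.ge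
  · rintro ⟨x, y, h, rfl⟩
    obtain ⟨t, ζ, ht, hsum, hζ, e⟩ := exists_decomposition_facePoint h
    refine ⟨⟨symCubic_mem _ _ _ _, ?_⟩, ?_⟩
    · rw [(isNuclearDecomposition_of_atoms ht hζ e).2]
      simp only [fun i => norm_prod_smul_head (ht i) (norm_wVec (hζ i)), hsum, le_refl]
    · rw [spectralNorm_W₃, inner_W₃_facePoint, Complex.ofReal_re]

theorem facePoint_mem_face {x y : ℂ} (h : (x, y) ∈ faceRegion) : facePoint x y ∈ face W₃ := by
  rw [face_W₃_eq]
  exact ⟨x, y, h, rfl⟩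

theorem zero_mem_faceRegion : ((0 : ℂ), (0 : ℂ)) ∈ faceRegion := by simp [faceRegion]

theorem nuclearRank_le_four_of_mem_face {S : Tensor 3 2} (hS : S ∈ face W₃) :
    nuclearRank S ≤ 4 := by
  rw [face_W₃_eq] at hS
  obtain ⟨x, y, h, rfl⟩ := hS
  obtain ⟨t, ζ, ht, -, hζ, e⟩ := exists_decomposition_facePoint h
  exact nuclearRank_le (isNuclearDecomposition_of_atoms ht hζ e)

/-! ### Exposedness and real dimension of the face. -/

theorem isExposed_face_W₃ : IsExposed ℝ (symNuclearBall 3 2) (face W₃) := by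
  intro _
  refine ⟨Complex.reCLM.comp ((innerSL ℂ W₃).restrictScalars ℝ), ?_⟩
  have hb : ∀ S ∈ symNuclearBall 3 2, (inner ℂ W₃ S).re ≤ 2 * cQ := fun S hS =>
    (re_inner_le_mul_nuclear (by linarith [cQ_pos]) spectralNorm_W₃.le S).trans
      (mul_le_of_le_one_right (by linarith [cQ_pos]) hS.2)
  have h0 := facePoint_mem_face zero_mem_faceRegion
  ext S
  simp only [face, Set.mem_ofPred_eq, spectralNorm_W₃]
  refine and_congr_right fun hS => ⟨fun h T hT => ?_, fun h => le_antisymm (hb S hS) ?_⟩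
  · exact (hb T hT).trans h.ge
  · have := h _ h0.1
    have h1 := h0.2
    rw [spectralNorm_W₃] at h1
    rw [← h1]
    exact this

/-- The linear part of the parametrization of the affine span of the face. -/
noncomputable def faceDir : ℂ × ℂ →ₗ[ℝ] Tensor 3 2 where
  toFun p := symCubic (cP ^ 3 * p.1) 0 (cP * cQ ^ 2 * conj p.1) (cQ ^ 3 * conj p.2)
  map_add' p q := by
    rw [symCubic_add, symCubic_inj]
    simp [mul_add]
  map_smul' a p := by
    rw [RingHom.id_apply, symCubic_real_smul, symCubic_inj]
    simp only [Prod.smul_fst, Prod.smul_snd, Complex.real_smul, map_mul, Complex.conj_ofReal,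
      mul_zero, true_and]
    exact ⟨by ring, by ring, by ring⟩

theorem facePoint_eq_add (x y : ℂ) : facePoint x y = facePoint 0 0 + faceDir (x, y) := by
  simp [facePoint, faceDir, symCubic_add]

theorem faceDir_injective : Function.Injective faceDir := by
  have hP : (cP : ℂ) ≠ 0 := by exact_mod_cast cP_pos.ne'
  have hQ : (cQ : ℂ) ≠ 0 := by exact_mod_cast cQ_pos.ne'
  rintro ⟨x, y⟩ ⟨x', y'⟩ h
  change symCubic _ _ _ _ = symCubic _ _ _ _ at h
  rw [symCubic_inj] at h
  obtain ⟨h1, -, -, h2⟩ := h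
  have := mul_left_cancel₀ (pow_ne_zero 3 hP) h1
  have := (starRingEnd ℂ).injective (mul_left_cancel₀ (pow_ne_zero 3 hQ) h2)
  simp_all

theorem vectorSpan_face_W₃ : vectorSpan ℝ (face W₃) = LinearMap.range faceDir := by
  apply le_antisymm
  · rw [vectorSpan_def, Submodule.span_le]
    rintro _ ⟨S, hS, T, hT, rfl⟩
    rw [face_W₃_eq] at hS hT
    obtain ⟨x, y, -, rfl⟩ := hS
    obtain ⟨x', y', -, rfl⟩ := hT
    refine ⟨(x, y) - (x', y'), ?_⟩
    rw [map_sub, facePoint_eq_add x y, facePoint_eq_add x' y']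
    simp
  · rintro _ ⟨⟨x, y⟩, rfl⟩
    have small : ∀ x y, (x, y) ∈ faceRegion → faceDir (x, y) ∈ vectorSpan ℝ (face W₃) := by
      intro x y h
      have := vsub_mem_vectorSpan ℝ (facePoint_mem_face h) (facePoint_mem_face zero_mem_faceRegion)
      rwa [facePoint_eq_add x y, vsub_eq_sub, add_sub_cancel_left] at this
    have hx : faceDir (x, 0) ∈ vectorSpan ℝ (face W₃) := by
      -- Scaling `x` into the disc of radius `1/2` gives `‖x‖ ^ 2 ≤ 1 - ‖x‖ ^ 2`, so the scaled `(x,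
      -- 0)` lies in the region.
      set r : ℝ := 2 * (‖x‖ + 1) with hr
      have hr0 : 0 < r := by positivity
      have hn : ‖((r⁻¹ : ℝ) : ℂ) * x‖ ≤ 1 / 2 := by
        rw [norm_mul, Complex.norm_real, norm_inv, Real.norm_of_nonneg hr0.le,
          inv_mul_le_iff₀ hr0, hr]
        linarith
      have h := small (((r⁻¹ : ℝ) : ℂ) * x) 0 (by
        have h0 := norm_nonneg (((r⁻¹ : ℝ) : ℂ) * x)
        refine ⟨by simp only; linarith, ?_⟩
        simp only
        rw [zero_sub, norm_neg, norm_pow]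
        nlinarith)
      have := Submodule.smul_mem _ r h
      rw [← map_smul] at this
      convert this using 2
      have : (r : ℂ) ≠ 0 := by exact_mod_cast hr0.ne'
      simp [this]
    have hy : faceDir (0, y) ∈ vectorSpan ℝ (face W₃) := by
      set r : ℝ := ‖y‖ + 1 with hr
      have hr0 : 0 < r := by positivity
      have h := small 0 (((r⁻¹ : ℝ) : ℂ) * y) (by
        refine ⟨by simp, ?_⟩
        simp only
        rw [norm_zero, zero_pow two_ne_zero, sub_zero, zero_pow two_ne_zero, sub_zero, norm_mul,
          Complex.norm_real, norm_inv, Real.norm_of_nonneg hr0.le, inv_mul_le_iff₀ hr0, hr]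
        linarith)
      have := Submodule.smul_mem _ r h
      rw [← map_smul] at this
      convert this using 2
      have : (r : ℂ) ≠ 0 := by exact_mod_cast hr0.ne'
      simp [this]
    have := add_mem hx hy
    rwa [← map_add, Prod.mk_add_mk, add_zero, zero_add] at this

theorem finrank_vectorSpan_face_W₃ : Module.finrank ℝ (vectorSpan ℝ (face W₃)) = 4 := by
  rw [vectorSpan_face_W₃, LinearMap.finrank_range_of_inj faceDir_injective, Module.finrank_prod,
    Complex.finrank_real_complex]

end NuclearFace

/-! ### The decomposition and the rank of `W₃`. -/

namespace NuclearFace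

open scoped ComplexConjugate

/-- The cubes of `1`, `ζ`, `conj ζ` are the three cube roots of unity `1`, `ω`, `ω ^ 2`, so both
face coordinates average to zero and only the `W₃` component remains. The factor `√3 / 2` inverts `3
* (cP ^ 2 * cQ) = 2 / √3`. -/
theorem W₃_decomposition {ζ c : ℂ} (hζ : ζ = Complex.exp (2 * Real.pi * Complex.I / 9))
    (hc : c = ((Real.sqrt 3 / 2 : ℝ) : ℂ)) :
    W₃ = c • (tensorPow 3 (wVec 1) + tensorPow 3 (wVec ζ) + tensorPow 3 (wVec (conj ζ))) ∧
      IsNuclearDecomposition W₃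
        ![![c • wVec 1, wVec 1, wVec 1], ![c • wVec ζ, wVec ζ, wVec ζ],
          ![c • wVec (conj ζ), wVec (conj ζ), wVec (conj ζ)]] := by
  have hn : ‖ζ‖ = 1 := by
    rw [hζ, show 2 * (Real.pi : ℂ) * Complex.I / 9 = ((2 * Real.pi / 9 : ℝ) : ℂ) * Complex.I by
      push_cast; ring, Complex.norm_exp_ofReal_mul_I]
  have hn' : ‖conj ζ‖ = 1 := by rwa [Complex.norm_conj]
  set ω := ζ ^ 3 with hω
  have hprim : IsPrimitiveRoot ω 3 := by
    have h9 := Complex.isPrimitiveRoot_exp 9 (by norm_num)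
    have : ω = Complex.exp (2 * Real.pi * Complex.I / (9 : ℕ)) ^ 3 := by
      rw [hω, hζ]; norm_cast
    rw [this]
    exact h9.pow (by norm_num) (by norm_num)
  have hsum : 1 + ω + ω ^ 2 = 0 := by
    have := hprim.geom_sum_eq_zero (by norm_num)
    simpa [Finset.sum_range_succ] using this
  have h3 : ω ^ 3 = 1 := hprim.pow_eq_one
  have hωn : ‖ω‖ = 1 := by rw [hω, norm_pow, hn, one_pow]
  have hconj : conj ω = ω ^ 2 := by
    have := mul_conj_of_norm_one hωn
    linear_combination ω ^ 2 * this - conj ω * h3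
  have h3' : conj ζ ^ 3 = ω ^ 2 := by rw [← map_pow, ← hω, hconj]
  have hcq : c * (3 * ((cP : ℂ) ^ 2 * cQ)) = 1 := by
    rw [hc]
    have : Real.sqrt 3 / 2 * (3 * (cP ^ 2 * cQ)) = 1 := by
      rw [three_mul_cP_sq_mul_cQ, cQ]
      field_simp
    exact_mod_cast this
  have hW : W₃ = c • (tensorPow 3 (wVec 1) + tensorPow 3 (wVec ζ) + tensorPow 3 (wVec (conj ζ))) := by
    rw [tensorPow_wVec norm_one, tensorPow_wVec hn, tensorPow_wVec hn', h3', ← hω, W₃_eq]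
    simp only [facePoint, symCubic_add, symCubic_smul, symCubic_inj, map_pow, hconj, one_pow, map_one]
    refine ⟨?_, ?_, ?_, ?_⟩
    · linear_combination (-c * cP ^ 3) * hsum
    · linear_combination -hcq
    · linear_combination (-c * cP * cQ ^ 2) * hsum - c * cP * cQ ^ 2 * ω * h3
    · linear_combination (-c * cQ ^ 3) * hsum -
        (c * cQ ^ 3) * (ω + ω ^ 2 * (ω ^ 3 + 1)) * h3
  refine ⟨hW, ?_⟩
  have := isNuclearDecomposition_of_atoms (r := 3) (S := W₃) (t := fun _ => Real.sqrt 3 / 2)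
    (ζ := ![1, ζ, conj ζ]) (fun _ => by positivity)
    (fun i => by fin_cases i <;> simp [hn]) (by
      rw [hW, Fin.sum_univ_three, hc]
      simp [smul_add])
  convert this using 1
  ext1 i
  fin_cases i <;> simp [hc]

/-- The determinant of the pencil `s * T_{ij0} + t * T_{ij1}` of slices is `D * (c0 * s + c1 * t) *
(r0 * s + r1 * t)` for a sum of two products and `-s ^ 2` for `W₃`. Comparing coefficients gives `c1
= r1 = 0`, which contradicts the entry `1` at `001`. -/
theorem W₃_ne_two_products (x y : Fin 3 → EuclideanSpace ℂ (Fin 2)) :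
    W₃ ≠ tensorProd x + tensorProd y := by
  intro h
  have hE : ∀ i j k : Fin 2, symCubic 0 1 0 0 ![i, j, k] =
      x 0 i * x 1 j * x 2 k + y 0 i * y 1 j * y 2 k := by
    intro i j k
    rw [← W₃_eq, h, PiLp.add_apply, tensorProd_three, tensorProd_three]
  have h000 := hE 0 0 0
  have h001 := hE 0 0 1
  have h010 := hE 0 1 0
  have h011 := hE 0 1 1
  have h100 := hE 1 0 0
  have h101 := hE 1 0 1
  have h110 := hE 1 1 0
  have h111 := hE 1 1 1
  simp only [symCubic_apply, Matrix.cons_val_zero, Matrix.cons_val_one] at h000 h001 h010 h011 h100 h101 h110 h111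
  clear hE h
  generalize x 0 0 = a0, x 0 1 = a1, x 1 0 = b0, x 1 1 = b1, x 2 0 = c0, x 2 1 = c1 at *
  generalize y 0 0 = p0, y 0 1 = p1, y 1 0 = q0, y 1 1 = q1, y 2 0 = r0, y 2 1 = r1 at *
  set D := (a0 * p1 - a1 * p0) * (b0 * q1 - b1 * q0) with hD
  have e1 : D * (c0 * r0) = -1 := by
    have : D * (c0 * r0) = (a0 * b0 * c0 + p0 * q0 * r0) * (a1 * b1 * c0 + p1 * q1 * r0) -
      (a0 * b1 * c0 + p0 * q1 * r0) * (a1 * b0 * c0 + p1 * q0 * r0) := by rw [hD]; ring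
    rw [this, ← h000, ← h110, ← h010, ← h100]; ring
  have e2 : D * (c1 * r1) = 0 := by
    have : D * (c1 * r1) = (a0 * b0 * c1 + p0 * q0 * r1) * (a1 * b1 * c1 + p1 * q1 * r1) -
      (a0 * b1 * c1 + p0 * q1 * r1) * (a1 * b0 * c1 + p1 * q0 * r1) := by rw [hD]; ring
    rw [this, ← h001, ← h111, ← h011, ← h101]; ring
  have e3 : D * (c0 * r1 + c1 * r0) = 0 := by
    have : D * (c0 * r1 + c1 * r0) =
      (a0 * b0 * c0 + p0 * q0 * r0) * (a1 * b1 * c1 + p1 * q1 * r1) +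
      (a0 * b0 * c1 + p0 * q0 * r1) * (a1 * b1 * c0 + p1 * q1 * r0) -
      (a0 * b1 * c0 + p0 * q1 * r0) * (a1 * b0 * c1 + p1 * q0 * r1) -
      (a0 * b1 * c1 + p0 * q1 * r1) * (a1 * b0 * c0 + p1 * q0 * r0) := by rw [hD]; ring
    rw [this, ← h000, ← h001, ← h110, ← h111, ← h010, ← h100, ← h011, ← h101]; ring
  have hD0 : D ≠ 0 := fun h0 => by simp [h0] at e1
  have hc0 : c0 ≠ 0 := fun h0 => by simp [h0] at e1
  have hr0 : r0 ≠ 0 := fun h0 => by simp [h0] at e1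
  have e2' := (mul_eq_zero.1 e2).resolve_left hD0
  have e3' := (mul_eq_zero.1 e3).resolve_left hD0
  have hz : c1 = 0 ∧ r1 = 0 := by
    rcases mul_eq_zero.1 e2' with h0 | h0
    · subst h0
      simpa [hc0] using e3'
    · subst h0
      simpa [hr0] using e3'
  simp [hz.1, hz.2] at h001

theorem three_le_tensorRank_W₃ : 3 ≤ tensorRank W₃ := by
  refine le_sInf ?_
  rintro _ ⟨r, x, hx, rfl⟩
  by_contra hr
  -- Sums of fewer than two products are padded with the zero product.
  have h0 : tensorProd (0 : Fin 3 → EuclideanSpace ℂ (Fin 2)) = 0 :=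
    norm_eq_zero.1 (by simp [norm_tensorProd])
  have hr : r < 3 := by
    rw [not_le] at hr
    exact_mod_cast hr
  interval_cases r
  · exact W₃_ne_two_products 0 0 (by simp [hx, h0])
  · exact W₃_ne_two_products (x 0) 0 (by simp [hx, h0])
  · exact W₃_ne_two_products (x 0) (x 1) (by simp [hx])

theorem rank_W₃ : tensorRank W₃ = 3 ∧ nuclearRank W₃ = 3 := by
  have h1 : nuclearRank W₃ ≤ 3 := nuclearRank_le (W₃_decomposition rfl rfl).2
  have h2 := tensorRank_le_nuclearRank W₃
  exact ⟨le_antisymm (h2.trans h1) three_le_tensorRank_W₃,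
    le_antisymm h1 (three_le_tensorRank_W₃.trans h2)⟩

/-! ### The action of matrices on cubics, and the two stabilizers. -/

theorem matAct_apply_three (A : Matrix (Fin 2) (Fin 2) ℂ) (T : Tensor 3 2) (i j k : Fin 2) :
    matAct A T ![i, j, k] = ∑ l : Fin 3 → Fin 2, A i (l 0) * A j (l 1) * A k (l 2) * T l := by
  simp [matAct, Fin.prod_univ_three]

theorem matAct_symCubic (A : Matrix (Fin 2) (Fin 2) ℂ) (a b c d : ℂ) :
    matAct A (symCubic a b c d) = symCubic
      (A 0 0 ^ 3 * a + 3 * A 0 0 ^ 2 * A 0 1 * b + 3 * A 0 0 * A 0 1 ^ 2 * c + A 0 1 ^ 3 * d)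
      (A 0 0 ^ 2 * A 1 0 * a + (A 0 0 ^ 2 * A 1 1 + 2 * A 0 0 * A 0 1 * A 1 0) * b +
        (2 * A 0 0 * A 0 1 * A 1 1 + A 0 1 ^ 2 * A 1 0) * c + A 0 1 ^ 2 * A 1 1 * d)
      (A 0 0 * A 1 0 ^ 2 * a + (2 * A 0 0 * A 1 0 * A 1 1 + A 0 1 * A 1 0 ^ 2) * b +
        (A 0 0 * A 1 1 ^ 2 + 2 * A 0 1 * A 1 0 * A 1 1) * c + A 0 1 * A 1 1 ^ 2 * d)
      (A 1 0 ^ 3 * a + 3 * A 1 0 ^ 2 * A 1 1 * b + 3 * A 1 0 * A 1 1 ^ 2 * c + A 1 1 ^ 3 * d) := by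
  refine tensor_ext fun i j k => ?_
  rw [matAct_apply_three, sum_index]
  simp only [symCubic_apply, Matrix.cons_val_zero, Matrix.cons_val_one, Matrix.cons_val]
  revert i j k
  simp only [Fin.forall_fin_two, Matrix.cons_val_zero, Matrix.cons_val_one]
  refine ⟨⟨⟨?_, ?_⟩, ?_, ?_⟩, ⟨?_, ?_⟩, ?_, ?_⟩ <;> ring

theorem matAct_diagMat (ζ a b c d : ℂ) : matAct (diagMat ζ) (symCubic a b c d) =
    symCubic (ζ ^ 3 * a) (ζ ^ 2 * conj ζ ^ 2 * b) (ζ * conj ζ ^ 4 * c) (conj ζ ^ 6 * d) := by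
  rw [matAct_symCubic, symCubic_inj]
  simp only [diagMat, Matrix.of_apply, Matrix.cons_val', Matrix.cons_val_zero, Matrix.cons_val_one,
    Matrix.cons_val_fin_one]
  refine ⟨by ring, by ring, by ring, by ring⟩

theorem matAct_diagMat_facePoint {ζ : ℂ} (h : ‖ζ‖ = 1) (x y : ℂ) :
    matAct (diagMat ζ) (facePoint x y) = facePoint (ζ ^ 3 * x) (ζ ^ 6 * y) := by
  have hc := mul_conj_of_norm_one h
  rw [facePoint, matAct_diagMat, facePoint, symCubic_inj]
  simp only [map_mul, map_pow]
  refine ⟨by ring, ?_, ?_, by ring⟩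
  · linear_combination ((cP : ℂ) ^ 2 * cQ) * (ζ * conj ζ + 1) * hc
  · linear_combination ((cP : ℂ) * cQ ^ 2 * conj x * conj ζ ^ 3) * hc

/-- The entry at `001` forces `V 0 0 ≠ 0`, the entry at `000` then forces `V 0 1 = 0`, and unitarity
gives `V 1 0 = 0`. What remains is `V 0 0 ^ 2 * V 1 1 = 1`. -/
theorem mem_tensorStabilizer_W₃ (V : U 2) :
    V ∈ tensorStabilizer W₃ ↔ ∃ ζ : ℂ, ‖ζ‖ = 1 ∧ V.1 = diagMat ζ := by
  change matAct V.1 W₃ = W₃ ↔ _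
  constructor
  · intro h
    rw [W₃_eq, matAct_symCubic, symCubic_inj] at h
    obtain ⟨h1, h2, -, -⟩ := h
    have hV := Matrix.mem_unitaryGroup_iff.1 V.2
    have hV00 := congrFun (congrFun hV 0) 0
    have hV01 := congrFun (congrFun hV 0) 1
    simp only [Matrix.mul_apply, Fin.sum_univ_two, Matrix.star_apply, Matrix.one_apply_eq,
      RCLike.star_def] at hV00 hV01
    rw [Matrix.one_apply_ne (by decide)] at hV01
    have hα : V.1 0 0 ≠ 0 := fun h0 => by simp [h0] at h2
    have hβ : V.1 0 1 = 0 := by simpa [hα] using h1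
    rw [hβ] at h2 hV00 hV01
    have hγ : V.1 1 0 = 0 := by simpa [hα] using hV01
    have hn : V.1 0 0 * conj (V.1 0 0) = 1 := by simpa using hV00
    refine ⟨V.1 0 0, ?_, ?_⟩
    · have : ‖V.1 0 0‖ ^ 2 = 1 ^ 2 := by
        rw [Complex.mul_conj, Complex.normSq_eq_norm_sq] at hn
        rw [one_pow]
        exact_mod_cast hn
      exact (pow_left_inj₀ (norm_nonneg _) zero_le_one two_ne_zero).1 this
    · have hδ : V.1 1 1 = conj (V.1 0 0) ^ 2 := by
        linear_combination conj (V.1 0 0) ^ 2 * h2 -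
          V.1 1 1 * (V.1 0 0 * conj (V.1 0 0) + 1) * hn
      rw [Matrix.eta_fin_two V.1, diagMat, hβ, hγ, hδ]
      simp
  · rintro ⟨ζ, hζ, h⟩
    have hc := mul_conj_of_norm_one hζ
    rw [h, W₃_eq, matAct_diagMat, symCubic_inj]
    refine ⟨by ring, ?_, by ring, by ring⟩
    linear_combination (ζ * conj ζ + 1) * hc

theorem inner_matAct {d n : ℕ} (A : Matrix (Fin n) (Fin n) ℂ) (S T : Tensor d n) :
    inner ℂ S (matAct A T) = inner ℂ (matAct (star A) S) T := by
  simp only [inner_tensor, matAct, map_sum, map_mul, map_prod, Finset.sum_mul, Finset.mul_sum,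
    Matrix.star_apply, RCLike.star_def, Complex.conj_conj]
  rw [Finset.sum_comm]
  exact Finset.sum_congr rfl fun k _ => Finset.sum_congr rfl fun i _ => by ring

theorem norm_matAct {d n : ℕ} (V : U n) (T : Tensor d n) : ‖matAct V.1 T‖ = ‖T‖ := by
  have h : inner ℂ (matAct V.1 T) (matAct V.1 T) = inner ℂ T T := by
    rw [inner_matAct, ← matAct_mul, Matrix.mem_unitaryGroup_iff'.1 V.2, matAct_one]
  rw [inner_self_eq_norm_sq_to_K, inner_self_eq_norm_sq_to_K] at h
  have h' : ‖matAct V.1 T‖ ^ 2 = ‖T‖ ^ 2 := by exact_mod_cast h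
  exact (pow_left_inj₀ (norm_nonneg _) (norm_nonneg _) two_ne_zero).1 h'

theorem norm_sq_symCubic (a b c d : ℂ) :
    ‖symCubic a b c d‖ ^ 2 = ‖a‖ ^ 2 + 3 * ‖b‖ ^ 2 + 3 * ‖c‖ ^ 2 + ‖d‖ ^ 2 := by
  rw [EuclideanSpace.norm_sq_eq, sum_index]
  simp only [symCubic_apply, Matrix.cons_val_zero, Matrix.cons_val_one]
  ring

/-- `facePoint 0 0`, a multiple of `W₃`, is the unique shortest point, since the coordinates `x, y`
enter entries orthogonal to it. Unitaries act isometrically, so one that preserves the face must fix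
this point. -/
theorem eq_zero_of_norm_facePoint_le {x y : ℂ} (h : ‖facePoint x y‖ ≤ ‖facePoint 0 0‖) :
    x = 0 ∧ y = 0 := by
  have h2 : ‖facePoint x y‖ ^ 2 ≤ ‖facePoint 0 0‖ ^ 2 := by gcongr
  simp only [facePoint, norm_sq_symCubic, norm_mul, norm_pow, Complex.norm_real, map_zero,
    norm_zero, mul_zero, Complex.norm_conj, Real.norm_of_nonneg cP_pos.le,
    Real.norm_of_nonneg cQ_pos.le, mul_pow] at h2
  have hP := cP_pos
  have hQ := cQ_pos
  have p1 : 0 ≤ (cP ^ 3) ^ 2 * ‖x‖ ^ 2 := by positivity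
  have p2 : 0 ≤ cP ^ 2 * (cQ ^ 2) ^ 2 * ‖x‖ ^ 2 := by positivity
  have p3 : 0 ≤ (cQ ^ 3) ^ 2 * ‖y‖ ^ 2 := by positivity
  have z1 : (cP ^ 3) ^ 2 * ‖x‖ ^ 2 = 0 := by linarith
  have z3 : (cQ ^ 3) ^ 2 * ‖y‖ ^ 2 = 0 := by linarith
  constructor
  · simpa [hP.ne'] using z1
  · simpa [hQ.ne'] using z3

theorem matAct_smul {d n : ℕ} (A : Matrix (Fin n) (Fin n) ℂ) (c : ℂ) (T : Tensor d n) :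
    matAct A (c • T) = c • matAct A T := by
  ext i
  simp only [matAct, PiLp.smul_apply, smul_eq_mul, Finset.mul_sum]
  exact Finset.sum_congr rfl fun k _ => by ring

theorem facePoint_zero : facePoint 0 0 = ((cP : ℂ) ^ 2 * cQ) • W₃ := by
  rw [facePoint, W₃_eq, symCubic_smul]
  simp

theorem mem_setStabilizer_face (V : U 2) :
    V ∈ setStabilizer (face W₃) ↔ ∃ ζ : ℂ, ‖ζ‖ = 1 ∧ V.1 = diagMat ζ := by
  have hsub : ∀ V : U 2, V ∈ tensorStabilizer W₃ → ∀ S ∈ face W₃, matAct V.1 S ∈ face W₃ := by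
    intro V hV S hS
    obtain ⟨ζ, hζ, h⟩ := (mem_tensorStabilizer_W₃ V).1 hV
    rw [face_W₃_eq] at hS
    obtain ⟨x, y, ⟨h1, h2⟩, rfl⟩ := hS
    rw [h, matAct_diagMat_facePoint hζ]
    refine facePoint_mem_face ⟨?_, ?_⟩
    · simpa [hζ] using h1
    · simp only at h2 ⊢
      rw [show ζ ^ 6 * y - (ζ ^ 3 * x) ^ 2 = ζ ^ 6 * (y - x ^ 2) by ring]
      simpa [hζ] using h2
  constructor
  · intro h
    have h : matAct V.1 '' face W₃ = face W₃ := h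
    have h0 := h ▸ Set.mem_image_of_mem (matAct V.1) (facePoint_mem_face zero_mem_faceRegion)
    rw [face_W₃_eq] at h0
    obtain ⟨x, y, -, e⟩ := h0
    have hn := norm_matAct V (facePoint 0 0)
    rw [e] at hn
    obtain ⟨rfl, rfl⟩ := eq_zero_of_norm_facePoint_le hn.le
    rw [facePoint_zero, matAct_smul] at e
    refine (mem_tensorStabilizer_W₃ V).1 (smul_right_injective _ ?_ e)
    have := cP_pos
    have := cQ_pos
    exact_mod_cast (by positivity : cP ^ 2 * cQ ≠ 0)
  · intro h
    have hV := (mem_tensorStabilizer_W₃ V).2 h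
    refine Set.Subset.antisymm (Set.image_subset_iff.2 (hsub V hV)) fun S hS =>
      ⟨matAct (V⁻¹ : U 2).1 S, hsub _ (inv_mem hV) S hS, ?_⟩
    have := act_inv_act V⁻¹ S
    rwa [inv_inv] at this

theorem diagMat_mem_unitaryGroup {ζ : ℂ} (h : ‖ζ‖ = 1) :
    diagMat ζ ∈ Matrix.unitaryGroup (Fin 2) ℂ := by
  have hc := mul_conj_of_norm_one h
  rw [Matrix.mem_unitaryGroup_iff]
  ext i j
  fin_cases i <;> fin_cases j <;> simp [diagMat, Matrix.mul_apply, hc]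
  linear_combination (ζ * conj ζ + 1) * hc

/-- The homomorphism `ζ ↦ diag(ζ, ζ̄²)` from the circle to the stabilizer of `W₃`. -/
noncomputable def circleHom : Circle →* tensorStabilizer W₃ where
  toFun ζ := ⟨⟨diagMat ζ, diagMat_mem_unitaryGroup ζ.norm_coe⟩,
    (mem_tensorStabilizer_W₃ _).2 ⟨ζ, ζ.norm_coe, rfl⟩⟩
  map_one' := by
    refine Subtype.ext (Subtype.ext ?_)
    ext i j
    fin_cases i <;> fin_cases j <;> simp [diagMat]
  map_mul' ζ ξ := by
    refine Subtype.ext (Subtype.ext ?_)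
    change diagMat _ = diagMat _ * diagMat _
    ext i j
    fin_cases i <;> fin_cases j <;> simp [diagMat, Matrix.mul_apply, mul_pow]

theorem circleHom_bijective : Function.Bijective circleHom := by
  constructor
  · intro ζ ξ h
    have : diagMat ζ = diagMat ξ := congrArg (fun V : tensorStabilizer W₃ => V.1.1) h
    have := congrFun (congrFun this 0) 0
    exact Circle.ext (by simpa [diagMat] using this)
  · rintro ⟨V, hV⟩
    obtain ⟨ζ, hζ, h⟩ := (mem_tensorStabilizer_W₃ V).1 hV
    exact ⟨⟨ζ, mem_sphere_zero_iff_norm.2 hζ⟩, Subtype.ext (Subtype.ext h.symm)⟩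

theorem continuous_circleHom : Continuous circleHom := by
  refine Continuous.subtype_mk (Continuous.subtype_mk ?_ _) _
  refine continuous_matrix fun i j => ?_
  fin_cases i <;> fin_cases j <;> simp [diagMat] <;> fun_prop

theorem exists_circle_equiv :
    ∃ e : Circle ≃ₜ* tensorStabilizer W₃, ∀ ζ : Circle, (e ζ).1.1 = diagMat ζ := by
  let e := MulEquiv.ofBijective circleHom circleHom_bijective
  have hc : Continuous e.toEquiv := continuous_circleHom
  exact ⟨{ e with
    continuous_toFun := hc
    -- A continuous bijection from a compact space to a Hausdorff space is a homeomorphism.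
    continuous_invFun := (hc.homeoOfEquivCompactToT2).continuous_symm }, fun ζ => rfl⟩

end NuclearFace

/-! ### The orbit of the face: semialgebraicity and the upper bound on its dimension. -/

namespace NuclearFace

open scoped ComplexConjugate

/-- The union of the translates of the face under the unitary group. -/
def faceOrbit : Set (Tensor 3 2) := ⋃ V : U 2, matAct V.1 '' face W₃

/-- Applying the inverse to `S` leaves only the entries of `M` under the existential quantifier,
with polynomial conditions: the shape needed for elimination. -/
theorem mem_faceOrbit_iff {S : Tensor 3 2} :
    S ∈ faceOrbit ↔ ∃ M : Matrix (Fin 2) (Fin 2) ℂ, M * star M = 1 ∧ matAct (star M) S ∈ face W₃ := by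
  simp only [faceOrbit, Set.mem_iUnion]
  constructor
  · rintro ⟨V, T, hT, rfl⟩
    refine ⟨V.1, Matrix.mem_unitaryGroup_iff.1 V.2, ?_⟩
    rwa [← matAct_mul, Matrix.mem_unitaryGroup_iff'.1 V.2, matAct_one]
  · rintro ⟨M, hM, h⟩
    exact ⟨⟨M, Matrix.mem_unitaryGroup_iff.2 hM⟩, _, h, by rw [← matAct_mul, hM, matAct_one]⟩

/-- The face coordinates are recovered from the entries at `000` and `111`, and the norm
inequalities are squared to become polynomial; `‖x‖ ≤ 1` makes the right side nonnegative, so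
squaring loses nothing. -/
theorem mem_face_iff_poly {S : Tensor 3 2} : S ∈ face W₃ ↔
    (∀ i, S i = facePoint (((cP ^ 3)⁻¹ : ℝ) * S ![0, 0, 0])
      (((cQ ^ 3)⁻¹ : ℝ) * conj (S ![1, 1, 1])) i) ∧
    ‖(((cP ^ 3)⁻¹ : ℝ) : ℂ) * S ![0, 0, 0]‖ ^ 2 ≤ 1 ∧
    ‖(((cQ ^ 3)⁻¹ : ℝ) : ℂ) * conj (S ![1, 1, 1]) - ((((cP ^ 3)⁻¹ : ℝ) : ℂ) * S ![0, 0, 0]) ^ 2‖ ^ 2 ≤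
      (1 - ‖(((cP ^ 3)⁻¹ : ℝ) : ℂ) * S ![0, 0, 0]‖ ^ 2) ^ 2 := by
  have hP : (cP : ℂ) ≠ 0 := by exact_mod_cast cP_pos.ne'
  have hQ : (cQ : ℂ) ≠ 0 := by exact_mod_cast cQ_pos.ne'
  have hreg : ∀ x y : ℂ, (x, y) ∈ faceRegion ↔
      ‖x‖ ^ 2 ≤ 1 ∧ ‖y - x ^ 2‖ ^ 2 ≤ (1 - ‖x‖ ^ 2) ^ 2 := by
    intro x y
    rw [sq_le_one_iff₀ (norm_nonneg _)]
    refine and_congr_right fun h => ?_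
    have : 0 ≤ 1 - ‖x‖ ^ 2 := by nlinarith [norm_nonneg x]
    exact (pow_le_pow_iff_left₀ (norm_nonneg _) this two_ne_zero).symm
  rw [← hreg, face_W₃_eq]
  constructor
  · rintro ⟨x, y, h, rfl⟩
    have e1 : (((cP ^ 3)⁻¹ : ℝ) : ℂ) * facePoint x y ![0, 0, 0] = x := by
      simp [facePoint, symCubic_apply, hP]
    have e2 : (((cQ ^ 3)⁻¹ : ℝ) : ℂ) * conj (facePoint x y ![1, 1, 1]) = y := by
      simp [facePoint, symCubic_apply, hQ]
    rw [e1, e2]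
    exact ⟨fun i => rfl, h⟩
  · rintro ⟨h1, h2⟩
    exact ⟨_, _, h2, by ext i; exact h1 i⟩

theorem isSemialgebraic_faceOrbit : IsSemialgebraic (realCoords '' faceOrbit) := by
  let z₀ (z : ((Fin 3 → Fin 2) ⊕ (Fin 3 → Fin 2)) ⊕ Fin 8 → ℝ) : Tensor 3 2 :=
    WithLp.toLp 2 fun i => ⟨z (Sum.inl (Sum.inl i)), z (Sum.inl (Sum.inr i))⟩
  let M (z : ((Fin 3 → Fin 2) ⊕ (Fin 3 → Fin 2)) ⊕ Fin 8 → ℝ) : Matrix (Fin 2) (Fin 2) ℂ :=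
    !![⟨z (Sum.inr 0), z (Sum.inr 1)⟩, ⟨z (Sum.inr 2), z (Sum.inr 3)⟩;
      ⟨z (Sum.inr 4), z (Sum.inr 5)⟩, ⟨z (Sum.inr 6), z (Sum.inr 7)⟩]
  have pT : ∀ i, IsCPolyFun fun z => z₀ z i := fun i => ⟨.coord _, .coord _⟩
  have pM : ∀ i j, IsCPolyFun fun z => M z i j := by
    intro i j
    fin_cases i <;> fin_cases j <;> exact ⟨.coord _, .coord _⟩
  have pS : ∀ i, IsCPolyFun fun z => matAct (star (M z)) (z₀ z) i := by
    intro i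
    refine .sum _ fun k => .mul (.prod _ fun j => ?_) (pT k)
    exact (pM _ _).conj
  have hA : IsSemialgebraic {z | M z * star (M z) = 1 ∧ matAct (star (M z)) (z₀ z) ∈ face W₃} := by
    have h1 : IsSemialgebraic {z | M z * star (M z) = 1} := by
      have e : {z | M z * star (M z) = 1} =
          {z | ∀ k : Fin 2 × Fin 2, z ∈ {z | ∑ l, M z k.1 l * conj (M z k.2 l) =
            (1 : Matrix (Fin 2) (Fin 2) ℂ) k.1 k.2}} := by
        ext z
        simp only [Set.mem_ofPred_eq, ← Matrix.ext_iff, Matrix.mul_apply, Matrix.star_apply,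
          RCLike.star_def, Prod.forall]
      rw [e]
      exact isSemialgebraic_forall fun k => IsCPolyFun.isSemialgebraic_eq
        (.sum _ fun l => (pM _ _).mul (pM _ _).conj) (.const _)
    have px : IsCPolyFun fun z => (((cP ^ 3)⁻¹ : ℝ) : ℂ) * matAct (star (M z)) (z₀ z) ![0, 0, 0] :=
      (IsCPolyFun.const _).mul (pS _)
    have py : IsCPolyFun fun z =>
        (((cQ ^ 3)⁻¹ : ℝ) : ℂ) * conj (matAct (star (M z)) (z₀ z) ![1, 1, 1]) :=
      (IsCPolyFun.const _).mul (pS _).conj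
    have pF : ∀ {f g : (((Fin 3 → Fin 2) ⊕ (Fin 3 → Fin 2)) ⊕ Fin 8 → ℝ) → ℂ}, IsCPolyFun f →
        IsCPolyFun g → ∀ i, IsCPolyFun fun z => facePoint (f z) (g z) i := by
      intro f g hf hg
      have ha := (IsCPolyFun.const (cP ^ 3 : ℂ)).mul hf
      have hb := IsCPolyFun.const (ι := ((Fin 3 → Fin 2) ⊕ (Fin 3 → Fin 2)) ⊕ Fin 8) (cP ^ 2 * cQ : ℂ)
      have hc := (IsCPolyFun.const (cP * cQ ^ 2 : ℂ)).mul hf.conj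
      have hd := (IsCPolyFun.const (cQ ^ 3 : ℂ)).mul hg.conj
      rw [forall_index]
      exact ⟨⟨ha, hb, hb, hc⟩, hb, hc, hc, hd⟩
    have h2 := ((isSemialgebraic_forall fun i => (pS i).isSemialgebraic_eq (pF px py i)).inter
      ((px.normSq.isSemialgebraic_le (.const 1)).inter
        ((py.sub (px.pow 2)).normSq.isSemialgebraic_le (((IsPolyFun.const 1).sub px.normSq).pow 2))))
    convert h1.inter h2 using 1
    ext z
    simp only [Set.mem_ofPred_eq, Set.mem_inter_iff, mem_face_iff_poly]
  -- The eight real coordinates of the matrix are eliminated by Tarski–Seidenberg.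
  convert hA.exists_fin using 1
  ext x
  constructor
  · rintro ⟨S, hS, rfl⟩
    obtain ⟨N, hN, h⟩ := mem_faceOrbit_iff.1 hS
    refine ⟨![(N 0 0).re, (N 0 0).im, (N 0 1).re, (N 0 1).im, (N 1 0).re, (N 1 0).im, (N 1 1).re,
      (N 1 1).im], ?_⟩
    set z := Sum.elim (realCoords S) ![(N 0 0).re, (N 0 0).im, (N 0 1).re, (N 0 1).im, (N 1 0).re,
      (N 1 0).im, (N 1 1).re, (N 1 1).im] with hz
    have e1 : M z = N := by
      rw [Matrix.eta_fin_two N]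
      simp [M, hz]
    have e2 : z₀ z = S := by
      ext i
      simp [z₀, hz, realCoords]
    change M z * star (M z) = 1 ∧ matAct (star (M z)) (z₀ z) ∈ face W₃
    rw [e1, e2]
    exact ⟨hN, h⟩
  · rintro ⟨v, h1, h2⟩
    refine ⟨_, mem_faceOrbit_iff.2 ⟨_, h1, h2⟩, ?_⟩
    ext (i | i) <;> simp [realCoords, z₀]

/-- `symCubic` as a continuous real-linear map. -/
noncomputable def symCubicCLM : (ℂ × ℂ × ℂ × ℂ) →L[ℝ] Tensor 3 2 :=
  LinearMap.toContinuousLinearMap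
    { toFun := fun p => symCubic p.1 p.2.1 p.2.2.1 p.2.2.2
      map_add' := fun p q => by rw [symCubic_add]; rfl
      map_smul' := fun t p => by
        rw [RingHom.id_apply, symCubic_real_smul]
        simp }

theorem contDiff_matAct {E : Type*} [NormedAddCommGroup E] [NormedSpace ℝ E]
    {α β γ δ x y : E → ℂ} (hα : ContDiff ℝ 1 α) (hβ : ContDiff ℝ 1 β) (hγ : ContDiff ℝ 1 γ)
    (hδ : ContDiff ℝ 1 δ) (hx : ContDiff ℝ 1 x) (hy : ContDiff ℝ 1 y) :
    ContDiff ℝ 1 fun p => matAct !![α p, β p; γ p, δ p] (facePoint (x p) (y p)) := by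
  have hx' : ContDiff ℝ 1 fun p => conj (x p) := Complex.conjCLE.contDiff.comp hx
  have hy' : ContDiff ℝ 1 fun p => conj (y p) := Complex.conjCLE.contDiff.comp hy
  simp only [facePoint, matAct_symCubic, Matrix.of_apply, Matrix.cons_val', Matrix.cons_val_zero,
    Matrix.cons_val_one, Matrix.cons_val_fin_one]
  refine symCubicCLM.contDiff.comp (ContDiff.prodMk ?_ (ContDiff.prodMk ?_ (ContDiff.prodMk ?_ ?_)))
  all_goals fun_prop

/-- For unimodular `ζ` the determinant of `diagMat ζ` is `conj ζ`, so the choice `ζ = conj (det V)`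
leaves a factor of determinant one. -/
theorem exists_special_mul_diagMat (V : U 2) : ∃ α γ ζ : ℂ, ‖ζ‖ = 1 ∧ ‖α‖ ^ 2 + ‖γ‖ ^ 2 = 1 ∧
    V.1 = !![α, -conj γ; γ, conj α] * diagMat ζ := by
  have hV := Matrix.mem_unitaryGroup_iff'.1 V.2
  have h00 := congrFun (congrFun hV 0) 0
  have h01 := congrFun (congrFun hV 0) 1
  have hdet : ‖V.1.det‖ = 1 := by
    have := Matrix.det_of_mem_unitary V.2
    exact CStarRing.norm_of_mem_unitary this
  simp only [Matrix.mul_apply, Fin.sum_univ_two, Matrix.star_apply, Matrix.one_apply_eq,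
    RCLike.star_def] at h00 h01
  rw [Matrix.one_apply_ne (by decide)] at h01
  rw [Matrix.det_fin_two] at hdet
  generalize hα : V.1 0 0 = α at *
  generalize hβ : V.1 0 1 = β at *
  generalize hγ : V.1 1 0 = γ at *
  generalize hδ : V.1 1 1 = δ at *
  set Δ := α * δ - β * γ with hΔ
  have hΔc := mul_conj_of_norm_one hdet
  have e1 : Δ * conj α = δ := by rw [hΔ]; linear_combination δ * h00 - γ * h01
  have e2 : Δ * conj γ = -β := by rw [hΔ]; linear_combination α * h01 - β * h00
  refine ⟨α * Δ, γ * Δ, conj Δ, by rwa [Complex.norm_conj], ?_, ?_⟩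
  · rw [norm_mul, norm_mul, hdet, mul_one, mul_one]
    have : ((‖α‖ ^ 2 + ‖γ‖ ^ 2 : ℝ) : ℂ) = 1 := by
      rw [← Complex.normSq_eq_norm_sq, ← Complex.normSq_eq_norm_sq, Complex.ofReal_add,
        ← Complex.mul_conj, ← Complex.mul_conj]
      linear_combination h00
    exact_mod_cast this
  · have f1 : α * Δ * conj Δ = α := by linear_combination α * hΔc
    have f2 : -conj (γ * Δ) * conj (conj Δ) ^ 2 = β := by
      rw [map_mul, Complex.conj_conj]
      linear_combination -e2 - Δ * conj γ * hΔc
    have f3 : γ * Δ * conj Δ = γ := by linear_combination γ * hΔc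
    have f4 : conj (α * Δ) * conj (conj Δ) ^ 2 = δ := by
      rw [map_mul, Complex.conj_conj]
      linear_combination e1 + Δ * conj α * hΔc
    rw [diagMat, Matrix.mul_fin_two, mul_zero, mul_zero, mul_zero, mul_zero, add_zero, zero_add,
      add_zero, zero_add, f1, f2, f3, f4, Matrix.eta_fin_two V.1, hα, hβ, hγ, hδ]

/-- Diagonal factors only move points within the face, so three angles for `SU(2)` and two complex
face coordinates suffice. A `C¹` image of a 7-dimensional real space has Hausdorff dimension at most
7. -/
theorem dimH_faceOrbit_le : dimH faceOrbit ≤ 7 := by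
  set g : ℝ × ℝ × ℝ × ℂ × ℂ → Tensor 3 2 := fun p =>
    matAct !![(Real.cos p.1 : ℂ) * Complex.exp (p.2.1 * Complex.I),
      -((Real.sin p.1 : ℂ) * Complex.exp (-(p.2.2.1 * Complex.I)));
      (Real.sin p.1 : ℂ) * Complex.exp (p.2.2.1 * Complex.I),
      (Real.cos p.1 : ℂ) * Complex.exp (-(p.2.1 * Complex.I))] (facePoint p.2.2.2.1 p.2.2.2.2) with hg
  have ofR : ∀ {f : ℝ × ℝ × ℝ × ℂ × ℂ → ℝ}, ContDiff ℝ 1 f → ContDiff ℝ 1 fun p => (f p : ℂ) :=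
    fun hf => Complex.ofRealCLM.contDiff.comp hf
  have hcos := ofR (f := fun p => Real.cos p.1) (by fun_prop)
  have hsin := ofR (f := fun p => Real.sin p.1) (by fun_prop)
  have h1 := ofR (f := fun p => p.2.1) (by fun_prop)
  have h2 := ofR (f := fun p => p.2.2.1) (by fun_prop)
  have hgd : ContDiff ℝ 1 g := by
    refine contDiff_matAct (hcos.mul ?_) (hsin.mul ?_).neg (hsin.mul ?_) (hcos.mul ?_) ?_ ?_
    · exact (h1.mul contDiff_const).cexp
    · exact (h2.mul contDiff_const).neg.cexp
    · exact (h2.mul contDiff_const).cexp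
    · exact (h1.mul contDiff_const).neg.cexp
    · fun_prop
    · fun_prop
  have hsub : faceOrbit ⊆ Set.range g := by
    intro S hS
    obtain ⟨V, T, hT, rfl⟩ := Set.mem_iUnion.1 hS
    obtain ⟨α, γ, ζ, hζ, hn, hV⟩ := exists_special_mul_diagMat V
    rw [face_W₃_eq] at hT
    obtain ⟨x, y, -, rfl⟩ := hT
    have hα1 : ‖α‖ ≤ 1 := by nlinarith [norm_nonneg α, sq_nonneg ‖γ‖]
    have hc : Real.cos (Real.arccos ‖α‖) = ‖α‖ :=
      Real.cos_arccos (by linarith [norm_nonneg α]) hα1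
    have hs : Real.sin (Real.arccos ‖α‖) = ‖γ‖ := by
      rw [Real.sin_arccos, ← hn, add_sub_cancel_left, Real.sqrt_sq (norm_nonneg _)]
    have hconj : ∀ z : ℂ, conj z = ‖z‖ * Complex.exp (-(z.arg * Complex.I)) := by
      intro z
      conv_lhs => rw [← Complex.norm_mul_exp_arg_mul_I z]
      rw [map_mul, Complex.conj_ofReal, ← Complex.exp_conj, map_mul, Complex.conj_ofReal,
        Complex.conj_I, mul_neg]
    -- The diagonal factor of `V` is absorbed into the face coordinates as `ζ ^ 3 * x` and `ζ ^ 6 *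
    -- y`.
    refine ⟨(Real.arccos ‖α‖, α.arg, γ.arg, ζ ^ 3 * x, ζ ^ 6 * y), ?_⟩
    simp only [hg]
    rw [hc, hs, ← hconj, ← hconj, Complex.norm_mul_exp_arg_mul_I, Complex.norm_mul_exp_arg_mul_I, hV,
      matAct_mul, matAct_diagMat_facePoint hζ]
  refine (dimH_mono hsub).trans (hgd.dimH_range_le.trans (le_of_eq ?_))
  simp [Complex.finrank_real_complex]

end NuclearFace

/-! ### The lower bound on the dimension of the orbit, by a local chart. -/

namespace NuclearFace

open scoped ComplexConjugate

/-- The matrix `[[1 + iτ, -γ̄], [γ, 1 - iτ]]`, a multiple of a special unitary matrix. -/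
noncomputable def quatMat (τ : ℝ) (γ : ℂ) : Matrix (Fin 2) (Fin 2) ℂ :=
  !![1 + Complex.I * τ, -conj γ; γ, 1 - Complex.I * τ]

/-- The norm of the quaternion of `quatMat`. -/
noncomputable def quatNorm (τ : ℝ) (γ : ℂ) : ℝ := Real.sqrt (1 + (τ ^ 2 + ‖γ‖ ^ 2))

theorem quatNorm_pos (τ : ℝ) (γ : ℂ) : 0 < quatNorm τ γ := Real.sqrt_pos.2 (by positivity)

theorem smul_quatMat_mem (τ : ℝ) (γ : ℂ) :
    ((quatNorm τ γ : ℂ)⁻¹) • quatMat τ γ ∈ Matrix.unitaryGroup (Fin 2) ℂ := by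
  have hN : (quatNorm τ γ : ℂ) ≠ 0 := by exact_mod_cast (quatNorm_pos τ γ).ne'
  have hN2 : (quatNorm τ γ : ℂ) ^ 2 = 1 + (τ ^ 2 + γ * conj γ) := by
    rw [Complex.mul_conj, Complex.normSq_eq_norm_sq]
    have : quatNorm τ γ ^ 2 = 1 + (τ ^ 2 + ‖γ‖ ^ 2) := Real.sq_sqrt (by positivity)
    exact_mod_cast this
  have hq : quatMat τ γ * star (quatMat τ γ) = ((quatNorm τ γ : ℂ) ^ 2) • 1 := by
    rw [hN2]
    ext i j
    fin_cases i <;> fin_cases j <;> simp [quatMat, Matrix.mul_apply] <;> ring_nf <;>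
      simp [Complex.I_sq]
  rw [Matrix.mem_unitaryGroup_iff, star_smul, smul_mul_smul_comm, hq, smul_smul]
  convert one_smul ℂ (1 : Matrix (Fin 2) (Fin 2) ℂ) using 2
  simp
  field_simp

theorem matAct_smul_left {d n : ℕ} (c : ℂ) (A : Matrix (Fin n) (Fin n) ℂ) (T : Tensor d n) :
    matAct (c • A) T = c ^ d • matAct A T := by
  ext i
  simp only [matAct, PiLp.smul_apply, smul_eq_mul, Matrix.smul_apply, Finset.mul_sum,
    Finset.prod_mul_distrib, Finset.prod_const, Finset.card_univ, Fintype.card_fin, mul_assoc]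

/-- Seven real coordinates of a symmetric tensor. -/
noncomputable def coordCLM : Tensor 3 2 →L[ℝ] ℝ × ℂ × ℂ × ℂ :=
  LinearMap.toContinuousLinearMap
    { toFun := fun S => ((S ![0, 0, 1]).im, S ![0, 0, 0], S ![0, 1, 1], S ![1, 1, 1])
      map_add' := fun S T => by simp
      map_smul' := fun t S => by simp }

/-- A chart of the orbit of the face, in the coordinates `coordCLM`. -/
noncomputable def orbitChart (p : ℝ × ℂ × ℂ × ℂ) : ℝ × ℂ × ℂ × ℂ :=
  (quatNorm p.1 p.2.1)⁻¹ ^ 3 • coordCLM (matAct (quatMat p.1 p.2.1) (facePoint p.2.2.1 p.2.2.2))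

theorem orbitChart_mem {p : ℝ × ℂ × ℂ × ℂ} (hp : p.2.2 ∈ faceRegion) :
    orbitChart p ∈ coordCLM '' faceOrbit := by
  refine ⟨matAct ((quatNorm p.1 p.2.1 : ℂ)⁻¹ • quatMat p.1 p.2.1) (facePoint p.2.2.1 p.2.2.2), ?_, ?_⟩
  · exact Set.mem_iUnion.2 ⟨⟨_, smul_quatMat_mem p.1 p.2.1⟩, _, facePoint_mem_face hp, rfl⟩
  · rw [matAct_smul_left, orbitChart, ← map_smul]
    congr 1
    ext i
    simp

theorem contDiff_orbitChart : ContDiff ℝ 1 orbitChart := by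
  have h1 : ContDiff ℝ 1 fun p : ℝ × ℂ × ℂ × ℂ => (p.1 : ℂ) :=
    Complex.ofRealCLM.contDiff.comp (by fun_prop)
  have h2 : ContDiff ℝ 1 fun p : ℝ × ℂ × ℂ × ℂ => conj p.2.1 :=
    Complex.conjCLE.contDiff.comp (by fun_prop)
  refine ContDiff.smul (ContDiff.pow (ContDiff.inv (ContDiff.sqrt ?_ fun p => ?_) fun p => ?_) 3)
    (coordCLM.contDiff.comp (contDiff_matAct ?_ ?_ ?_ ?_ ?_ ?_))
  · have h3 : ContDiff ℝ 1 fun p : ℝ × ℂ × ℂ × ℂ => ‖p.2.1‖ ^ 2 :=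
      ContDiff.norm_sq ℝ (f := fun p : ℝ × ℂ × ℂ × ℂ => p.2.1) (by fun_prop)
    fun_prop
  · positivity
  · exact (quatNorm_pos p.1 p.2.1).ne'
  all_goals fun_prop

/-- Once `t` is factored out of `F - c`, the derivative at `0` is the value `G 0`, so the long
polynomials below need not be differentiated. -/
theorem hasDerivAt_of_factor {F : ℝ → ℂ} {c g : ℂ} (G : ℂ → ℂ) (hG : DifferentiableAt ℂ G 0)
    (hF : ∀ t : ℝ, F t = c + t * G t) (hg : G 0 = g) : HasDerivAt F g 0 := by
  have h : HasDerivAt (fun z => c + z * G z) (G 0) ((0 : ℝ) : ℂ) := by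
    simpa using ((hasDerivAt_id (0 : ℂ)).mul hG.hasDerivAt).const_add c
  rw [← hg]
  exact h.comp_ofReal.congr_of_eventuallyEq (Filter.Eventually.of_forall hF)

/-- The normalization depends on `t` only through `t ^ 2`, so it does not contribute to the first
order at the origin. -/
theorem hasDerivAt_quatNorm (τ : ℝ) (γ : ℂ) :
    HasDerivAt (fun t : ℝ => (quatNorm (t * τ) (t * γ))⁻¹ ^ 3) 0 0 := by
  have h1 : HasDerivAt (fun t : ℝ => 1 + t ^ 2 * (τ ^ 2 + ‖γ‖ ^ 2)) 0 0 := by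
    have := (((hasDerivAt_id (0 : ℝ)).pow 2).mul_const (τ ^ 2 + ‖γ‖ ^ 2)).const_add 1
    simpa using this
  have h2 := ((h1.sqrt (by simp)).inv (by simp)).pow 3
  simp only [zero_div, neg_zero, mul_zero] at h2
  refine h2.congr_of_eventuallyEq (Filter.Eventually.of_forall fun t => ?_)
  simp only [Pi.pow_apply, Pi.inv_apply, quatNorm]
  congr 3
  rw [norm_mul, mul_pow, mul_pow, Complex.norm_real, Real.norm_eq_abs, sq_abs]
  ring

/-- The derivative of `orbitChart` at the origin. -/
theorem hasDerivAt_orbitChart (τ : ℝ) (γ x y : ℂ) :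
    HasDerivAt (fun t : ℝ => orbitChart (t • (τ, γ, x, y)))
      (cP ^ 2 * cQ * τ, cP ^ 3 * x - 3 * conj γ * (cP ^ 2 * cQ),
        2 * γ * (cP ^ 2 * cQ) + cP * cQ ^ 2 * conj x, cQ ^ 3 * conj y) 0 := by
  let S (t : ℝ) : Tensor 3 2 := matAct (quatMat (t * τ) (t * γ)) (facePoint (t * x) (t * y))
  have hS : ∀ t i j k, S t ![i, j, k] = symCubic _ _ _ _ ![i, j, k] := fun t i j k => by
    simp only [S, facePoint, matAct_symCubic]
    rfl
  have h0 : HasDerivAt (fun t => S t ![0, 0, 0])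
      (cP ^ 3 * x - 3 * conj γ * (cP ^ 2 * cQ)) 0 := by
    refine hasDerivAt_of_factor (c := 0) (fun z => (1 + z * (Complex.I * τ)) ^ 3 * (cP ^ 3 * x) -
      3 * (1 + z * (Complex.I * τ)) ^ 2 * conj γ * (cP ^ 2 * cQ) +
      3 * (1 + z * (Complex.I * τ)) * (z * conj γ) ^ 2 * (cP * cQ ^ 2 * conj x) -
      (z * conj γ) ^ 3 * (cQ ^ 3 * conj y)) (by fun_prop) (fun t => ?_) (by simp)
    simp only [hS, symCubic_apply, quatMat, Matrix.of_apply, Matrix.cons_val', Matrix.cons_val_zero,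
      Matrix.cons_val_one, Matrix.cons_val_fin_one, map_mul, Complex.conj_ofReal, Complex.ofReal_mul]
    ring
  have h1 : HasDerivAt (fun t => S t ![0, 0, 1]) (Complex.I * τ * (cP ^ 2 * cQ)) 0 := by
    refine hasDerivAt_of_factor (c := cP ^ 2 * cQ) (fun z =>
      (1 + z * (Complex.I * τ)) ^ 2 * (z * γ) * (cP ^ 3 * x) +
      (Complex.I * τ - z * (Complex.I * τ) ^ 2 - z ^ 2 * (Complex.I * τ) ^ 3 -
        2 * (1 + z * (Complex.I * τ)) * (z * conj γ) * γ) * (cP ^ 2 * cQ) +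
      (-2 * (1 + z * (Complex.I * τ)) * (z * conj γ) * (1 - z * (Complex.I * τ)) +
        (z * conj γ) ^ 2 * (z * γ)) * (cP * cQ ^ 2 * conj x) +
      (z * conj γ) ^ 2 * (1 - z * (Complex.I * τ)) * (cQ ^ 3 * conj y)) (by fun_prop) (fun t => ?_)
      (by simp)
    simp only [hS, symCubic_apply, quatMat, Matrix.of_apply, Matrix.cons_val', Matrix.cons_val_zero,
      Matrix.cons_val_one, Matrix.cons_val_fin_one, map_mul, Complex.conj_ofReal, Complex.ofReal_mul]
    ring
  have h2 : HasDerivAt (fun t => S t ![0, 1, 1])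
      (2 * γ * (cP ^ 2 * cQ) + cP * cQ ^ 2 * conj x) 0 := by
    refine hasDerivAt_of_factor (c := 0) (fun z =>
      (1 + z * (Complex.I * τ)) * (z * γ) ^ 2 * (cP ^ 3 * x) +
      (2 * (1 + z * (Complex.I * τ)) * γ * (1 - z * (Complex.I * τ)) -
        z * conj γ * (z * γ ^ 2)) * (cP ^ 2 * cQ) +
      ((1 + z * (Complex.I * τ)) * (1 - z * (Complex.I * τ)) ^ 2 -
        2 * (z * conj γ) * (z * γ) * (1 - z * (Complex.I * τ))) * (cP * cQ ^ 2 * conj x) -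
      z * conj γ * (1 - z * (Complex.I * τ)) ^ 2 * (cQ ^ 3 * conj y)) (by fun_prop) (fun t => ?_)
      (by simp)
    simp only [hS, symCubic_apply, quatMat, Matrix.of_apply, Matrix.cons_val', Matrix.cons_val_zero,
      Matrix.cons_val_one, Matrix.cons_val_fin_one, map_mul, Complex.conj_ofReal, Complex.ofReal_mul]
    ring
  have h3 : HasDerivAt (fun t => S t ![1, 1, 1]) (cQ ^ 3 * conj y) 0 := by
    refine hasDerivAt_of_factor (c := 0) (fun z => (z * γ) ^ 3 * (cP ^ 3 * x) +
      3 * (z * γ ^ 2) * (1 - z * (Complex.I * τ)) * (cP ^ 2 * cQ) +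
      3 * (z * γ) * (1 - z * (Complex.I * τ)) ^ 2 * (cP * cQ ^ 2 * conj x) +
      (1 - z * (Complex.I * τ)) ^ 3 * (cQ ^ 3 * conj y)) (by fun_prop) (fun t => ?_) (by simp)
    simp only [hS, symCubic_apply, quatMat, Matrix.of_apply, Matrix.cons_val', Matrix.cons_val_zero,
      Matrix.cons_val_one, Matrix.cons_val_fin_one, map_mul, Complex.conj_ofReal, Complex.ofReal_mul]
    ring
  have h1' : HasDerivAt (fun t => (S t ![0, 0, 1]).im) (cP ^ 2 * cQ * τ) 0 := by
    refine (Complex.imCLM.hasFDerivAt.comp_hasDerivAt (0 : ℝ) h1).congr_deriv ?_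
    rw [show Complex.I * τ * ((cP : ℂ) ^ 2 * cQ) = ((cP ^ 2 * cQ * τ : ℝ) : ℂ) * Complex.I by
      push_cast; ring]
    rw [Complex.imCLM_apply, Complex.im_ofReal_mul, Complex.I_im, mul_one]
  have hcurve : (fun t : ℝ => orbitChart (t • (τ, γ, x, y))) =
      (fun t : ℝ => (quatNorm (t * τ) (t * γ))⁻¹ ^ 3) • fun t =>
        ((S t ![0, 0, 1]).im, S t ![0, 0, 0], S t ![0, 1, 1], S t ![1, 1, 1]) := by
    ext1 t
    simp only [orbitChart, Prod.smul_mk, Complex.real_smul, smul_eq_mul]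
    rfl
  rw [hcurve]
  refine ((hasDerivAt_quatNorm τ γ).smul (h1'.prodMk (h0.prodMk (h2.prodMk h3)))).congr_deriv ?_
  have hN0 : quatNorm 0 0 = 1 := by simp [quatNorm]
  rw [zero_smul, add_zero, zero_mul, Complex.ofReal_zero, zero_mul, hN0, inv_one, one_pow, one_smul]

theorem dimH_faceOrbit_ge : 7 ≤ dimH faceOrbit := by
  have hstrict : HasStrictFDerivAt orbitChart (fderiv ℝ orbitChart 0) 0 :=
    contDiff_orbitChart.contDiffAt.hasStrictFDerivAt one_ne_zero
  have hinj : Function.Injective (fderiv ℝ orbitChart 0) := by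
    rw [injective_iff_map_eq_zero]
    rintro ⟨τ, γ, x, y⟩ h
    have hline : HasDerivAt (fun t : ℝ => t • (τ, γ, x, y)) (τ, γ, x, y) 0 := by
      simpa using (hasDerivAt_id (0 : ℝ)).smul_const (τ, γ, x, y)
    have hd : HasFDerivAt orbitChart (fderiv ℝ orbitChart 0) ((0 : ℝ) • (τ, γ, x, y)) := by
      rw [zero_smul]
      exact hstrict.hasFDerivAt
    have hcomp : HasDerivAt (fun t : ℝ => orbitChart (t • (τ, γ, x, y)))
        (fderiv ℝ orbitChart 0 (τ, γ, x, y)) 0 :=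
      HasFDerivAt.comp_hasDerivAt (f := fun t : ℝ => t • (τ, γ, x, y)) (0 : ℝ) hd hline
    have := hcomp.unique (hasDerivAt_orbitChart τ γ x y)
    rw [h] at this
    simp only [Prod.ext_iff, Prod.fst_zero, Prod.snd_zero] at this
    obtain ⟨e1, e2, e3, e4⟩ := this
    have hP : (cP : ℂ) ≠ 0 := by exact_mod_cast cP_pos.ne'
    have hQ : (cQ : ℂ) ≠ 0 := by exact_mod_cast cQ_pos.ne'
    have hP2 : (cP : ℂ) ^ 2 = 2 / 3 := by rw [← Complex.ofReal_pow, cP_sq]; norm_num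
    have hQ2 : (cQ : ℂ) ^ 2 = 1 / 3 := by rw [← Complex.ofReal_pow, cQ_sq]; norm_num
    have hτ : τ = 0 := by
      have := mul_eq_zero.1 e1.symm
      have := cP_pos
      have := cQ_pos
      have hne : cP ^ 2 * cQ ≠ 0 := by positivity
      tauto
    have hy : y = 0 := by simpa [hQ] using e4.symm
    have f2 : cP * x = 3 * conj γ * cQ := by
      refine mul_left_cancel₀ (pow_ne_zero 2 hP) ?_
      linear_combination -e2
    have f3 : cQ * x = -2 * conj γ * cP := by
      have e3' := congrArg conj e3
      simp only [map_zero, map_add, map_mul, map_pow, Complex.conj_ofReal, Complex.conj_conj,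
        map_ofNat] at e3'
      refine mul_left_cancel₀ (mul_ne_zero hP hQ) ?_
      linear_combination -e3'
    -- Eliminating `x` from `f2` and `f3` leaves `(3 * cQ ^ 2 + 2 * cP ^ 2) * conj γ = 0`, with
    -- coefficient `1 + 4/3 = 7/3`.
    have hγ : conj γ = 0 := by
      linear_combination (-3 / 7 : ℂ) * (cQ * f2 - cP * f3) - (9 / 7 : ℂ) * conj γ * hQ2 -
        (6 / 7 : ℂ) * conj γ * hP2
    have hγ0 : γ = 0 := by simpa using hγ
    have hx : x = 0 := by
      rw [hγ] at f3
      simpa [hQ] using f3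
    simp [hτ, hγ0, hx, hy]
  have hsurj : (fderiv ℝ orbitChart 0).range = ⊤ :=
    LinearMap.range_eq_top.2 ((LinearMap.injective_iff_surjective
      (f := (fderiv ℝ orbitChart 0 : (ℝ × ℂ × ℂ × ℂ) →ₗ[ℝ] (ℝ × ℂ × ℂ × ℂ)))).1 hinj)
  have hmap := hstrict.map_nhds_eq_of_surj hsurj
  have hreg : {p : ℝ × ℂ × ℂ × ℂ | p.2.2 ∈ faceRegion} ∈ nhds (0 : ℝ × ℂ × ℂ × ℂ) := by
    have hopen : IsOpen {p : ℝ × ℂ × ℂ × ℂ |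
        ‖p.2.2.1‖ < 1 ∧ ‖p.2.2.2 - p.2.2.1 ^ 2‖ < 1 - ‖p.2.2.1‖ ^ 2} :=
      IsOpen.and (isOpen_lt (by fun_prop) continuous_const) (isOpen_lt (by fun_prop) (by fun_prop))
    refine Filter.mem_of_superset (hopen.mem_nhds (by simp)) fun p hp => ⟨hp.1.le, hp.2.le⟩
  -- The chart is a local surjection at the origin, and points near the origin have face coordinates
  -- in the region, so the projected orbit contains an open set. A linear projection is Lipschitz
  -- and cannot raise Hausdorff dimension.
  have hmem : coordCLM '' faceOrbit ∈ nhds (orbitChart 0) := by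
    rw [← hmap, Filter.mem_map]
    exact Filter.mem_of_superset hreg fun p hp => orbitChart_mem (p := p) hp
  have hdim := Real.dimH_of_nonempty_interior ⟨_, mem_interior_iff_mem_nhds.2 hmem⟩
  have hle := coordCLM.lipschitz.dimH_image_le faceOrbit
  rw [hdim] at hle
  refine le_trans (le_of_eq ?_) hle
  simp [Complex.finrank_real_complex]

end NuclearFace

theorem mainTheorem1 :
    -- the set in question is an exposed face of the ball
    IsExposed ℝ (symNuclearBall 3 2) (face W₃) ∧
    -- its real dimension
    ((face W₃).Nonempty ∧ Module.finrank ℝ (vectorSpan ℝ (face W₃)) = 4) ∧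
    -- the nuclear decomposition, the rank and the nuclear rank
    (∀ (ζ : ℂ) (c : ℂ), ζ = Complex.exp (2 * Real.pi * Complex.I / 9) →
        c = ((Real.sqrt 3 / 2 : ℝ) : ℂ) →
        W₃ = c • (tensorPow 3 (wVec 1) + tensorPow 3 (wVec ζ) +
          tensorPow 3 (wVec (starRingEnd ℂ ζ))) ∧
        IsNuclearDecomposition W₃
          ![![c • wVec 1, wVec 1, wVec 1],
            ![c • wVec ζ, wVec ζ, wVec ζ],
            ![c • wVec (starRingEnd ℂ ζ), wVec (starRingEnd ℂ ζ), wVec (starRingEnd ℂ ζ)]]) ∧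
    (tensorRank W₃ = 3 ∧ nuclearRank W₃ = 3) ∧
    -- the nuclear rank on the face
    (∀ S ∈ face W₃, nuclearRank S ≤ 4) ∧
    -- the stabilizers
    ((∀ V : U 2, V ∈ tensorStabilizer W₃ ↔ ∃ ζ : ℂ, ‖ζ‖ = 1 ∧ V.1 = diagMat ζ) ∧
      (∀ V : U 2, V ∈ setStabilizer (face W₃) ↔ ∃ ζ : ℂ, ‖ζ‖ = 1 ∧ V.1 = diagMat ζ) ∧
      ∃ e : Circle ≃ₜ* tensorStabilizer W₃, ∀ ζ : Circle, (e ζ).1.1 = diagMat ζ) ∧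
    -- the union of the translated faces
    (IsSemialgebraic (realCoords '' ⋃ V : U 2, matAct V.1 '' face W₃) ∧
      dimH (⋃ V : U 2, matAct V.1 '' face W₃) = 7) :=
  ⟨isExposed_face_W₃, ⟨⟨_, facePoint_mem_face zero_mem_faceRegion⟩, finrank_vectorSpan_face_W₃⟩,
    fun _ _ hζ hc => W₃_decomposition hζ hc, rank_W₃,
    fun _ hS => nuclearRank_le_four_of_mem_face hS,
    ⟨mem_tensorStabilizer_W₃, mem_setStabilizer_face, exists_circle_equiv⟩,
    isSemialgebraic_faceOrbit, le_antisymm dimH_faceOrbit_le dimH_faceOrbit_ge⟩
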